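/- Running times are counted on a unit-cost random access machine (registers and arrays of natural numbers, assignments, comparisons, addition, truncated subtraction, conditionals, while loops; every elementary operation costs one step). A simple graph $G$ on $n$ vertices with $m$ edges is given by $n$, $m$ and a list of its edges in arbitrary order and orientation; all other memory cells are arbitrary. $G$ is $k$-edge-connected if deleting fewer than $k$ edges never disconnects it. For an edge $e=\{u,v\}$ and an integer $k\ge 1$, the procedure HandleDeletion$(e)$ does the following. It replaces $G$ by $G'=G\setminus\{e\}$ and computes, by Dinic's algorithm (phases consisting of a breadth-first search for the level graph and a depth-first search for a blocking flow), a maximum $u$–$v$ flow $f$ in the network in which each edge of $G'$ is a pair of opposite arcs of capacity $1$. If $|f|\ne k-1$, it stops with $G''=G'$ (for $k$-edge-connected $G$ this is the case $|f|\ge k$). If $|f|=k-1$, let $S$ be the set of vertices reachable from $u$, and $T$ the set of vertices from which $v$ is reachable, in the residual graph. If $S=\{u\}$ and $T=\{v\}$, it chooses a vertex $w\notin\{u,v\}$ and puts $G''=G'\cup\{\{u,w\},\{w,v\}\}$ (and $G''=G'$ if there is no such $w$, i.e. $n=2$). Otherwise it chooses $u'\in S$, $v'\in T$ with $\{u',v'\}\ne\{u,v\}$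 and puts $G''=G'\cup\{\{u',v'\}\}$. Here $\cup$ is the union of simple graphs. Claim. There are explicit programs for HandleDeletion and for the Nagamochi–Ibaraki sparsification algorithm (repeatedly scan an unscanned node $x$ of largest rank; each unscanned edge $xy$ joins the forest number $r(y)+1$ and the ranks are updated; keep the first $k$ forests), and an absolute constant $C>0$, such that for all $n$, all $k\ge1$ and every $k$-edge-connected simple graph $G$ with $n$ vertices and $m$ edges: (1) For every edge $e=\{u,v\}$ of $G$, HandleDeletion$(e)$ halts after at most $C\cdot\min(n^{2/3},m^{1/2})\cdot m$ steps, having computed the value of a maximum flow $f$ and a graph $G''$ as described above. (2) If $m\ge1$, the sparsification program, run once on $G$ as preprocessing, halts after at most $C\cdot m$ steps with a $k$-edge-connected spanning subgraph $H\subseteq G$ that has at most $kn$ edges. Afterwards, for every edge $e=\{u,v\}$ of $G$, HandleDeletion$(e)$ run on $H$ instead of $G$ (if $e\notin H$, then $H\setminus\{e\}=H$) halts after at most $C\cdot k\cdot n^{5/3}$ steps, having computed the value of a maximum flow in $H\setminus\{e\}$ and a graph $H''$ as described above. -/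

import Mathlib

/-! ## A unit-cost random access machine

A machine has finitely many registers and finitely many arrays of natural numbers.  Programs are
built from assignments, array writes, conditionals and while loops; expressions use constants,
registers, array reads, addition and truncated subtraction.  Every elementary operation costs one
step: an assignment, a write or a test costs one step plus one step for each node of the expressions
that it evaluates. -/

/-- The registers. -/
inductive Reg
  | n | m | k | u | v | flow | i | j | x | y | a | b | p | q | qh | qt | depth | found | top | fin
  deriving DecidableEq

/-- The arrays. -/
inductive Arr
  | src | dst | head | nxt | target | rev | res | level | queue | cur | path | inS | inT
  | rank | scanned | used | keep | bucket | entNode | entNext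
  deriving DecidableEq

/-- A memory state: contents of the registers and of the arrays. -/
@[ext]
structure State where
  reg : Reg → ℕ
  arr : Arr → ℕ → ℕ

def State.setReg (s : State) (r : Reg) (c : ℕ) : State :=
  { s with reg := Function.update s.reg r c }

def State.setArr (s : State) (t : Arr) (idx c : ℕ) : State :=
  { s with arr := Function.update s.arr t (Function.update (s.arr t) idx c) }

/-- Arithmetic expressions. -/
inductive Expr
  | const (c : ℕ)
  | reg (r : Reg)
  | get (t : Arr) (idx : Expr)
  | add (e₁ e₂ : Expr)
  | sub (e₁ e₂ : Expr)

def Expr.eval (s : State) : Expr → ℕ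
  | .const c => c
  | .reg r => s.reg r
  | .get t idx => s.arr t (idx.eval s)
  | .add e₁ e₂ => e₁.eval s + e₂.eval s
  | .sub e₁ e₂ => e₁.eval s - e₂.eval s

def Expr.cost : Expr → ℕ
  | .const _ => 1
  | .reg _ => 1
  | .get _ idx => idx.cost + 1
  | .add e₁ e₂ => e₁.cost + e₂.cost + 1
  | .sub e₁ e₂ => e₁.cost + e₂.cost + 1

instance : Coe Reg Expr := ⟨Expr.reg⟩
instance (c : ℕ) : OfNat Expr c := ⟨Expr.const c⟩
instance : Add Expr := ⟨Expr.add⟩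
instance : Sub Expr := ⟨Expr.sub⟩

/-- Tests. -/
inductive Test
  | lt (e₁ e₂ : Expr)
  | eq (e₁ e₂ : Expr)
  | not (c : Test)
  | and (c d : Test)
  | or (c d : Test)

def Test.eval (s : State) : Test → Prop
  | .lt e₁ e₂ => e₁.eval s < e₂.eval s
  | .eq e₁ e₂ => e₁.eval s = e₂.eval s
  | .not c => ¬ c.eval s
  | .and c d => c.eval s ∧ d.eval s
  | .or c d => c.eval s ∨ d.eval s

def Test.cost : Test → ℕ
  | .lt e₁ e₂ => e₁.cost + e₂.cost + 1
  | .eq e₁ e₂ => e₁.cost + e₂.cost + 1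
  | .not c => c.cost + 1
  | .and c d => c.cost + d.cost + 1
  | .or c d => c.cost + d.cost + 1

/-- Programs. -/
inductive Prog
  | skip
  | set (r : Reg) (e : Expr)
  | put (t : Arr) (idx e : Expr)
  | seq (P Q : Prog)
  | ite (c : Test) (P Q : Prog)
  | loop (c : Test) (P : Prog)

/-- `Exec P s s' t`: program `P`, started in state `s`, halts in state `s'` after exactly `t`
steps. -/
inductive Exec : Prog → State → State → ℕ → Prop
  | skip (s : State) : Exec .skip s s 1
  | set (s : State) (r : Reg) (e : Expr) :
      Exec (.set r e) s (s.setReg r (e.eval s)) (e.cost + 1)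
  | put (s : State) (t : Arr) (idx e : Expr) :
      Exec (.put t idx e) s (s.setArr t (idx.eval s) (e.eval s)) (idx.cost + e.cost + 1)
  | seq {P Q : Prog} {s s' s'' : State} {t t' : ℕ} :
      Exec P s s' t → Exec Q s' s'' t' → Exec (.seq P Q) s s'' (t + t')
  | ite_true {c : Test} {P Q : Prog} {s s' : State} {t : ℕ} :
      c.eval s → Exec P s s' t → Exec (.ite c P Q) s s' (c.cost + 1 + t)
  | ite_false {c : Test} {P Q : Prog} {s s' : State} {t : ℕ} :
      ¬ c.eval s → Exec Q s s' t → Exec (.ite c P Q) s s' (c.cost + 1 + t)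
  | loop_done {c : Test} {P : Prog} {s : State} :
      ¬ c.eval s → Exec (.loop c P) s s (c.cost + 1)
  | loop_step {c : Test} {P : Prog} {s s' s'' : State} {t t' : ℕ} :
      c.eval s → Exec P s s' t → Exec (.loop c P) s' s'' t' →
      Exec (.loop c P) s s'' (c.cost + 1 + t + t')

/-! ## The programs -/

namespace Prog

open Reg Arr Expr Test

/-- Sequential composition of a list of programs. -/
def block : List Prog → Prog
  | [] => skip
  | [P] => P
  | P :: Q :: Ps => seq P (block (Q :: Ps))

/-- `for r = 0, …, e - 1 do P`. -/
def upTo (r : Reg) (e : Expr) (P : Prog) : Prog :=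
  block [set r 0, loop (lt r e) (block [P, set r (r + 1)])]

/-- `if c then P`. -/
def when (c : Test) (P : Prog) : Prog := ite c P skip

/-- The `i`-th edge of the edge list has the end nodes stored in the registers `r` and `r'`. -/
def edgeIs (r r' : Reg) : Test :=
  or (and (eq (get src i) r) (eq (get dst i) r')) (and (eq (get src i) r') (eq (get dst i) r))

/-- `G := G \ {uv}`: a deleted entry of the edge list is overwritten by the last entry. -/
def removeEdge : Prog := block [
  set i 0,
  loop (lt i m) (ite (edgeIs u v)
    (block [set m (m - 1), put src i (get src m), put dst i (get dst m)])
    (set i (i + 1)))]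

/-- `G := G ∪ {pq}`: the edge is appended to the edge list unless it is present already. -/
def addEdge : Prog := block [
  set found 0,
  upTo i m (when (edgeIs p q) (set found 1)),
  when (eq found 0) (block [put src m p, put dst m q, set m (m + 1)])]

/-- Builds the network with zero flow.  The edge number `i` gives the two arcs `i` and `i + m`,
which point in opposite directions and have residual capacity `1` each.  The arcs that leave a node
form a linked list; an entry `a + 1` of `head` and `nxt` stands for the arc `a`, and `0` stands for
the end of the list. -/
def buildNetwork : Prog := block [
  upTo i n (put head i 0),
  upTo i m (block [
    put target i (get dst i),
    put res i 1,
    put rev i (i + m),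
    put nxt i (get head (get src i)),
    put head (get src i) (i + 1),
    put target (i + m) (get src i),
    put res (i + m) 1,
    put rev (i + m) i,
    put nxt (i + m) (get head (get dst i)),
    put head (get dst i) (i + m + 1)])]

/-- Breadth-first search from the node in the register `root`.  The arc `a - 1` is used if the
expression `cap` is positive.  In the end `mark[w]` is `0` if the node `w` has not been reached,
and otherwise its distance from the root plus one. -/
def search (root : Reg) (mark : Arr) (cap : Expr) : Prog := block [
  upTo i n (put mark i 0),
  put mark root 1,
  put queue 0 root,
  set qh 0,
  set qt 1,
  loop (lt qh qt) (block [
    set x (get queue qh),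
    set qh (qh + 1),
    set a (get head x),
    loop (lt 0 a) (block [
      set y (get target (a - 1)),
      when (and (lt 0 cap) (eq (get mark y) 0)) (block [
        put mark y (get mark x + 1),
        put queue qt y,
        set qt (qt + 1)]),
      set a (get nxt (a - 1))])])]

/-- The residual capacity of the arc `a - 1`. -/
def forward : Expr := get res (a - 1)

/-- The residual capacity of the reversal of the arc `a - 1`. -/
def backward : Expr := get res (get rev (a - 1))

/-- Pushes one unit of flow along the arcs `path[0], …, path[depth - 1]` from `u` to `v`. -/
def augment : Prog := block [
  loop (lt 0 depth) (block [
    set depth (depth - 1),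
    set a (get path depth),
    put res a (get res a - 1),
    put res (get rev a) (get res (get rev a) + 1)]),
  set flow (flow + 1),
  set x u]

/-- Depth-first search for a blocking flow in the level graph, with a pointer `cur` to the current
arc of each node: the search advances along an admissible arc, retreats from a node that has no
arcs left, and augments at `v`. -/
def blockingFlow : Prog := block [
  upTo i n (put cur i (get head i)),
  set x u,
  set depth 0,
  set fin 0,
  loop (eq fin 0)
    (ite (eq x v) augment
    (ite (eq (get cur x) 0)
      (ite (eq x u) (set fin 1)
        (block [
          set depth (depth - 1),
          set x (get target (get rev (get path depth))),
          put cur x (get nxt (get cur x - 1))]))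
      (block [
        set a (get cur x - 1),
        set y (get target a),
        ite (and (lt 0 (get res a)) (eq (get level y) (get level x + 1)))
          (block [put path depth a, set depth (depth + 1), set x y])
          (put cur x (get nxt a))])))]

/-- Dinic's algorithm for a maximum flow from `u` to `v` with unit capacities. -/
def dinicMaxFlow : Prog := block [
  buildNetwork,
  set flow 0,
  search u level forward,
  loop (lt 0 (get level v)) (block [
    blockingFlow,
    search u level forward])]

/-- Computes the nodes that are reachable from `u`, and the nodes from which `v` is reachable, in
the residual graph, and adds the augmenting edges. -/
def bridge : Prog := block [
  search u inS forward,
  search v inT backward,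
  set p u,
  set q v,
  upTo i n (when (and (lt 0 (get inS i)) (not (eq i u))) (set p i)),
  when (eq p u)
    (upTo i n (when (and (lt 0 (get inT i)) (not (eq i v))) (set q i))),
  ite (and (eq p u) (eq q v))
    (block [
      set j n,
      upTo i n (when (and (not (eq i u)) (not (eq i v))) (set j i)),
      when (lt j n) (block [
        set q j,
        addEdge,
        set p j,
        set q v,
        addEdge])])
    addEdge]

/-- The procedure HandleDeletion for the edge `uv`. -/
def handleDeletion : Prog := block [
  removeEdge,
  dinicMaxFlow,
  when (eq (flow + 1) k) bridge]

/-- Adds the node `y` to the bucket of its rank. -/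
def pushBucket : Prog := block [
  put entNode j y,
  put entNext j (get bucket (get rank y)),
  put bucket (get rank y) (j + 1),
  set j (j + 1)]

/-- Scans the node `x`: each unscanned edge `b = xy` joins the forest number `rank[y] + 1`, and is
kept if that number is at most `k`. -/
def scanNode : Prog := block [
  set a (get head x),
  loop (lt 0 a) (block [
    ite (lt (a - 1) m) (set b (a - 1)) (set b (a - 1 - m)),
    when (eq (get used b) 0) (block [
      set y (get target (a - 1)),
      when (lt (get rank y) k) (put keep b 1),
      when (eq (get rank x) (get rank y)) (put rank x (get rank x + 1)),
      put rank y (get rank y + 1),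
      put used b 1,
      pushBucket,
      when (lt top (get rank y)) (set top (get rank y))]),
    set a (get nxt (a - 1))]),
  put scanned x 1]

/-- The Nagamochi–Ibaraki algorithm: repeatedly scans an unscanned node of largest rank, found with
buckets, and finally replaces the edge list by the union of the first `k` forests. -/
def sparsify : Prog := block [
  buildNetwork,
  upTo i m (block [put used i 0, put keep i 0]),
  put bucket 0 0,
  upTo i n (block [put rank i 0, put scanned i 0, put bucket i 0]),
  set j 0,
  upTo y n pushBucket,
  set top 0,
  set fin 0,
  loop (eq fin 0)
    (ite (eq (get bucket top) 0)
      (ite (eq top 0) (set fin 1) (set top (top - 1)))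
      (block [
        set a (get bucket top - 1),
        set x (get entNode a),
        put bucket top (get entNext a),
        when (eq (get scanned x) 0) scanNode])),
  set j 0,
  upTo i m (when (lt 0 (get keep i)) (block [
    put src j (get src i),
    put dst j (get dst i),
    set j (j + 1)])),
  set m j]

end Prog

/-! ## What the programs compute -/

/-- The state `s` holds the graph `G` as a list of its edges, each edge once, in any order and with
its end nodes in any order.  All other memory cells are arbitrary. -/
structure Encodes {n : ℕ} (s : State) (G : SimpleGraph (Fin n)) : Prop where
  numNodes : s.reg .n = n
  numEdges : s.reg .m = G.edgeSet.ncard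
  sound : ∀ i < s.reg .m, ∃ x y : Fin n, G.Adj x y ∧ s.arr .src i = x ∧ s.arr .dst i = y
  complete : ∀ x y : Fin n, G.Adj x y → ∃ i < s.reg .m,
    (s.arr .src i = x ∧ s.arr .dst i = y) ∨ (s.arr .src i = y ∧ s.arr .dst i = x)

/-- `f` is an integral flow from `u` to `v` in the network in which every edge of `G` is a pair of
opposite arcs of capacity one.  Here `f x y` is the net flow from `x` to `y`. -/
structure IsUnitFlow {n : ℕ} (G : SimpleGraph (Fin n)) (u v : Fin n) (f : Fin n → Fin n → ℤ) :
    Prop where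
  skew : ∀ x y, f y x = - f x y
  support : ∀ x y, ¬ G.Adj x y → f x y = 0
  capacity : ∀ x y, f x y ≤ 1
  conservation : ∀ x, x ≠ u → x ≠ v → ∑ y, f x y = 0

/-- The value of a flow with source `u`. -/
def flowValue {n : ℕ} (u : Fin n) (f : Fin n → Fin n → ℤ) : ℤ := ∑ y, f u y

structure IsMaxUnitFlow {n : ℕ} (G : SimpleGraph (Fin n)) (u v : Fin n)
    (f : Fin n → Fin n → ℤ) : Prop where
  isFlow : IsUnitFlow G u v f
  maximal : ∀ g, IsUnitFlow G u v g → flowValue u g ≤ flowValue u f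

/-- The arc `(x, y)` has positive residual capacity `1 - f x y`. -/
def ResidualArc {n : ℕ} (G : SimpleGraph (Fin n)) (f : Fin n → Fin n → ℤ) (x y : Fin n) : Prop :=
  G.Adj x y ∧ 0 < 1 - f x y

/-- The nodes that are reachable from `u` in the residual graph. -/
def sourceSide {n : ℕ} (G : SimpleGraph (Fin n)) (f : Fin n → Fin n → ℤ) (u : Fin n) :
    Set (Fin n) :=
  {w | Relation.ReflTransGen (ResidualArc G f) u w}

/-- The nodes from which `v` is reachable in the residual graph. -/
def sinkSide {n : ℕ} (G : SimpleGraph (Fin n)) (f : Fin n → Fin n → ℤ) (v : Fin n) :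
    Set (Fin n) :=
  {w | Relation.ReflTransGen (ResidualArc G f) w v}

/-- `G''` is a possible outcome of HandleDeletion for the edge `uv` of `G` and the parameter `k`,
when `f` is the maximum flow that was found in `G' = G \ {uv}`.  If a node outside `{u, v}` is called
for and there is none, no edge is added. -/
def IsRestoration {n : ℕ} (G : SimpleGraph (Fin n)) (u v : Fin n) (k : ℕ)
    (f : Fin n → Fin n → ℤ) (G'' : SimpleGraph (Fin n)) : Prop :=
  let G' := G.deleteEdges {s(u, v)}
  let S := sourceSide G' f u
  let T := sinkSide G' f v
  (flowValue u f + 1 ≠ k → G'' = G') ∧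
  (flowValue u f + 1 = k →
    (S = {u} ∧ T = {v} →
      (∃ w, w ≠ u ∧ w ≠ v ∧ G'' = G' ⊔ SimpleGraph.edge u w ⊔ SimpleGraph.edge w v) ∨
      ((∀ w, w = u ∨ w = v) ∧ G'' = G')) ∧
    (¬ (S = {u} ∧ T = {v}) →
      ∃ u' ∈ S, ∃ v' ∈ T, u' ≠ v' ∧ s(u', v') ≠ s(u, v) ∧ G'' = G' ⊔ SimpleGraph.edge u' v'))

/-- The state `s` holds an input for HandleDeletion. -/
structure EncodesDeletion {n : ℕ} (s : State) (G : SimpleGraph (Fin n)) (k : ℕ) (u v : Fin n) :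
    Prop where
  graph : Encodes s G
  param : s.reg .k = k
  fst : s.reg .u = u
  snd : s.reg .v = v

/-! ## Program logic -/

-- The running time of HandleDeletion is that of Dinic's algorithm, since every other part is linear
-- in `n + m`. One phase costs `O(n + m)`: in the depth-first search every arc is passed at most
-- once, and an augmentation is paid for by the residual capacity that it takes from the level graph
-- (`blockingFlow_runs`). After a phase the level graph is blocked, so the distance from `u` to `v`
-- grows (`IsBFS.lt_of_blocked`), and every phase gains at least one unit of flow.
--
-- Fix `D` with `m < (D + 1)²` or `n² < (D + 1)³`. Once the distance exceeds `D`, the distance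
-- layers yield more than `D` cuts that no residual arc leaves except between consecutive layers.
-- The cuts share total residual capacity `2m`, and the layers share `n` nodes, so one of the cuts
-- is small and at most `2D + 2` units of flow are missing (`IsBFS.remaining_le`). Hence there are
-- `O(D)` phases (`dinicMaxFlow_runs`), and `D` can be taken of order `min(n^{2/3}, m^{1/2})`. A
-- connected graph has `n ≤ m + 1`, which turns `n + m` into `O(m)`. The final searches compute `S`
-- and `T`; they are separated by a saturated cut, so the added pair is never a loop
-- (`bridge_runs`).
--
-- For the sparsifier, the invariant `ForestInv` speaks of cuts instead of trees: for each cut and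
-- each `j`, either forest `j` crosses the cut or all active nodes of rank at least `j` lie on one
-- side. Scanning from a node of largest rank preserves this (`ForestInv.scanEdge`), and it implies
-- that a cut crossed by forest `i` is crossed by all lower forests. A cut that loses an edge
-- therefore keeps `k` others (`ForestInv.cut_kept`), which is enough for `k`-edge-connectivity
-- (`IsCutCertificate.isEdgeConnected`); acyclicity of the forests plays no role. Each kept edge is
-- charged to a rank increase capped at `k`, whence at most `kn` edges.
--
-- Programs are treated by weakest preconditions (`Runs`), and `Runs.loop` combines an invariant
-- with a potential that bounds the remaining steps.

attribute [simp] Expr.eval Expr.cost Test.eval Test.cost Prog.block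

@[simp] theorem Expr.eval_add' (s : State) (e₁ e₂ : Expr) :
    (e₁ + e₂).eval s = e₁.eval s + e₂.eval s := rfl

@[simp] theorem Expr.eval_sub' (s : State) (e₁ e₂ : Expr) :
    (e₁ - e₂).eval s = e₁.eval s - e₂.eval s := rfl

@[simp] theorem Expr.eval_zero (s : State) : (0 : Expr).eval s = 0 := rfl

@[simp] theorem Expr.eval_one (s : State) : (1 : Expr).eval s = 1 := rfl

@[simp] theorem Expr.cost_add' (e₁ e₂ : Expr) : (e₁ + e₂).cost = e₁.cost + e₂.cost + 1 := rfl

@[simp] theorem Expr.cost_sub' (e₁ e₂ : Expr) : (e₁ - e₂).cost = e₁.cost + e₂.cost + 1 := rfl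

@[simp] theorem Expr.cost_zero : (0 : Expr).cost = 1 := rfl

@[simp] theorem Expr.cost_one : (1 : Expr).cost = 1 := rfl

namespace State

@[simp] theorem setReg_reg (s : State) (r r' : Reg) (c : ℕ) :
    (s.setReg r c).reg r' = if r' = r then c else s.reg r' := by
  simp [setReg, Function.update_apply]

@[simp] theorem setReg_arr (s : State) (r : Reg) (c : ℕ) : (s.setReg r c).arr = s.arr := rfl

@[simp] theorem setArr_reg (s : State) (t : Arr) (i c : ℕ) : (s.setArr t i c).reg = s.reg := rfl

@[simp] theorem setArr_arr (s : State) (t t' : Arr) (i c : ℕ) :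
    (s.setArr t i c).arr t' = if t' = t then Function.update (s.arr t) i c else s.arr t' := by
  simp [setArr, Function.update_apply]

end State

/-- `P`, started in `s`, halts, and `Q` holds of the final state and the number of steps. -/
def Runs (P : Prog) (s : State) (Q : State → ℕ → Prop) : Prop :=
  ∃ s' t, Exec P s s' t ∧ Q s' t

theorem Runs.mono {P : Prog} {s : State} {Q R : State → ℕ → Prop} (h : Runs P s Q)
    (hQR : ∀ s' t, Q s' t → R s' t) : Runs P s R :=
  let ⟨s', t, he, hq⟩ := h
  ⟨s', t, he, hQR _ _ hq⟩

-- `Runs` is a total-correctness weakest precondition that also sees the step count. The rules for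
-- straight-line code are equivalences, so `simp` turns such code into a statement about updated
-- states.
@[simp] theorem runs_skip {s : State} {Q : State → ℕ → Prop} : Runs .skip s Q ↔ Q s 1 :=
  ⟨fun ⟨_, _, h, hq⟩ => by cases h; exact hq, fun h => ⟨_, _, .skip s, h⟩⟩

@[simp] theorem runs_set {r : Reg} {e : Expr} {s : State} {Q : State → ℕ → Prop} :
    Runs (.set r e) s Q ↔ Q (s.setReg r (e.eval s)) (e.cost + 1) :=
  ⟨fun ⟨_, _, h, hq⟩ => by cases h; exact hq, fun h => ⟨_, _, .set s r e, h⟩⟩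

@[simp] theorem runs_put {t : Arr} {d e : Expr} {s : State} {Q : State → ℕ → Prop} :
    Runs (.put t d e) s Q ↔ Q (s.setArr t (d.eval s) (e.eval s)) (d.cost + e.cost + 1) :=
  ⟨fun ⟨_, _, h, hq⟩ => by cases h; exact hq, fun h => ⟨_, _, .put s t d e, h⟩⟩

@[simp] theorem runs_seq {P P' : Prog} {s : State} {Q : State → ℕ → Prop} :
    Runs (.seq P P') s Q ↔
      Runs P s (fun s' t => Runs P' s' (fun s'' t' => Q s'' (t + t'))) := by
  constructor
  · rintro ⟨_, _, h, hq⟩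
    cases h with
    | seq h h' => exact ⟨_, _, h, _, _, h', hq⟩
  · rintro ⟨_, _, h, _, _, h', hq⟩
    exact ⟨_, _, .seq h h', hq⟩

@[simp] theorem runs_ite {c : Test} {P P' : Prog} {s : State} {Q : State → ℕ → Prop} :
    Runs (.ite c P P') s Q ↔
      (c.eval s → Runs P s (fun s' t => Q s' (c.cost + 1 + t))) ∧
      (¬ c.eval s → Runs P' s (fun s' t => Q s' (c.cost + 1 + t))) := by
  constructor
  · rintro ⟨_, _, h, hq⟩
    cases h with
    | ite_true hc h => exact ⟨fun _ => ⟨_, _, h, hq⟩, fun hn => absurd hc hn⟩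
    | ite_false hc h => exact ⟨fun hn => absurd hn hc, fun _ => ⟨_, _, h, hq⟩⟩
  · rintro ⟨h₁, h₂⟩
    by_cases hc : c.eval s
    · obtain ⟨_, _, h, hq⟩ := h₁ hc
      exact ⟨_, _, .ite_true hc h, hq⟩
    · obtain ⟨_, _, h, hq⟩ := h₂ hc
      exact ⟨_, _, .ite_false hc h, hq⟩

@[simp] theorem runs_when {c : Test} {P : Prog} {s : State} {Q : State → ℕ → Prop} :
    Runs (.when c P) s Q ↔
      (c.eval s → Runs P s (fun s' t => Q s' (c.cost + 1 + t))) ∧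
      (¬ c.eval s → Q s (c.cost + 1 + 1)) := by
  simp [Prog.when]

namespace Prog

/-- Whether the program may modify the register. -/
def modR : Prog → Reg → Bool
  | skip, _ => false
  | set r _, r' => decide (r' = r)
  | put _ _ _, _ => false
  | seq P Q, r => P.modR r || Q.modR r
  | ite _ P Q, r => P.modR r || Q.modR r
  | loop _ P, r => P.modR r

/-- Whether the program may modify the array. -/
def modA : Prog → Arr → Bool
  | skip, _ => false
  | set _ _, _ => false
  | put t _ _, t' => decide (t' = t)
  | seq P Q, t => P.modA t || Q.modA t
  | ite _ P Q, t => P.modA t || Q.modA t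
  | loop _ P, t => P.modA t

end Prog

/-- The states agree in all memory cells that the program does not modify. -/
structure Frame (P : Prog) (s s' : State) : Prop where
  reg : ∀ r, P.modR r = false → s'.reg r = s.reg r
  arr : ∀ t, P.modA t = false → s'.arr t = s.arr t

theorem Frame.refl (P : Prog) (s : State) : Frame P s s := ⟨fun _ _ => rfl, fun _ _ => rfl⟩

theorem Frame.trans {P : Prog} {s s' s'' : State} (h : Frame P s s') (h' : Frame P s' s'') :
    Frame P s s'' :=
  ⟨fun r hr => (h'.reg r hr).trans (h.reg r hr), fun t ht => (h'.arr t ht).trans (h.arr t ht)⟩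

theorem Frame.mono {P Q : Prog} {s s' : State} (h : Frame P s s')
    (hr : ∀ r, Q.modR r = false → P.modR r = false)
    (ha : ∀ t, Q.modA t = false → P.modA t = false) : Frame Q s s' :=
  ⟨fun r h' => h.reg r (hr r h'), fun t h' => h.arr t (ha t h')⟩

/-- `modR` and `modA` are computable, so for a concrete program the side condition that a cell is
left alone is closed by `rfl`. -/
theorem Exec.frame {P : Prog} {s s' : State} {t : ℕ} (h : Exec P s s' t) : Frame P s s' := by
  induction h with
  | skip s => exact .refl _ _
  | set s r e =>
    refine ⟨fun r' hr => ?_, fun _ _ => rfl⟩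
    have : r' ≠ r := by simpa [Prog.modR] using hr
    simp [this]
  | put s t d e =>
    refine ⟨fun _ _ => rfl, fun t' ht => ?_⟩
    have : t' ≠ t := by simpa [Prog.modA] using ht
    simp [this]
  | seq _ _ ih₁ ih₂ =>
    refine (ih₁.mono ?_ ?_).trans (ih₂.mono ?_ ?_) <;> simp +contextual [Prog.modR, Prog.modA]
  | ite_true _ _ ih => exact ih.mono (by simp +contextual [Prog.modR]) (by simp +contextual [Prog.modA])
  | ite_false _ _ ih => exact ih.mono (by simp +contextual [Prog.modR]) (by simp +contextual [Prog.modA])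
  | loop_done _ => exact .refl _ _
  | loop_step _ _ _ ih₁ ih₂ =>
    exact (ih₁.mono (by simp [Prog.modR]) (by simp [Prog.modA])).trans ih₂

theorem Runs.frame {P : Prog} {s : State} {Q : State → ℕ → Prop} (h : Runs P s Q) :
    Runs P s (fun s' t => Frame P s s' ∧ Q s' t) :=
  let ⟨s', t, he, hq⟩ := h
  ⟨s', t, he, he.frame, hq⟩

/-- The rule for while loops: `φ` bounds the remaining number of steps. -/
theorem Runs.loop {c : Test} {P : Prog} (I : State → ℕ → Prop) {s : State} {φ : ℕ} (h₀ : I s φ)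
    (step : ∀ s' φ, Frame (.loop c P) s s' → I s' φ → c.eval s' →
      Runs P s' (fun s'' t => ∃ φ', I s'' φ' ∧ c.cost + 1 + t + φ' ≤ φ)) :
    Runs (.loop c P) s (fun s' t => Frame (.loop c P) s s' ∧ ¬ c.eval s' ∧
      ∃ φ', I s' φ' ∧ t + φ' ≤ φ + c.cost + 1) := by
  suffices H : ∀ φ s', Frame (.loop c P) s s' → I s' φ →
      Runs (.loop c P) s' (fun s'' t => ¬ c.eval s'' ∧ ∃ φ', I s'' φ' ∧ t + φ' ≤ φ + c.cost + 1)
    from (H φ s (.refl _ _) h₀).frame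
  intro φ
  -- The test alone costs a step, so the potential drops strictly in each pass and also proves
  -- termination.
  induction φ using Nat.strong_induction_on with
  | _ φ ih =>
    intro s' hf hI
    by_cases hc : c.eval s'
    · obtain ⟨s₁, t₁, he, φ₁, hI₁, hφ⟩ := step s' φ hf hI hc
      have hf' : Frame (.loop c P) s' s₁ :=
        he.frame.mono (by simp [Prog.modR]) (by simp [Prog.modA])
      obtain ⟨s₂, t₂, he₂, hn, φ₂, hI₂, hφ₂⟩ := ih φ₁ (by omega) s₁ (hf.trans hf') hI₁
      exact ⟨s₂, _, .loop_step hc he he₂, hn, φ₂, hI₂, by omega⟩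
    · exact ⟨s', _, .loop_done hc, hc, φ, hI, by omega⟩

/-- The rule for counting loops whose body takes at most `c` steps. -/
theorem Runs.upTo {r R : Reg} {P : Prog} (I : ℕ → State → Prop) (c : ℕ) {s : State}
    (hr : P.modR r = false) (hR : P.modR R = false) (hrR : R ≠ r) (h₀ : I 0 (s.setReg r 0))
    (step : ∀ i s', i < s.reg R → Frame (Prog.upTo r R P) s s' → s'.reg r = i → I i s' →
      Runs P s' (fun s'' t => t ≤ c ∧ I (i + 1) (s''.setReg r (i + 1)))) :
    Runs (Prog.upTo r R P) s (fun s' t => Frame (Prog.upTo r R P) s s' ∧ I (s.reg R) s' ∧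
      t ≤ (c + 8) * s.reg R + 6) := by
  -- Overhead per pass: 4 steps for the test and 4 for the increment. The remaining 6 are 2 for the
  -- initial assignment and 4 for the failing test.
  have key : Runs (Prog.upTo r R P) s (fun s' t => I (s.reg R) s' ∧
      t ≤ (c + 8) * s.reg R + 6) := by
    simp only [Prog.upTo, Prog.block, runs_seq, runs_set, Expr.eval_zero, Expr.cost_zero]
    refine (Runs.loop (fun s' φ => ∃ i ≤ s.reg R, s'.reg r = i ∧ I i s' ∧
      φ = (c + 8) * (s.reg R - i)) (φ := (c + 8) * s.reg R)
      ⟨0, by simp, by simp, h₀, by simp⟩ ?_).mono ?_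
    · rintro s' φ hf ⟨i, hi, hri, hI, rfl⟩ hc
      have hfr : Frame (Prog.upTo r R P) s s' := by
        refine Frame.trans (s' := s.setReg r 0) ⟨fun r' h => ?_, fun t h => rfl⟩
          (hf.mono (by simp [Prog.upTo, Prog.modR]) (by simp [Prog.upTo, Prog.modA]))
        have : r' ≠ r := by
          rintro rfl
          simp [Prog.upTo, Prog.modR] at h
        simp [this]
      have hRs : s'.reg R = s.reg R :=
        hfr.reg R (by simp [Prog.upTo, Prog.modR, hR, hrR])
      simp only [Test.eval, Expr.eval, hri, hRs] at hc
      simp only [runs_seq, runs_set]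
      refine (step i s' hc hfr hri hI).frame.mono ?_
      rintro s'' t ⟨hf'', ht, hI'⟩
      have hr'' : s''.reg r = i := (hf''.reg r hr).trans hri
      refine ⟨_, ⟨i + 1, hc, by simp [hr''], by simpa [hr''] using hI', rfl⟩, ?_⟩
      obtain ⟨d, hd⟩ : ∃ d, s.reg R - i = d + 1 := ⟨s.reg R - i - 1, by omega⟩
      have : s.reg R - (i + 1) = d := by omega
      rw [hd, this]
      simp
      nlinarith
    · rintro s' t ⟨hf, hc, φ', ⟨i, hi, hri, hI, rfl⟩, ht⟩
      have hRs : s'.reg R = s.reg R := by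
        rw [hf.reg R (by simp [Prog.modR, hR, hrR])]
        simp [hrR]
      simp only [Test.eval, Expr.eval, hri, hRs] at hc
      obtain rfl : i = s.reg R := by omega
      simp at ht
      exact ⟨hI, by omega⟩
  exact key.frame

/-! ## Edge lists -/

/-- The first `m` entries of the arrays `src` and `dst` list the edges in `E`, each edge once. -/
def EdgeList (m : ℕ) (src dst : ℕ → ℕ) (E : Set (Sym2 ℕ)) : Prop :=
  Set.BijOn (fun i => s(src i, dst i)) (Set.Iio m) E

/-- The state holds a list of the edges in `E`. -/
def HasEdges (s : State) (E : Set (Sym2 ℕ)) : Prop :=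
  EdgeList (s.reg .m) (s.arr .src) (s.arr .dst) E

/-- The edges of a graph on `Fin n` as pairs of natural numbers. -/
def natEdges {n : ℕ} (G : SimpleGraph (Fin n)) : Set (Sym2 ℕ) :=
  Sym2.map Fin.val '' G.edgeSet

theorem sym2Map_val_injective {n : ℕ} :
    Function.Injective (Sym2.map (Fin.val : Fin n → ℕ)) :=
  Sym2.map.injective Fin.val_injective

theorem mem_natEdges {n : ℕ} {G : SimpleGraph (Fin n)} {x y : Fin n} :
    s((x : ℕ), (y : ℕ)) ∈ natEdges G ↔ G.Adj x y := by
  rw [← Sym2.map_mk, natEdges, sym2Map_val_injective.mem_set_image, SimpleGraph.mem_edgeSet]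

theorem exists_of_mem_natEdges {n : ℕ} {G : SimpleGraph (Fin n)} {a b : ℕ}
    (h : s(a, b) ∈ natEdges G) : ∃ x y : Fin n, (x : ℕ) = a ∧ (y : ℕ) = b ∧ G.Adj x y := by
  obtain ⟨e, he, h⟩ := h
  induction e with
  | _ x y =>
    rw [Sym2.map_mk, Sym2.eq_iff] at h
    rcases h with ⟨h₁, h₂⟩ | ⟨h₁, h₂⟩
    · exact ⟨x, y, h₁, h₂, he⟩
    · exact ⟨y, x, h₂, h₁, SimpleGraph.Adj.symm he⟩

theorem natEdges_deleteEdges {n : ℕ} (G : SimpleGraph (Fin n)) (x y : Fin n) :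
    natEdges (G.deleteEdges {s(x, y)}) = natEdges G \ {s((x : ℕ), (y : ℕ))} := by
  rw [natEdges, SimpleGraph.edgeSet_deleteEdges, Set.image_sdiff sym2Map_val_injective,
    Set.image_singleton, Sym2.map_mk, natEdges]

theorem natEdges_sup_edge {n : ℕ} (G : SimpleGraph (Fin n)) {x y : Fin n} (h : x ≠ y) :
    natEdges (G ⊔ SimpleGraph.edge x y) = insert s((x : ℕ), (y : ℕ)) (natEdges G) := by
  rw [natEdges, SimpleGraph.edgeSet_sup, SimpleGraph.edgeSet_edge_of_ne h, Set.image_union,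
    Set.image_singleton, Sym2.map_mk, Set.union_singleton, natEdges]

theorem natEdges_ncard {n : ℕ} (G : SimpleGraph (Fin n)) :
    (natEdges G).ncard = G.edgeSet.ncard :=
  Set.ncard_image_of_injective _ sym2Map_val_injective

theorem EdgeList.ncard {m : ℕ} {src dst : ℕ → ℕ} {E : Set (Sym2 ℕ)} (h : EdgeList m src dst E) :
    E.ncard = m := by
  rw [← h.image_eq, h.injOn.ncard_image, Set.ncard_eq_toFinset_card']
  simp

/-- The list maps `m` indices onto a set of `m` edges, so it is injective: the count in `Encodes` is
what excludes repetitions. -/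
theorem encodes_iff {n : ℕ} {s : State} {G : SimpleGraph (Fin n)} :
    Encodes s G ↔ s.reg .n = n ∧ HasEdges s (natEdges G) := by
  constructor
  · intro h
    refine ⟨h.numNodes, ?_⟩
    have hmaps : Set.MapsTo (fun i => s(s.arr .src i, s.arr .dst i)) (Set.Iio (s.reg .m))
        (natEdges G) := by
      intro i hi
      obtain ⟨x, y, hxy, hx, hy⟩ := h.sound i hi
      simp only [hx, hy]
      exact mem_natEdges.2 hxy
    have hsurj : Set.SurjOn (fun i => s(s.arr .src i, s.arr .dst i)) (Set.Iio (s.reg .m))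
        (natEdges G) := by
      rintro _ ⟨e, he, rfl⟩
      induction e with
      | _ x y =>
        obtain ⟨i, hi, hxy⟩ := h.complete x y he
        exact ⟨i, hi, by simpa [Sym2.eq_iff] using hxy⟩
    refine ⟨hmaps, ?_, hsurj⟩
    have himg : (fun i => s(s.arr .src i, s.arr .dst i)) '' (Set.Iio (s.reg .m)) = natEdges G :=
      Set.Subset.antisymm hmaps.image_subset hsurj
    apply Set.injOn_of_ncard_image_eq
    · rw [himg, natEdges_ncard, ← h.numEdges, Set.ncard_eq_toFinset_card']
      simp
    · exact Set.finite_Iio _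
  · rintro ⟨hn, hE⟩
    refine ⟨hn, by rw [← natEdges_ncard, hE.ncard], fun i hi => ?_, fun x y hxy => ?_⟩
    · obtain ⟨x, y, hx, hy, hxy⟩ := exists_of_mem_natEdges (hE.mapsTo hi)
      exact ⟨x, y, hxy, hx.symm, hy.symm⟩
    · obtain ⟨i, hi, h⟩ := hE.surjOn (mem_natEdges.2 hxy)
      exact ⟨i, hi, by simpa [Sym2.eq_iff] using h⟩

theorem EdgeList.congr {m : ℕ} {src dst src' dst' : ℕ → ℕ} {E : Set (Sym2 ℕ)}
    (h : EdgeList m src dst E) (hs : ∀ i < m, src' i = src i) (hd : ∀ i < m, dst' i = dst i) :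
    EdgeList m src' dst' E :=
  (Set.EqOn.bijOn_iff fun i hi => by simp [hs i hi, hd i hi]).2 h

theorem EdgeList.insert {m : ℕ} {src dst : ℕ → ℕ} {E : Set (Sym2 ℕ)}
    (h : EdgeList m src dst E) {x y : ℕ} (hxy : s(x, y) ∉ E) :
    EdgeList (m + 1) (Function.update src m x) (Function.update dst m y)
      (insert s(x, y) E) := by
  have h' : EdgeList m (Function.update src m x) (Function.update dst m y) E :=
    h.congr (fun i hi => by simp [hi.ne]) (fun i hi => by simp [hi.ne])
  have := Set.BijOn.insert (a := m) h' (by simpa using hxy)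
  have hIio : Set.Iio (m + 1) = Insert.insert m (Set.Iio m) := by ext; simp
  rw [EdgeList, hIio]
  simpa using this

theorem EdgeList.erase {m : ℕ} {src dst : ℕ → ℕ} {E : Set (Sym2 ℕ)}
    (h : EdgeList m src dst E) {i : ℕ} (hi : i < m) :
    EdgeList (m - 1) (Function.update src i (src (m - 1))) (Function.update dst i (dst (m - 1)))
      (E \ {s(src i, dst i)}) := by
  have h₁ : Set.InjOn (fun j => s(src j, dst j)) (Set.Iio m) := h.injOn
  -- The new list is the old one read through the index map that sends `i` to `m - 1` and fixes the
  -- rest; this map is injective below `m - 1`.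
  have hval : ∀ j, s(Function.update src i (src (m - 1)) j, Function.update dst i (dst (m - 1)) j)
      = (fun j => s(src j, dst j)) (if j = i then m - 1 else j) := by
    intro j
    by_cases hj : j = i <;> simp [hj]
  refine ⟨fun j hj => ?_, fun j hj j' hj' he => ?_, fun e he => ?_⟩
  · simp only [Set.mem_Iio] at hj
    simp only [hval]
    have hlt : (if j = i then m - 1 else j) < m := by split_ifs <;> omega
    refine ⟨h.mapsTo hlt, fun hh => ?_⟩
    have := h₁ hlt hi hh
    split_ifs at this <;> omega
  · simp only [Set.mem_Iio] at hj hj'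
    simp only [hval] at he
    have := h₁ (x₁ := if j = i then m - 1 else j) (x₂ := if j' = i then m - 1 else j')
      (by simp only [Set.mem_Iio]; split_ifs <;> omega)
      (by simp only [Set.mem_Iio]; split_ifs <;> omega) he
    split_ifs at this <;> omega
  · obtain ⟨j, hj, rfl⟩ := h.surjOn he.1
    simp only [Set.mem_Iio] at hj
    have hji : j ≠ i := fun hji => he.2 (by simp [hji])
    refine ⟨if j = m - 1 then i else j, ?_, ?_⟩
    · simp only [Set.mem_Iio]
      split_ifs <;> omega
    · simp only [hval]
      by_cases hjm : j = m - 1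
      · simp [hjm]
      · simp [hjm, hji]

@[simp] theorem edgeIs_eval (s : State) (r r' : Reg) : (Prog.edgeIs r r').eval s ↔
    s(s.arr .src (s.reg .i), s.arr .dst (s.reg .i)) = s(s.reg r, s.reg r') := by
  simp [Prog.edgeIs]

@[simp] theorem edgeIs_cost (r r' : Reg) : (Prog.edgeIs r r').cost = 19 := rfl

theorem removeEdge_runs {s : State} {E : Set (Sym2 ℕ)} (hE : HasEdges s E) :
    Runs Prog.removeEdge s (fun s' t => Frame Prog.removeEdge s s' ∧
      HasEdges s' (E \ {s(s.reg .u, s.reg .v)}) ∧ s'.reg .m ≤ s.reg .m ∧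
      t ≤ 60 * s.reg .m + 6) := by
  apply Runs.frame
  simp only [Prog.removeEdge, Prog.block, runs_seq, runs_set]
  -- The edge may be absent, hence the two options for `E'`. After a deletion `i` stays put, because
  -- the entry moved into its place is still unchecked; either branch lowers `m - i` by one.
  refine (Runs.loop (fun s' φ => ∃ E', (E' = E ∨ E' = E \ {s(s.reg .u, s.reg .v)}) ∧
    HasEdges s' E' ∧ s'.reg .i ≤ s'.reg .m ∧ s'.reg .m ≤ s.reg .m ∧
    (∀ j < s'.reg .i, s(s'.arr .src j, s'.arr .dst j) ≠ s(s.reg .u, s.reg .v)) ∧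
    φ = 60 * (s'.reg .m - s'.reg .i)) (φ := 60 * s.reg .m)
    ⟨E, .inl rfl, by simpa [HasEdges] using hE, by simp⟩ ?_).mono ?_
  · rintro s' φ hf ⟨E', hE', hs', him, hmm, hne, rfl⟩ hc
    simp only [Test.eval, Expr.eval] at hc
    have hu : s'.reg .u = s.reg .u := by rw [hf.reg .u rfl]; simp
    have hv : s'.reg .v = s.reg .v := by rw [hf.reg .v rfl]; simp
    simp only [runs_ite, runs_seq, runs_set, runs_put, edgeIs_eval, hu, hv]
    constructor
    · intro he
      refine ⟨_, ⟨E \ {s(s.reg .u, s.reg .v)}, .inr rfl, ?_, ?_, ?_, ?_, rfl⟩, ?_⟩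
      · have := EdgeList.erase hs' hc
        rw [he] at this
        simp only [HasEdges]
        rcases hE' with rfl | rfl
        · simpa using this
        · simpa using this
      · simp; omega
      · simp; omega
      · intro j hj
        simp at hj ⊢
        simpa [hj.ne] using hne j hj
      · simp; omega
    · intro he
      refine ⟨_, ⟨E', hE', by simpa [HasEdges] using hs', ?_, ?_, ?_, rfl⟩, ?_⟩
      · simp; omega
      · simpa using hmm
      · intro j hj
        simp at hj ⊢
        rcases Nat.le_iff_lt_or_eq.1 hj with hj | rfl
        · simpa using hne j hj
        · simpa using he
      · simp; omega
  · rintro s' t ⟨hf, hc, φ', ⟨E', hE', hs', him, hmm, hne, rfl⟩, ht⟩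
    simp only [Test.eval, Expr.eval] at hc
    have him' : s'.reg .i = s'.reg .m := by omega
    refine ⟨?_, hmm, ?_⟩
    · rcases hE' with rfl | rfl
      · convert hs' using 1
        refine Set.sdiff_singleton_eq_self fun hmem => ?_
        obtain ⟨j, hj, he⟩ := hs'.surjOn hmem
        exact hne j (him' ▸ hj) he
      · exact hs'
    · simp at ht ⊢; omega

theorem addEdge_runs {s : State} {E : Set (Sym2 ℕ)} (hE : HasEdges s E) :
    Runs Prog.addEdge s (fun s' t => Frame Prog.addEdge s s' ∧
      HasEdges s' (insert s(s.reg .p, s.reg .q) E) ∧ s'.reg .m ≤ s.reg .m + 1 ∧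
      t ≤ 60 * s.reg .m + 40) := by
  apply Runs.frame
  simp only [Prog.addEdge, Prog.block, runs_seq, runs_set]
  refine (Runs.upTo (fun i s' =>
    (s'.reg .found = 0 → ∀ j < i, s(s.arr .src j, s.arr .dst j) ≠ s(s.reg .p, s.reg .q)) ∧
    (s'.reg .found ≠ 0 → s(s.reg .p, s.reg .q) ∈ E)) 30 rfl rfl (by simp) (by simp) ?_).mono ?_
  · rintro i s' hi hf hri ⟨h₁, h₂⟩
    have hsrc : s'.arr .src = s.arr .src := by rw [hf.arr .src rfl]; simp
    have hdst : s'.arr .dst = s.arr .dst := by rw [hf.arr .dst rfl]; simp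
    have hp : s'.reg .p = s.reg .p := by rw [hf.reg .p rfl]; simp
    have hq : s'.reg .q = s.reg .q := by rw [hf.reg .q rfl]; simp
    simp only [runs_when, runs_set, edgeIs_eval, hri, hsrc, hdst, hp, hq]
    constructor
    · intro he
      refine ⟨by simp, by simp, fun _ => ?_⟩
      rw [← he]
      exact hE.mapsTo (by simpa using hi)
    · intro he
      refine ⟨by simp, fun h j hj => ?_, by simpa using h₂⟩
      rcases Nat.lt_succ_iff_lt_or_eq.1 hj with hj | rfl
      · exact h₁ (by simpa using h) j hj
      · exact he
  · rintro s' t ⟨hf, ⟨h₁, h₂⟩, ht⟩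
    have hsrc : s'.arr .src = s.arr .src := by rw [hf.arr .src rfl]; simp
    have hdst : s'.arr .dst = s.arr .dst := by rw [hf.arr .dst rfl]; simp
    have hp : s'.reg .p = s.reg .p := by rw [hf.reg .p rfl]; simp
    have hq : s'.reg .q = s.reg .q := by rw [hf.reg .q rfl]; simp
    have hm : s'.reg .m = s.reg .m := by rw [hf.reg .m rfl]; simp
    simp only [runs_when, runs_seq, runs_set, runs_put]
    simp at ht
    constructor
    · intro h
      simp only [Test.eval, Expr.eval] at h
      refine ⟨?_, by simp [hm], by simp; omega⟩
      have : s(s.reg .p, s.reg .q) ∉ E := fun hmem => by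
        obtain ⟨j, hj, he⟩ := hE.surjOn hmem
        exact h₁ h j (by simpa using hj) he
      simpa [HasEdges, hm, hsrc, hdst, hp, hq] using EdgeList.insert hE this
    · intro h
      simp only [Test.eval, Expr.eval] at h
      refine ⟨?_, by simp [hm], by simp; omega⟩
      rw [Set.insert_eq_of_mem (h₂ h)]
      simpa [HasEdges, hm, hsrc, hdst] using hE

/-! ## Linked lists and networks -/

/-- Following the pointers `nxt` from `p` one meets the entries of `L`; the pointer `a + 1` stands for
the entry `a`, and `0` for the end of the list. -/
def Chain (nxt : ℕ → ℕ) : ℕ → List ℕ → Prop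
  | p, [] => p = 0
  | p, a :: L => p = a + 1 ∧ Chain nxt (nxt a) L

theorem Chain.update {nxt : ℕ → ℕ} {a c : ℕ} :
    ∀ {p : ℕ} {L : List ℕ}, Chain nxt p L → a ∉ L → Chain (Function.update nxt a c) p L
  | _, [], h, _ => h
  | _, b :: L, ⟨h₁, h₂⟩, ha => by
    simp only [List.mem_cons, not_or] at ha
    refine ⟨h₁, ?_⟩
    rw [Function.update_of_ne (Ne.symm ha.1)]
    exact h₂.update ha.2

theorem Chain.eq_nil {nxt : ℕ → ℕ} {L : List ℕ} (h : Chain nxt 0 L) : L = [] := by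
  cases L with
  | nil => rfl
  | cons a L => exact absurd h.1 (by omega)

theorem Chain.eq_cons {nxt : ℕ → ℕ} {p : ℕ} {L : List ℕ} (h : Chain nxt p L) (hp : p ≠ 0) :
    ∃ a L', L = a :: L' ∧ p = a + 1 ∧ Chain nxt (nxt a) L' := by
  cases L with
  | nil => exact absurd h hp
  | cons a L => exact ⟨a, L, rfl, h⟩

/-- The lists `adj x`, for `x < n`, start at the pointers `head x`. -/
def Chains (n : ℕ) (head nxt : ℕ → ℕ) (adj : ℕ → List ℕ) : Prop :=
  ∀ x < n, Chain nxt (head x) (adj x)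

/-- Freshness of `a` in all lists is what allows `nxt a` to be overwritten. -/
theorem Chains.push {n : ℕ} {head nxt : ℕ → ℕ} {adj : ℕ → List ℕ} (h : Chains n head nxt adj)
    {a y : ℕ} (ha : ∀ x < n, a ∉ adj x) :
    Chains n (Function.update head y (a + 1)) (Function.update nxt a (head y))
      (Function.update adj y (a :: adj y)) := by
  intro x hx
  by_cases hxy : x = y
  · subst hxy
    simpa [Chain] using (h x hx).update (ha x hx)
  · simpa [hxy] using (h x hx).update (ha x hx)

theorem mem_update_cons {adj : ℕ → List ℕ} {a b x y : ℕ} :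
    b ∈ Function.update adj y (a :: adj y) x ↔ (b = a ∧ x = y) ∨ b ∈ adj x := by
  by_cases hxy : x = y
  · subst hxy; simp
  · simp [hxy]

theorem nodup_update_cons {adj : ℕ → List ℕ} {a x y : ℕ} (h : (adj x).Nodup) (ha : a ∉ adj x) :
    (Function.update adj y (a :: adj y) x).Nodup := by
  by_cases hxy : x = y
  · subst hxy; simp [h, ha]
  · simp [hxy, h]

/-- The edges join different nodes below `n`. -/
def ValidEdges (n : ℕ) (E : Set (Sym2 ℕ)) : Prop :=
  ∀ x y, s(x, y) ∈ E → x < n ∧ y < n ∧ x ≠ y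

theorem validEdges_natEdges {n : ℕ} (G : SimpleGraph (Fin n)) : ValidEdges n (natEdges G) := by
  intro a b h
  obtain ⟨x, y, rfl, rfl, hxy⟩ := exists_of_mem_natEdges h
  exact ⟨x.2, y.2, fun he => hxy.ne (Fin.ext he)⟩

/-- The network in which each of the `m` edges in `E` gives two opposite arcs. The arc `a` goes from
`tgt (rev a)` to `tgt a`. -/
structure Network (n m : ℕ) (E : Set (Sym2 ℕ)) where
  (tgt rev head nxt : ℕ → ℕ)
  adj : ℕ → List ℕ
  chains : Chains n head nxt adj
  nodup : ∀ x < n, (adj x).Nodup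
  mem_adj : ∀ x < n, ∀ a, a ∈ adj x ↔ a < m + m ∧ tgt (rev a) = x
  tgt_lt : ∀ a < m + m, tgt a < n
  rev_lt : ∀ a < m + m, rev a < m + m
  rev_rev : ∀ a < m + m, rev (rev a) = a
  loopless : ∀ a < m + m, tgt (rev a) ≠ tgt a
  simple : ∀ a < m + m, ∀ b < m + m, tgt (rev a) = tgt (rev b) → tgt a = tgt b → a = b
  edge_mem : ∀ a < m + m, s(tgt (rev a), tgt a) ∈ E
  exists_arc : ∀ x y, s(x, y) ∈ E → ∃ a < m + m, tgt (rev a) = x ∧ tgt a = y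

/-- The state holds the network. -/
structure Network.Holds {n m : ℕ} {E : Set (Sym2 ℕ)} (N : Network n m E) (s : State) : Prop where
  n_eq : s.reg .n = n
  m_eq : s.reg .m = m
  tgt_eq : s.arr .target = N.tgt
  rev_eq : s.arr .rev = N.rev
  head_eq : s.arr .head = N.head
  nxt_eq : s.arr .nxt = N.nxt

theorem Network.Holds.frame {n m : ℕ} {E : Set (Sym2 ℕ)} {N : Network n m E} {s s' : State}
    {P : Prog} (h : N.Holds s) (hf : Frame P s s')
    (hP : (P.modR .n || P.modR .m || P.modA .target || P.modA .rev || P.modA .head ||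
      P.modA .nxt) = false) : N.Holds s' := by
  simp only [Bool.or_eq_false_iff] at hP
  obtain ⟨⟨⟨⟨⟨h₁, h₂⟩, h₃⟩, h₄⟩, h₅⟩, h₆⟩ := hP
  exact ⟨(hf.reg _ h₁).trans h.n_eq, (hf.reg _ h₂).trans h.m_eq, (hf.arr _ h₃).trans h.tgt_eq,
    (hf.arr _ h₄).trans h.rev_eq, (hf.arr _ h₅).trans h.head_eq, (hf.arr _ h₆).trans h.nxt_eq⟩

theorem arc_cases {m a : ℕ} (h : a < m + m) : a < m ∨ ∃ b < m, a = b + m := by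
  by_cases ha : a < m
  · exact .inl ha
  · exact .inr ⟨a - m, by omega, by omega⟩

theorem exists_network {n m : ℕ} {E : Set (Sym2 ℕ)} {src dst : ℕ → ℕ}
    (hE : EdgeList m src dst E) (hv : ValidEdges n E) {tgt rev head nxt : ℕ → ℕ}
    {adj : ℕ → List ℕ} (hc : Chains n head nxt adj) (hnd : ∀ x < n, (adj x).Nodup)
    (hmem : ∀ x < n, ∀ a, a ∈ adj x ↔
      (a < m ∧ src a = x) ∨ (∃ b < m, a = b + m ∧ dst b = x))
    (harr : ∀ j < m, tgt j = dst j ∧ tgt (j + m) = src j ∧ rev j = j + m ∧ rev (j + m) = j) :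
    ∃ N : Network n m E, N.tgt = tgt ∧ N.rev = rev ∧ N.head = head ∧ N.nxt = nxt := by
  have hedge : ∀ j < m, s(src j, dst j) ∈ E := fun j hj => hE.mapsTo hj
  have hlt : ∀ j < m, src j < n ∧ dst j < n ∧ src j ≠ dst j := fun j hj => hv _ _ (hedge j hj)
  have hinj : ∀ i < m, ∀ j < m, s(src i, dst i) = s(src j, dst j) → i = j :=
    fun i hi j hj h => hE.injOn hi hj h
  refine ⟨⟨tgt, rev, head, nxt, adj, hc, hnd, ?_, ?_, ?_, ?_, ?_, ?_, ?_, ?_⟩, rfl, rfl, rfl, rfl⟩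
  · intro x hx a
    rw [hmem x hx]
    constructor
    · rintro (⟨ha, hs⟩ | ⟨b, hb, rfl, hd⟩)
      · exact ⟨by omega, by rw [(harr a ha).2.2.1, (harr a ha).2.1, hs]⟩
      · exact ⟨by omega, by rw [(harr b hb).2.2.2, (harr b hb).1, hd]⟩
    · rintro ⟨ha, ht⟩
      rcases arc_cases ha with ha | ⟨b, hb, rfl⟩
      · exact .inl ⟨ha, by rw [← ht, (harr a ha).2.2.1, (harr a ha).2.1]⟩
      · exact .inr ⟨b, hb, rfl, by rw [← ht, (harr b hb).2.2.2, (harr b hb).1]⟩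
  · intro a ha
    rcases arc_cases ha with ha | ⟨b, hb, rfl⟩
    · rw [(harr a ha).1]; exact (hlt a ha).2.1
    · rw [(harr b hb).2.1]; exact (hlt b hb).1
  · intro a ha
    rcases arc_cases ha with ha | ⟨b, hb, rfl⟩
    · rw [(harr a ha).2.2.1]; omega
    · rw [(harr b hb).2.2.2]; omega
  · intro a ha
    rcases arc_cases ha with ha | ⟨b, hb, rfl⟩
    · rw [(harr a ha).2.2.1, (harr a ha).2.2.2]
    · rw [(harr b hb).2.2.2, (harr b hb).2.2.1]
  · intro a ha
    rcases arc_cases ha with ha | ⟨b, hb, rfl⟩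
    · rw [(harr a ha).2.2.1, (harr a ha).2.1, (harr a ha).1]; exact (hlt a ha).2.2
    · rw [(harr b hb).2.2.2, (harr b hb).2.1, (harr b hb).1]; exact (hlt b hb).2.2.symm
  · intro a ha b hb h₁ h₂
    rcases arc_cases ha with ha | ⟨c, hc, rfl⟩ <;> rcases arc_cases hb with hb | ⟨d, hd, rfl⟩
    · rw [(harr a ha).2.2.1, (harr a ha).2.1, (harr b hb).2.2.1, (harr b hb).2.1] at h₁
      rw [(harr a ha).1, (harr b hb).1] at h₂
      exact hinj a ha b hb (by rw [h₁, h₂])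
    · rw [(harr a ha).2.2.1, (harr a ha).2.1, (harr d hd).2.2.2, (harr d hd).1] at h₁
      rw [(harr a ha).1, (harr d hd).2.1] at h₂
      -- Arcs of different orientation with the same ends would come from one edge, whose ends would
      -- then coincide.
      obtain rfl := hinj a ha d hd (by rw [h₁, h₂, Sym2.eq_swap])
      exact absurd h₁ (hlt a ha).2.2
    · rw [(harr c hc).2.2.2, (harr c hc).1, (harr b hb).2.2.1, (harr b hb).2.1] at h₁
      rw [(harr c hc).2.1, (harr b hb).1] at h₂
      obtain rfl := hinj c hc b hb (by rw [h₁, h₂, Sym2.eq_swap])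
      exact absurd h₂ (hlt c hc).2.2
    · rw [(harr c hc).2.2.2, (harr c hc).1, (harr d hd).2.2.2, (harr d hd).1] at h₁
      rw [(harr c hc).2.1, (harr d hd).2.1] at h₂
      rw [hinj c hc d hd (by rw [h₁, h₂])]
  · intro a ha
    rcases arc_cases ha with ha | ⟨b, hb, rfl⟩
    · rw [(harr a ha).2.2.1, (harr a ha).2.1, (harr a ha).1]; exact hedge a ha
    · rw [(harr b hb).2.2.2, (harr b hb).2.1, (harr b hb).1, Sym2.eq_swap]; exact hedge b hb
  · intro x y hxy
    obtain ⟨j, hj, h⟩ := hE.surjOn hxy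
    simp only [Set.mem_Iio] at hj
    simp only [Sym2.eq_iff] at h
    rcases h with ⟨h₁, h₂⟩ | ⟨h₁, h₂⟩
    · exact ⟨j, by omega, by rw [(harr j hj).2.2.1, (harr j hj).2.1, h₁], by rw [(harr j hj).1, h₂]⟩
    · exact ⟨j + m, by omega, by rw [(harr j hj).2.2.2, (harr j hj).1, h₂],
        by rw [(harr j hj).2.1, h₁]⟩

/-- The arrays of the network while the first `i` edges have been entered. -/
def PartialNetwork (n m : ℕ) (src dst : ℕ → ℕ) (i : ℕ) (s : State) : Prop :=
  (∀ j < i, s.arr .target j = dst j ∧ s.arr .target (j + m) = src j ∧ s.arr .rev j = j + m ∧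
    s.arr .rev (j + m) = j) ∧
  (∀ j < i, s.arr .res j = 1 ∧ s.arr .res (j + m) = 1) ∧
  ∃ adj, Chains n (s.arr .head) (s.arr .nxt) adj ∧ (∀ x < n, (adj x).Nodup) ∧
    ∀ x < n, ∀ a, a ∈ adj x ↔ (a < i ∧ src a = x) ∨ (∃ b < i, a = b + m ∧ dst b = x)

/-- Besides the abstract network, the formulas for `rev` and `target` are exported: the sparsifier
recovers the edge number of an arc from them. -/
theorem buildNetwork_runs {s : State} {n : ℕ} {E : Set (Sym2 ℕ)} (hn : s.reg .n = n)
    (hE : HasEdges s E) (hv : ValidEdges n E) :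
    Runs Prog.buildNetwork s (fun s' t => Frame Prog.buildNetwork s s' ∧
      t ≤ 110 * (n + s.reg .m) + 20 ∧ (∀ a < s.reg .m + s.reg .m, s'.arr .res a = 1) ∧
      (∀ a < s.reg .m, s'.arr .rev a = a + s.reg .m ∧ s'.arr .target a = s.arr .dst a ∧
        s'.arr .target (a + s.reg .m) = s.arr .src a) ∧
      ∃ N : Network n (s.reg .m) E, N.Holds s') := by
  apply Runs.frame
  simp only [Prog.buildNetwork, Prog.block, runs_seq]
  refine (Runs.upTo (fun i s' => ∀ x < i, s'.arr .head x = 0) 10 rfl rfl (by simp)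
    (by simp) ?_).mono ?_
  · intro i s' hi hf hri h
    simp only [runs_put]
    refine ⟨by simp, fun x hx => ?_⟩
    rcases Nat.lt_succ_iff_lt_or_eq.1 hx with hx | rfl
    · simpa [hri, hx.ne] using h x hx
    · simp [hri]
  rintro s₁ t₁ ⟨hf₁, h₁, ht₁⟩
  have hn₁ : s₁.reg .n = n := (hf₁.reg .n rfl).trans hn
  have hm₁ : s₁.reg .m = s.reg .m := hf₁.reg .m rfl
  have hsrc₁ : s₁.arr .src = s.arr .src := hf₁.arr .src rfl
  have hdst₁ : s₁.arr .dst = s.arr .dst := hf₁.arr .dst rfl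
  have hlt : ∀ j < s.reg .m, s.arr .src j < n ∧ s.arr .dst j < n ∧ s.arr .src j ≠ s.arr .dst j :=
    fun j hj => hv _ _ (hE.mapsTo hj)
  rw [hn] at h₁ ht₁
  refine (Runs.upTo (fun i s' => i ≤ s.reg .m →
    PartialNetwork n (s.reg .m) (s.arr .src) (s.arr .dst) i s') 100 rfl rfl (by simp) ?_ ?_).mono ?_
  · refine fun _ => ⟨by simp, by simp, fun _ => [], fun x hx => ?_, by simp, by simp⟩
    simpa [Chain] using h₁ x hx
  · intro i s' hi hf hri hI
    rw [hm₁] at hi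
    obtain ⟨ha, hr, adj, hc, hnd, hmem⟩ := hI hi.le
    have hm' : s'.reg .m = s.reg .m := (hf.reg .m rfl).trans hm₁
    have hsrc' : s'.arr .src = s.arr .src := (hf.arr .src rfl).trans hsrc₁
    have hdst' : s'.arr .dst = s.arr .dst := (hf.arr .dst rfl).trans hdst₁
    simp only [runs_put, runs_seq]
    refine ⟨by simp, fun _ => ?_⟩
    have hfresh : ∀ x < n, i ∉ adj x := fun x hx h => by
      rcases (hmem x hx i).1 h with ⟨h, _⟩ | ⟨b, hb, h, _⟩ <;> omega
    have hc₁ := hc.push (y := s.arr .src i) hfresh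
    have hfresh₁ : ∀ x < n, i + s.reg .m ∉
        Function.update adj (s.arr .src i) (i :: adj (s.arr .src i)) x := fun x hx h => by
      rcases mem_update_cons.1 h with ⟨h, _⟩ | h
      · omega
      · rcases (hmem x hx _).1 h with ⟨h, _⟩ | ⟨b, hb, h, _⟩ <;> omega
    have hc₂ := hc₁.push (y := s.arr .dst i) hfresh₁
    refine ⟨?_, ?_, _, by simpa [hri, hm', hsrc', hdst'] using hc₂, ?_, ?_⟩
    · intro j hj
      simp [hri, hm', hsrc', hdst', Function.update_apply]
      rcases Nat.lt_succ_iff_lt_or_eq.1 hj with hj | rfl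
      · obtain ⟨q₁, q₂, q₃, q₄⟩ := ha j hj
        refine ⟨?_, ?_, ?_, ?_⟩ <;> split_ifs <;> omega
      · refine ⟨?_, ?_, ?_, ?_⟩ <;> split_ifs <;> omega
    · intro j hj
      simp [hri, hm', Function.update_apply]
      rcases Nat.lt_succ_iff_lt_or_eq.1 hj with hj | rfl
      · obtain ⟨q₁, q₂⟩ := hr j hj
        refine ⟨?_, ?_⟩ <;> intros <;> assumption
      · omega
    · exact fun x hx => nodup_update_cons (nodup_update_cons (hnd x hx) (hfresh x hx))
        (hfresh₁ x hx)
    · intro x hx a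
      rw [mem_update_cons, mem_update_cons, hmem x hx]
      constructor
      · rintro (⟨rfl, hd⟩ | ⟨rfl, hs⟩ | ⟨h, hs⟩ | ⟨b, hb, h, hd⟩)
        · exact .inr ⟨i, by omega, rfl, hd.symm⟩
        · exact .inl ⟨by omega, hs.symm⟩
        · exact .inl ⟨by omega, hs⟩
        · exact .inr ⟨b, by omega, h, hd⟩
      · rintro (⟨h, hs⟩ | ⟨b, hb, h, hd⟩)
        · rcases Nat.lt_succ_iff_lt_or_eq.1 h with h | rfl
          · exact .inr (.inr (.inl ⟨h, hs⟩))
          · exact .inr (.inl ⟨rfl, hs.symm⟩)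
        · rcases Nat.lt_succ_iff_lt_or_eq.1 hb with hb | rfl
          · exact .inr (.inr (.inr ⟨b, hb, h, hd⟩))
          · exact .inl ⟨h, hd.symm⟩
  · rintro s₂ t₂ ⟨hf₂, hI, ht₂⟩
    rw [hm₁] at hI ht₂
    obtain ⟨ha, hr, adj, hc, hnd, hmem⟩ := hI le_rfl
    obtain ⟨N, h₁, h₂, h₃, h₄⟩ := exists_network hE hv hc hnd hmem ha
    refine ⟨by omega, fun a h => ?_, fun a h => ?_, N, ?_⟩
    · rcases arc_cases h with h | ⟨b, hb, rfl⟩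
      · exact (hr a h).1
      · exact (hr b hb).2
    · exact ⟨(ha a h).2.2.1, (ha a h).1, (ha a h).2.1⟩
    · exact ⟨(hf₂.reg .n rfl).trans hn₁, (hf₂.reg .m rfl).trans hm₁, h₁.symm, h₂.symm, h₃.symm,
        h₄.symm⟩

/-! ## Breadth-first search -/

section BFS

variable {n m : ℕ} {E : Set (Sym2 ℕ)}

/-- The node at which an arc starts. -/
def Network.tail (N : Network n m E) (a : ℕ) : ℕ := N.tgt (N.rev a)

theorem Network.tail_lt (N : Network n m E) {a : ℕ} (ha : a < m + m) : N.tail a < n :=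
  N.tgt_lt _ (N.rev_lt a ha)

theorem Network.tail_rev (N : Network n m E) {a : ℕ} (ha : a < m + m) :
    N.tail (N.rev a) = N.tgt a := by
  rw [Network.tail, N.rev_rev a ha]

/-- Labels `d` (the distance from the root plus one, and zero for unreachable nodes) that are
consistent with a breadth-first search along the arcs with positive `κ`. -/
structure IsBFS (N : Network n m E) (ρ : ℕ) (κ d : ℕ → ℕ) : Prop where
  root : d ρ = 1
  closed : ∀ a < m + m, 0 < d (N.tail a) → 0 < κ a →
    0 < d (N.tgt a) ∧ d (N.tgt a) ≤ d (N.tail a) + 1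
  pred : ∀ y < n, 0 < d y → y ≠ ρ →
    ∃ a < m + m, N.tgt a = y ∧ 0 < κ a ∧ 0 < d (N.tail a) ∧ d y = d (N.tail a) + 1

/-- The invariant of breadth-first search; `pend` holds for the arcs out of the node being processed
that are still to be looked at. -/
structure BFSInv (N : Network n m E) (ρ : ℕ) (κ d Q : ℕ → ℕ) (qh qt : ℕ) (pend : ℕ → Prop) :
    Prop where
  le : qh ≤ qt
  root : d ρ = 1
  mem : ∀ i < qt, Q i < n ∧ 0 < d (Q i)
  inj : ∀ i < qt, ∀ j < qt, Q i = Q j → i = j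
  cover : ∀ y < n, 0 < d y → ∃ i < qt, Q i = y
  mono : ∀ i j, i ≤ j → j < qt → d (Q i) ≤ d (Q j)
  near : ∀ i j, qh ≤ i + 1 → i < qt → j < qt → d (Q j) ≤ d (Q i) + 1
  closed : ∀ i < qh, ∀ a < m + m, N.tail a = Q i → 0 < κ a →
    pend a ∨ (0 < d (N.tgt a) ∧ d (N.tgt a) ≤ d (Q i) + 1)
  pred : ∀ y < n, 0 < d y → y ≠ ρ →
    ∃ a < m + m, N.tgt a = y ∧ 0 < κ a ∧ 0 < d (N.tail a) ∧ d y = d (N.tail a) + 1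

namespace BFSInv

variable {N : Network n m E} {ρ : ℕ} {κ d Q : ℕ → ℕ} {qh qt : ℕ} {pend pend' : ℕ → Prop}

theorem isBFS (h : BFSInv N ρ κ d Q qt qt fun _ => False) : IsBFS N ρ κ d where
  root := h.root
  closed a ha hd hκ := by
    obtain ⟨i, hi, he⟩ := h.cover _ (N.tail_lt ha) hd
    rw [← he]
    exact (h.closed i hi a ha he.symm hκ).resolve_left id
  pred := h.pred

theorem init {d₀ Q₀ : ℕ → ℕ} (h₀ : ∀ x < n, d₀ x = 0) (hρ : ρ < n) :
    BFSInv N ρ κ (Function.update d₀ ρ 1) (Function.update Q₀ 0 ρ) 0 1 fun _ => False := by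
  have hd : ∀ y < n, 0 < Function.update d₀ ρ 1 y → y = ρ := by
    intro y hy h
    by_contra hne
    simp [hne, h₀ y hy] at h
  refine ⟨by omega, by simp, ?_, ?_, ?_, ?_, ?_, by simp, ?_⟩
  · intro i hi
    obtain rfl : i = 0 := by omega
    simpa using hρ
  · intros; omega
  · intro y hy h
    exact ⟨0, by omega, by simp [hd y hy h]⟩
  · intro i j _ _
    obtain rfl : i = j := by omega
    rfl
  · intro i j _ _ _
    obtain rfl : i = j := by omega
    omega
  · intro y hy h hne
    exact absurd (hd y hy h) hne

theorem dequeue (h : BFSInv N ρ κ d Q qh qt fun _ => False) (hq : qh < qt) :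
    BFSInv N ρ κ d Q (qh + 1) qt fun a => a < m + m ∧ N.tail a = Q qh where
  le := hq
  root := h.root
  mem := h.mem
  inj := h.inj
  cover := h.cover
  mono := h.mono
  near i j hi := h.near i j (by omega)
  closed i hi a ha ht hκ := by
    rcases Nat.lt_succ_iff_lt_or_eq.1 hi with hi | rfl
    · exact .inr ((h.closed i hi a ha ht hκ).resolve_left id)
    · exact .inl ⟨ha, ht⟩
  pred := h.pred

/-- The condition `qh ≤ i + 1` in `near` reaches back to the entry just taken out of the queue. A
head that is already labelled therefore exceeds the label of `Q qh` by at most one. -/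
theorem skip (h : BFSInv N ρ κ d Q (qh + 1) qt pend) {a : ℕ} (ha : N.tail a = Q qh)
    (hn : N.tgt a < n) (hpend : ∀ b, pend b → b = a ∨ pend' b) (hs : ¬ (0 < κ a ∧ d (N.tgt a) = 0)) :
    BFSInv N ρ κ d Q (qh + 1) qt pend' where
  le := h.le
  root := h.root
  mem := h.mem
  inj := h.inj
  cover := h.cover
  mono := h.mono
  near := h.near
  closed i hi b hb ht hκ := by
    rcases h.closed i hi b hb ht hκ with hp | hp
    · rcases hpend b hp with rfl | hp
      · right
        have hpos : 0 < d (N.tgt b) := by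
          by_contra hc
          exact hs ⟨hκ, by omega⟩
        obtain ⟨j, hj, he⟩ := h.cover _ hn hpos
        have hle := h.le
        have := h.near qh j le_rfl (by omega) hj
        rw [he] at this
        rw [← ht, ha]
        exact ⟨hpos, this⟩
      · exact .inl hp
    · exact .inr hp
  pred := h.pred

/-- The label `d (Q qh) + 1` is at least every label in the queue by `near`, and by `mono` at most
one more than those from position `qh` on. Appending the node thus keeps the queue sorted and
narrow. -/
theorem visit (h : BFSInv N ρ κ d Q (qh + 1) qt pend) {a : ℕ} (ha : N.tail a = Q qh)
    (hlt : a < m + m) (hpend : ∀ b, pend b → b = a ∨ pend' b) (hκ : 0 < κ a)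
    (hd : d (N.tgt a) = 0) :
    BFSInv N ρ κ (Function.update d (N.tgt a) (d (Q qh) + 1)) (Function.update Q qt (N.tgt a))
      (qh + 1) (qt + 1) pend' := by
  have hle := h.le
  have hne : ∀ y, 0 < d y → y ≠ N.tgt a := by
    rintro y hy rfl
    omega
  have hQ : ∀ i < qt, Function.update Q qt (N.tgt a) i = Q i := fun i hi => by simp [hi.ne]
  have hdQ : ∀ i < qt, Function.update d (N.tgt a) (d (Q qh) + 1) (Q i) = d (Q i) := fun i hi => by
    simp [hne _ (h.mem i hi).2]
  have hdp : ∀ y, 0 < d y → Function.update d (N.tgt a) (d (Q qh) + 1) y = d y := fun y hy => by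
    simp [hne y hy]
  have hcase : ∀ i < qt + 1, i < qt ∨ i = qt := fun i hi => Nat.lt_succ_iff_lt_or_eq.1 hi
  have hup : ∀ i < qt, d (Q i) ≤ d (Q qh) + 1 := fun i hi => h.near qh i le_rfl (by omega) hi
  have hlo : ∀ i, qh ≤ i → i < qt → d (Q qh) ≤ d (Q i) := fun i hi hi' => h.mono qh i hi hi'
  refine ⟨by omega, ?_, ?_, ?_, ?_, ?_, ?_, ?_, ?_⟩
  · rw [hdp _ (by rw [h.root]; omega), h.root]
  · intro i hi
    rcases hcase i hi with hi | rfl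
    · rw [hQ i hi, hdQ i hi]; exact h.mem i hi
    · simpa using N.tgt_lt a hlt
  · intro i hi j hj he
    rcases hcase i hi with hi | rfl <;> rcases hcase j hj with hj | rfl
    · rw [hQ i hi, hQ j hj] at he; exact h.inj i hi j hj he
    · rw [hQ i hi, Function.update_self] at he
      exact absurd he (hne _ (h.mem i hi).2)
    · rw [hQ j hj, Function.update_self] at he
      exact absurd he.symm (hne _ (h.mem j hj).2)
    · rfl
  · intro y hy hdy
    by_cases hya : y = N.tgt a
    · exact ⟨qt, by omega, by simp [hya]⟩
    · obtain ⟨i, hi, he⟩ := h.cover y hy (by simpa [hya] using hdy)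
      exact ⟨i, by omega, by rw [hQ i hi, he]⟩
  · intro i j hij hj
    rcases hcase j hj with hj | rfl
    · rw [hQ i (by omega), hQ j hj, hdQ i (by omega), hdQ j hj]; exact h.mono i j hij hj
    · rcases hcase i (by omega) with hi | rfl
      · rw [hQ i hi, hdQ i hi]; simpa using hup i hi
      · rfl
  · intro i j hi hiq hj
    rcases hcase i hiq with hiq | rfl <;> rcases hcase j hj with hj | rfl
    · rw [hQ i hiq, hQ j hj, hdQ i hiq, hdQ j hj]; exact h.near i j hi hiq hj
    · rw [hQ i hiq, hdQ i hiq]; simpa using hlo i (by omega) hiq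
    · rw [hQ j hj, hdQ j hj]
      have := hup j hj
      simp
      omega
    · omega
  · intro i hi b hb ht hκb
    rw [hQ i (by omega)] at ht
    rw [hQ i (by omega), hdQ i (by omega)]
    have hnew : b = a ∨ N.tgt b = N.tgt a → Q i = Q qh ∨ i ≤ qh := fun _ => .inr (by omega)
    by_cases hba : N.tgt b = N.tgt a
    · by_cases hba' : b = a
      · subst hba'
        have : Q i = Q qh := by rw [← ht, ha]
        right
        simp [this]
      · rcases h.closed i hi b hb ht hκb with hp | hp
        · exact .inl ((hpend b hp).resolve_left hba')
        · rw [hba] at hp; omega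
    · rcases h.closed i hi b hb ht hκb with hp | hp
      · rcases hpend b hp with rfl | hp
        · exact absurd rfl hba
        · exact .inl hp
      · right
        rw [hdp _ hp.1]; exact hp
  · intro y hy hdy hyr
    by_cases hya : y = N.tgt a
    · refine ⟨a, hlt, hya.symm, hκ, ?_, ?_⟩
      · rw [ha, hdQ qh (by omega)]; exact (h.mem qh (by omega)).2
      · rw [ha, hdQ qh (by omega), hya]; simp
    · simp only [ne_eq, hya, not_false_eq_true, Function.update_of_ne] at hdy ⊢
      obtain ⟨b, hb, h₁, h₂, h₃, h₄⟩ := h.pred y hy hdy hyr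
      exact ⟨b, hb, h₁, h₂, by rw [hdp _ h₃]; exact h₃, by rw [hdp _ h₃]; exact h₄⟩

end BFSInv

/-- Every arc is on the list of its tail and on no other. -/
theorem Network.sum_length_adj (N : Network n m E) :
    ∑ x ∈ Finset.range n, (N.adj x).length = m + m := by
  have h := Finset.card_eq_sum_card_fiberwise (f := N.tail) (s := Finset.range (m + m))
    (t := Finset.range n) (fun a ha => by simpa using N.tail_lt (by simpa using ha))
  rw [Finset.card_range] at h
  rw [h]
  refine Finset.sum_congr rfl fun x hx => ?_
  have hx := Finset.mem_range.1 hx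
  rw [← List.toFinset_card_of_nodup (N.nodup x hx)]
  congr 1
  ext a
  rw [List.mem_toFinset, N.mem_adj x hx, Finset.mem_filter, Finset.mem_range, Network.tail]

/-- The cost that is left for the nodes that have not been taken out of the queue. -/
def Network.searchCost (N : Network n m E) (Q : ℕ → ℕ) (qh : ℕ) : ℕ :=
  ∑ x ∈ Finset.range n \ (Finset.range qh).image Q, (50 + 60 * (N.adj x).length)

theorem Network.searchCost_congr (N : Network n m E) {Q Q' : ℕ → ℕ} {qh : ℕ}
    (h : ∀ i < qh, Q' i = Q i) : N.searchCost Q' qh = N.searchCost Q qh := by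
  rw [Network.searchCost, Network.searchCost, Finset.image_congr (g := Q)]
  intro i hi
  exact h i (by simpa using hi)

theorem Network.searchCost_succ (N : Network n m E) {Q : ℕ → ℕ} {qh : ℕ} (hlt : Q qh < n)
    (hinj : ∀ i < qh, Q i ≠ Q qh) :
    N.searchCost Q (qh + 1) + (50 + 60 * (N.adj (Q qh)).length) = N.searchCost Q qh := by
  have h : Finset.range n \ (Finset.range qh).image Q =
      insert (Q qh) (Finset.range n \ (Finset.range (qh + 1)).image Q) := by
    ext y
    rw [Finset.range_add_one, Finset.image_insert]
    by_cases hy : y = Q qh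
    · subst hy
      simpa [hlt] using hinj
    · simp [hy]
  rw [Network.searchCost, Network.searchCost, h, Finset.sum_insert (by simp; exact fun _ => ⟨qh, le_rfl, rfl⟩),
    add_comm]

theorem Network.searchCost_zero (N : Network n m E) (Q : ℕ → ℕ) :
    N.searchCost Q 0 = 50 * n + 60 * (m + m) := by
  rw [Network.searchCost, Finset.range_zero, Finset.image_empty, Finset.sdiff_empty,
    Finset.sum_add_distrib, ← Finset.mul_sum, N.sum_length_adj]
  simp [mul_comm]

/-- The expression `cap` and its meaning `κ` are parameters so that one proof serves the searches
along residual arcs and against them. -/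
theorem search_runs (N : Network n m E) {s : State} (hN : N.Holds s) {r : Reg} {mark : Arr}
    {cap : Expr} {κ : ℕ → ℕ} (hr : r = .u ∨ r = .v)
    (hm : mark = .level ∨ mark = .inS ∨ mark = .inT) (hρ : s.reg r < n) (hcost : cap.cost ≤ 10)
    (hκ : ∀ s', N.Holds s' → s'.arr .res = s.arr .res → cap.eval s' = κ (s'.reg .a - 1)) :
    Runs (Prog.search r mark cap) s (fun s' t => Frame (Prog.search r mark cap) s s' ∧
      IsBFS N (s.reg r) κ (s'.arr mark) ∧ t ≤ 200 * (n + m) + 100) := by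
  have hm₁ : mark ≠ .queue := by rcases hm with rfl | rfl | rfl <;> simp
  have hm₂ : Arr.queue ≠ mark := hm₁.symm
  have hm₃ : Arr.target ≠ mark := by rcases hm with rfl | rfl | rfl <;> simp
  have hm₄ : Arr.rev ≠ mark := by rcases hm with rfl | rfl | rfl <;> simp
  have hm₅ : Arr.head ≠ mark := by rcases hm with rfl | rfl | rfl <;> simp
  have hm₆ : Arr.nxt ≠ mark := by rcases hm with rfl | rfl | rfl <;> simp
  have hm₇ : Arr.res ≠ mark := by rcases hm with rfl | rfl | rfl <;> simp
  apply Runs.frame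
  simp only [Prog.search, Prog.block, runs_seq]
  refine (Runs.upTo (fun i s' => ∀ x < i, s'.arr mark x = 0) 10 rfl rfl (by simp)
    (by simp) ?_).mono ?_
  · intro i s' hi hf hri h
    simp only [runs_put]
    refine ⟨by simp, fun x hx => ?_⟩
    rcases Nat.lt_succ_iff_lt_or_eq.1 hx with hx | rfl
    · simpa [hri, hx.ne] using h x hx
    · simp [hri]
  rintro s₁ t₁ ⟨hf₁, h₁, ht₁⟩
  have hN₁ : N.Holds s₁ := hN.frame hf₁ (by rcases hm with rfl | rfl | rfl <;> rfl)
  have hr₁ : s₁.reg r = s.reg r := hf₁.reg r (by rcases hr with rfl | rfl <;> rfl)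
  have hres₁ : s₁.arr .res = s.arr .res := hf₁.arr .res (by rcases hm with rfl | rfl | rfl <;> rfl)
  rw [hN.n_eq] at h₁ ht₁
  simp only [runs_set, runs_put]
  -- A node releases 50 steps and 60 per outgoing arc when it leaves the queue. Unreached nodes keep
  -- their share, so the initial potential does not depend on the graph's connectivity.
  refine (Runs.loop (fun s' φ => BFSInv N (s.reg r) κ (s'.arr mark) (s'.arr .queue) (s'.reg .qh)
    (s'.reg .qt) (fun _ => False) ∧ φ = N.searchCost (s'.arr .queue) (s'.reg .qh))
    (φ := 50 * n + 60 * (m + m)) ?_ ?_).mono ?_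
  · refine ⟨?_, by simp [N.searchCost_zero]⟩
    simpa [hm₁, hm₂, hr₁] using BFSInv.init (N := N) (κ := κ) h₁ hρ
  · rintro s₂ _ hf₂ ⟨hI, rfl⟩ hc
    have hN₂ : N.Holds s₂ := by
      refine Network.Holds.frame (s := s₁) hN₁ (P := Prog.search r mark cap)
        ⟨fun r' hr' => ?_, fun t ht => ?_⟩ (by rcases hm with rfl | rfl | rfl <;> rfl)
      · simp only [Prog.search, Prog.upTo, Prog.when, Prog.block, Prog.modR, Bool.or_eq_false_iff,
          decide_eq_false_iff_not] at hr'
        rw [hf₂.reg r' (by simp [Prog.modR, Prog.when, hr'])]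
        simp [hr']
      · simp only [Prog.search, Prog.upTo, Prog.when, Prog.block, Prog.modA, Bool.or_eq_false_iff,
          decide_eq_false_iff_not] at ht
        rw [hf₂.arr t (by simp [Prog.modA, Prog.when, ht])]
        simp [ht]
    have hres₂ : s₂.arr .res = s.arr .res := by
      rw [hf₂.arr .res (by simp [Prog.modA, Prog.when, hm₇])]
      simpa [hm₇] using hres₁
    simp only [Test.eval, Expr.eval] at hc
    obtain ⟨hX, -⟩ := hI.mem _ hc
    generalize hXd : s₂.arr .queue (s₂.reg .qh) = X at hX
    simp only [runs_seq, runs_set]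
    refine (Runs.loop (fun s' φ => ∃ L, Chain N.nxt (s'.reg .a) L ∧
      (∀ a ∈ L, a < m + m ∧ N.tail a = X) ∧
      BFSInv N (s.reg r) κ (s'.arr mark) (s'.arr .queue) (s₂.reg .qh + 1) (s'.reg .qt)
        (fun a => a ∈ L) ∧ (∀ i < s₂.reg .qh + 1, s'.arr .queue i = s₂.arr .queue i) ∧
      φ = 60 * L.length) (φ := 60 * (N.adj X).length) ?_ ?_).mono ?_
    · refine ⟨N.adj X, ?_, fun a ha => (N.mem_adj X hX a).1 ha, ?_, by simp, rfl⟩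
      · simpa [hXd, hN₂.head_eq] using N.chains X hX
      · have := hI.dequeue hc
        rw [hXd] at this
        simpa [N.mem_adj X hX, Network.tail] using this
    · rintro s₃ φ hf₃ ⟨L, hL, hmem, hI₃, hpre, rfl⟩ hc₃
      simp only [Test.eval, Expr.eval, Expr.eval_zero] at hc₃
      obtain ⟨a, L, rfl, ha, hL'⟩ := hL.eq_cons hc₃.ne'
      obtain ⟨halt, htail⟩ := hmem a (by simp)
      have hx₃ : s₃.reg .x = X := by rw [hf₃.reg .x rfl]; simp [hXd]
      -- The test containing `cap` is evaluated after the assignment to `y`, so the network is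
      -- needed in that state.
      have hN₃ : ∀ c, N.Holds (s₃.setReg .y c) := fun c => by
        refine Network.Holds.frame (s := s₂) hN₂ (P := Prog.search r mark cap)
          ⟨fun r' hr' => ?_, fun t ht => ?_⟩ (by rcases hm with rfl | rfl | rfl <;> rfl)
        · simp only [Prog.search, Prog.upTo, Prog.when, Prog.block, Prog.modR,
            Bool.or_eq_false_iff, decide_eq_false_iff_not] at hr'
          simp only [State.setReg_reg, hr', if_false]
          rw [hf₃.reg r' (by simp [Prog.modR, Prog.when, hr'])]
          simp [hr']
        · simp only [Prog.search, Prog.upTo, Prog.when, Prog.block, Prog.modA,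
            Bool.or_eq_false_iff, decide_eq_false_iff_not] at ht
          rw [State.setReg_arr, hf₃.arr t (by simp [Prog.modA, Prog.when, ht])]
          simp
      have hcap : ∀ c, cap.eval (s₃.setReg .y c) = κ a := fun c => by
        rw [hκ _ (hN₃ c)]
        · simp [ha]
        · rw [State.setReg_arr, hf₃.arr .res (by simp [Prog.modA, Prog.when, hm₇])]
          simpa using hres₂
      have htgt : s₃.arr .target = N.tgt := (hN₃ 0).tgt_eq
      have hnxt : s₃.arr .nxt = N.nxt := (hN₃ 0).nxt_eq
      have htailQ : N.tail a = s₃.arr .queue (s₂.reg .qh) := by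
        rw [htail, hpre _ (by omega), hXd]
      have hQX : s₃.arr .queue (s₂.reg .qh) = X := by rw [hpre _ (by omega), hXd]
      have hpend : ∀ b, b ∈ a :: L → b = a ∨ b ∈ L := fun b hb => List.mem_cons.1 hb
      simp only [runs_seq, runs_set, runs_when, runs_put, Test.eval, Expr.eval, Expr.eval_zero,
        hcap, Expr.eval_sub', Expr.eval_one, Expr.eval_add', ha, htgt, State.setReg_arr,
        State.setReg_reg, reduceCtorEq, if_true, if_false, Nat.add_sub_cancel]
      constructor
      · rintro ⟨hpos, hz⟩
        refine ⟨_, ⟨L, ?_, fun b hb => hmem b (List.mem_cons_of_mem _ hb), ?_, ?_, rfl⟩, ?_⟩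
        · simpa [ha, hnxt, hm₆] using hL'
        · have := hI₃.visit htailQ halt hpend hpos hz
          simpa [ha, htgt, hx₃, hm₁, hm₂, hQX] using this
        · intro i hi
          have := hI₃.le
          have : i ≠ s₃.reg .qt := by omega
          simpa [hm₂, this] using hpre i hi
        · simp
          omega
      · intro hs
        refine ⟨_, ⟨L, ?_, fun b hb => hmem b (List.mem_cons_of_mem _ hb), ?_, ?_, rfl⟩, ?_⟩
        · simpa [ha, hnxt] using hL'
        · have := hI₃.skip htailQ (N.tgt_lt a halt) hpend hs
          simpa using this
        · simpa using hpre
        · simp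
          omega
    · rintro s₃ t₃ ⟨hf₃, hc₃, φ', ⟨L, hL, hmem, hI₃, hpre, rfl⟩, ht₃⟩
      simp only [Test.eval, Expr.eval, Expr.eval_zero] at hc₃
      have ha : s₃.reg .a = 0 := by omega
      rw [ha] at hL
      obtain rfl := hL.eq_nil
      have hqh : s₃.reg .qh = s₂.reg .qh + 1 := by rw [hf₃.reg .qh rfl]; simp
      refine ⟨_, ⟨by simpa [hqh] using hI₃, rfl⟩, ?_⟩
      rw [hqh, N.searchCost_congr hpre]
      have := N.searchCost_succ (Q := s₂.arr .queue) (qh := s₂.reg .qh) (hXd ▸ hX)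
        (fun i hi he => by have := hI.inj i (by omega) _ hc he; omega)
      rw [hXd] at this
      simp at ht₃ ⊢
      omega
  · rintro s₂ t₂ ⟨hf₂, hc, φ', ⟨hI, rfl⟩, ht⟩
    simp only [Test.eval, Expr.eval] at hc
    have hq : s₂.reg .qh = s₂.reg .qt := by have := hI.le; omega
    rw [hq] at hI
    refine ⟨hI.isBFS, ?_⟩
    simp at ht ⊢
    omega

end BFS

/-! ## Flows in a network -/

section Flow

variable {n m : ℕ} {E : Set (Sym2 ℕ)}

theorem Network.sum_rev {M : Type*} [AddCommMonoid M] (N : Network n m E) (c : ℕ → M) :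
    ∑ a ∈ Finset.range (m + m), c (N.rev a) = ∑ a ∈ Finset.range (m + m), c a := by
  refine Finset.sum_nbij' N.rev N.rev ?_ ?_ ?_ ?_ ?_ <;> intro a ha <;>
    simp only [Finset.mem_range] at ha ⊢
  · exact N.rev_lt a ha
  · exact N.rev_lt a ha
  · exact N.rev_rev a ha
  · exact N.rev_rev a ha

/-- By `simple` there is at most one arc between two given nodes. This lets `toFlow` be defined as a
sum, without choosing an arc. -/
theorem Network.sum_arcs (N : Network n m E) (c : ℕ → ℤ) {a : ℕ} (ha : a < m + m) :
    ∑ b ∈ Finset.range (m + m), (if N.tail b = N.tail a ∧ N.tgt b = N.tgt a then c b else 0) =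
      c a := by
  rw [Finset.sum_eq_single a]
  · simp
  · intro b hb hne
    rw [if_neg]
    rintro ⟨h₁, h₂⟩
    exact hne (N.simple b (Finset.mem_range.1 hb) a ha h₁ h₂)
  · intro h
    exact absurd (Finset.mem_range.2 ha) h

/-- The net flow out of a node when the residual capacities are `r`. -/
def Network.excess (N : Network n m E) (r : ℕ → ℕ) (x : ℕ) : ℤ :=
  ∑ a ∈ Finset.range (m + m), if N.tail a = x then 1 - (r a : ℤ) else 0

/-- The residual capacities `r` belong to a flow of value `F` from `u` to `v`. -/
structure Network.IsFlow (N : Network n m E) (u v : ℕ) (r : ℕ → ℕ) (F : ℕ) : Prop where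
  pair : ∀ a < m + m, r a + r (N.rev a) = 2
  conservation : ∀ x < n, x ≠ u → x ≠ v → N.excess r x = 0
  value : N.excess r u = F

/-- The flow that belongs to the residual capacities `r`. -/
def Network.toFlow (N : Network n m E) (r : ℕ → ℕ) (x y : Fin n) : ℤ :=
  ∑ a ∈ Finset.range (m + m), if N.tail a = x ∧ N.tgt a = y then 1 - (r a : ℤ) else 0

theorem sum_fin_ite (P : Prop) [Decidable P] {b : ℕ} (hb : b < n) (c : ℤ) :
    ∑ y : Fin n, (if P ∧ b = (y : ℕ) then c else 0) = if P then c else 0 := by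
  rw [Fintype.sum_eq_single (⟨b, hb⟩ : Fin n)]
  · simp
  · intro y hy
    rw [if_neg]
    rintro ⟨-, rfl⟩
    exact hy rfl

theorem Network.sum_toFlow (N : Network n m E) (r : ℕ → ℕ) (x : Fin n) :
    ∑ y, N.toFlow r x y = N.excess r x := by
  simp only [Network.toFlow, Network.excess]
  rw [Finset.sum_comm]
  exact Finset.sum_congr rfl fun a ha => sum_fin_ite _ (N.tgt_lt a (Finset.mem_range.1 ha)) _

theorem Network.exists_arc_of_adj {G : SimpleGraph (Fin n)} (N : Network n m (natEdges G))
    {x y : Fin n} (h : G.Adj x y) : ∃ a < m + m, N.tail a = x ∧ N.tgt a = y :=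
  N.exists_arc _ _ (mem_natEdges.2 h)

theorem Network.adj_of_arc {G : SimpleGraph (Fin n)} (N : Network n m (natEdges G))
    {x y : Fin n} {a : ℕ} (ha : a < m + m) (hx : N.tail a = x) (hy : N.tgt a = y) : G.Adj x y := by
  have := N.edge_mem a ha
  rw [← Network.tail, hx, hy] at this
  exact mem_natEdges.1 this

theorem Network.toFlow_of_arc (N : Network n m E) (r : ℕ → ℕ) {x y : Fin n} {a : ℕ}
    (ha : a < m + m) (hx : N.tail a = x) (hy : N.tgt a = y) : N.toFlow r x y = 1 - r a := by
  rw [Network.toFlow, ← hx, ← hy]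
  exact N.sum_arcs (fun a => 1 - (r a : ℤ)) ha

theorem Network.sum_eq_zero_of_not_adj {G : SimpleGraph (Fin n)} (N : Network n m (natEdges G))
    (c : ℕ → ℤ) {x y : Fin n} (h : ¬ G.Adj x y) :
    ∑ a ∈ Finset.range (m + m), (if N.tail a = x ∧ N.tgt a = y then c a else 0) = 0 := by
  refine Finset.sum_eq_zero fun a ha => if_neg ?_
  rintro ⟨hx, hy⟩
  exact h (N.adj_of_arc (Finset.mem_range.1 ha) hx hy)

/-- An arc carries `1 - r a`. Skew symmetry is the condition `r a + r (rev a) = 2`, and the capacity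
bound is `0 ≤ r a`. -/
theorem Network.IsFlow.isUnitFlow {G : SimpleGraph (Fin n)} {N : Network n m (natEdges G)}
    {u v : Fin n} {r : ℕ → ℕ} {F : ℕ} (h : N.IsFlow u v r F) : IsUnitFlow G u v (N.toFlow r) where
  skew x y := by
    rw [Network.toFlow, ← N.sum_rev, Network.toFlow, ← Finset.sum_neg_distrib]
    refine Finset.sum_congr rfl fun a ha => ?_
    have ha := Finset.mem_range.1 ha
    have := h.pair a ha
    rw [N.tail_rev ha, ← Network.tail]
    by_cases h₁ : N.tail a = x <;> by_cases h₂ : N.tgt a = y <;> simp [h₁, h₂]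
    omega
  support x y hxy := N.sum_eq_zero_of_not_adj _ hxy
  capacity x y := by
    by_cases hxy : G.Adj x y
    · obtain ⟨a, ha, hx, hy⟩ := N.exists_arc_of_adj hxy
      rw [N.toFlow_of_arc r ha hx hy]
      omega
    · rw [Network.toFlow, N.sum_eq_zero_of_not_adj _ hxy]
      omega
  conservation x hu hv := by
    rw [N.sum_toFlow]
    exact h.conservation x x.2 (fun h => hu (Fin.ext h)) (fun h => hv (Fin.ext h))

theorem Network.IsFlow.flowValue_eq {N : Network n m E}
    {u : Fin n} {v : ℕ} {r : ℕ → ℕ} {F : ℕ} (h : N.IsFlow u v r F) :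
    flowValue u (N.toFlow r) = F := by
  rw [flowValue, N.sum_toFlow, h.value]

/-- Add up the net outflows of all nodes of `S`: only `u` contributes, and the terms inside `S`
cancel by skew symmetry. -/
theorem flowValue_eq_sum_cut {u v : Fin n} {h : Fin n → Fin n → ℤ} (skew : ∀ x y, h y x = - h x y)
    (cons : ∀ x, x ≠ u → x ≠ v → ∑ y, h x y = 0) {S : Finset (Fin n)} (hu : u ∈ S) (hv : v ∉ S) :
    flowValue u h = ∑ x ∈ S, ∑ y ∈ Sᶜ, h x y := by
  have h₁ : ∑ x ∈ S, ∑ y, h x y = flowValue u h :=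
    Finset.sum_eq_single_of_mem u hu fun x hx hxu =>
      cons x hxu (by rintro rfl; exact hv hx)
  have h₂ : ∑ x ∈ S, ∑ y ∈ S, h x y = 0 := by
    have h₃ : ∑ x ∈ S, ∑ y ∈ S, h x y = - ∑ x ∈ S, ∑ y ∈ S, h x y := by
      conv_lhs => rw [Finset.sum_comm]
      simp_rw [← Finset.sum_neg_distrib]
      exact Finset.sum_congr rfl fun x _ => Finset.sum_congr rfl fun y _ => skew x y
    omega
  rw [← h₁, Finset.sum_congr rfl fun x _ => (Finset.sum_add_sum_compl S (h x)).symm,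
    Finset.sum_add_distrib, h₂, zero_add]

/-- A flow exceeds another one by at most the residual capacity of a cut. -/
theorem Network.IsFlow.flowValue_le {G : SimpleGraph (Fin n)} {N : Network n m (natEdges G)}
    {u v : Fin n} {r : ℕ → ℕ} {F : ℕ} (h : N.IsFlow u v r F) {g : Fin n → Fin n → ℤ}
    (hg : IsUnitFlow G u v g) (S : ℕ → Prop) [DecidablePred S] (hu : S u) (hv : ¬ S v) :
    flowValue u g ≤ F +
      ∑ a ∈ Finset.range (m + m), if S (N.tail a) ∧ ¬ S (N.tgt a) then (r a : ℤ) else 0 := by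
  have hf := h.isUnitFlow
  set T : Finset (Fin n) := Finset.univ.filter fun x => S x with hT
  -- The cut formula is applied to the difference of the two flows, which on an arc is at most `1 -
  -- (1 - r a) = r a`.
  have hval : flowValue u g - F = ∑ x ∈ T, ∑ y ∈ Tᶜ, (g x y - N.toFlow r x y) := by
    rw [← flowValue_eq_sum_cut (u := u) (v := v)]
    · change _ = ∑ y, (g u y - N.toFlow r u y)
      rw [Finset.sum_sub_distrib, ← flowValue, ← flowValue, h.flowValue_eq]
    · intro x y
      rw [hg.skew, hf.skew]
      ring
    · intro x hxu hxv
      rw [Finset.sum_sub_distrib, hg.conservation x hxu hxv, hf.conservation x hxu hxv, sub_zero]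
    · simpa [hT] using hu
    · simpa [hT] using hv
  have hle : ∀ x y, g x y - N.toFlow r x y ≤
      ∑ a ∈ Finset.range (m + m), if N.tail a = x ∧ N.tgt a = y then (r a : ℤ) else 0 := by
    intro x y
    by_cases hxy : G.Adj x y
    · obtain ⟨a, ha, hx, hy⟩ := N.exists_arc_of_adj hxy
      have := hg.capacity x y
      rw [N.toFlow_of_arc r ha hx hy, ← hx, ← hy, N.sum_arcs _ ha]
      omega
    · rw [N.sum_eq_zero_of_not_adj _ hxy, hg.support x y hxy, hf.support x y hxy]
      simp
  have hsum : ∑ x ∈ T, ∑ y ∈ Tᶜ, (∑ a ∈ Finset.range (m + m),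
      if N.tail a = x ∧ N.tgt a = y then (r a : ℤ) else 0) =
      ∑ a ∈ Finset.range (m + m), if S (N.tail a) ∧ ¬ S (N.tgt a) then (r a : ℤ) else 0 := by
    rw [Finset.sum_congr rfl fun x _ => Finset.sum_comm, Finset.sum_comm]
    refine Finset.sum_congr rfl fun a ha => ?_
    have ha := Finset.mem_range.1 ha
    by_cases hS : S (N.tail a) ∧ ¬ S (N.tgt a)
    · rw [if_pos hS, Finset.sum_eq_single_of_mem (⟨N.tail a, N.tail_lt ha⟩ : Fin n)
        (by simpa [hT] using hS.1), Finset.sum_eq_single_of_mem (⟨N.tgt a, N.tgt_lt a ha⟩ : Fin n)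
        (by simpa [hT] using hS.2)]
      · simp
      · intro y _ hy
        rw [if_neg]
        rintro ⟨-, h⟩
        exact hy (Fin.ext h.symm)
      · intro x _ hx
        refine Finset.sum_eq_zero fun y _ => if_neg ?_
        rintro ⟨h, -⟩
        exact hx (Fin.ext h.symm)
    · rw [if_neg hS]
      refine Finset.sum_eq_zero fun x hx => Finset.sum_eq_zero fun y hy => if_neg ?_
      rintro ⟨h₁, h₂⟩
      apply hS
      rw [h₁, h₂]
      exact ⟨by simpa [hT] using hx, by simpa [hT] using hy⟩
  have := (hval.trans_le (Finset.sum_le_sum fun x _ => Finset.sum_le_sum fun y _ => hle x y))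
  omega

/-- The labelled nodes form a cut without outgoing residual capacity, so no flow can be larger. -/
theorem IsBFS.isMax {G : SimpleGraph (Fin n)} {N : Network n m (natEdges G)} {u v : Fin n}
    {r d : ℕ → ℕ} {F : ℕ} (hd : IsBFS N u r d) (h : N.IsFlow u v r F) (hv : d v = 0) :
    IsMaxUnitFlow G u v (N.toFlow r) := by
  refine ⟨h.isUnitFlow, fun g hg => ?_⟩
  rw [h.flowValue_eq]
  have := h.flowValue_le hg (fun x => 0 < d x) (by simp [hd.root]) (by simp [hv])
  rwa [Finset.sum_eq_zero, add_zero] at this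
  intro a ha
  have ha := Finset.mem_range.1 ha
  split_ifs with hS
  · by_contra hr
    exact hS.2 (hd.closed a ha hS.1 (by omega)).1
  · rfl

theorem IsBFS.pos_iff {N : Network n m E} {ρ : ℕ} {κ d : ℕ → ℕ} (hd : IsBFS N ρ κ d) (hρ : ρ < n)
    {w : ℕ} (hw : w < n) : 0 < d w ↔
      Relation.ReflTransGen (fun x y => ∃ a < m + m, N.tail a = x ∧ N.tgt a = y ∧ 0 < κ a) ρ w := by
  constructor
  · intro h
    induction hk : d w using Nat.strong_induction_on generalizing w with
    | _ k ih =>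
      by_cases hwρ : w = ρ
      · rw [hwρ]
      · obtain ⟨a, ha, ht, hκ, hpos, hdw⟩ := hd.pred w hw h hwρ
        exact (ih _ (by omega) (N.tail_lt ha) hpos rfl).tail ⟨a, ha, rfl, ht, hκ⟩
  · intro h
    induction h with
    | refl => rw [hd.root]; omega
    | tail _ h ih =>
      obtain ⟨a, ha, rfl, rfl, hκ⟩ := h
      exact (hd.closed a ha (ih (N.tail_lt ha)) hκ).1

/-- The condition `h'` keeps the intermediate nodes of a path in `ℕ` below `n`, so that the path
lifts to `Fin n`. -/
theorem reflTransGen_fin_iff {R : Fin n → Fin n → Prop} {R' : ℕ → ℕ → Prop}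
    (h : ∀ x y : Fin n, R x y ↔ R' x y) (h' : ∀ x y, R' x y → x < n ∧ y < n) {x y : Fin n} :
    Relation.ReflTransGen R x y ↔ Relation.ReflTransGen R' (x : ℕ) y := by
  constructor
  · exact fun hxy => Relation.ReflTransGen.lift Fin.val (fun a b => (h a b).1) _ _ hxy
  · intro hxy
    obtain ⟨b, hb⟩ : ∃ b, b = (y : ℕ) := ⟨_, rfl⟩
    rw [← hb] at hxy
    induction hxy generalizing y with
    | refl => rw [Fin.ext hb]
    | tail _ hab ih =>
      have := h' _ _ hab
      refine (ih (y := ⟨_, this.1⟩) rfl).tail ((h _ _).2 ?_)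
      rwa [← hb]

theorem Network.IsFlow.residualArc_iff {G : SimpleGraph (Fin n)} {N : Network n m (natEdges G)}
    {r : ℕ → ℕ} (x y : Fin n) :
    ResidualArc G (N.toFlow r) x y ↔
      ∃ a < m + m, N.tail a = x ∧ N.tgt a = y ∧ 0 < r a := by
  constructor
  · rintro ⟨hxy, hr⟩
    obtain ⟨a, ha, hx, hy⟩ := N.exists_arc_of_adj hxy
    rw [N.toFlow_of_arc r ha hx hy] at hr
    exact ⟨a, ha, hx, hy, by omega⟩
  · rintro ⟨a, ha, hx, hy, hr⟩
    refine ⟨N.adj_of_arc ha hx hy, ?_⟩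
    rw [N.toFlow_of_arc r ha hx hy]
    omega

theorem IsBFS.mem_sourceSide {G : SimpleGraph (Fin n)} {N : Network n m (natEdges G)} {u : Fin n}
    {r d : ℕ → ℕ} (hd : IsBFS N u r d) (w : Fin n) :
    w ∈ sourceSide G (N.toFlow r) u ↔ 0 < d w := by
  rw [hd.pos_iff u.2 w.2]
  refine reflTransGen_fin_iff Network.IsFlow.residualArc_iff ?_
  rintro x y ⟨a, ha, rfl, rfl, -⟩
  exact ⟨N.tail_lt ha, N.tgt_lt a ha⟩

/-- A search from `v` that uses an arc whenever its reversal has residual capacity walks residual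
paths to `v` backwards; `rev` translates between the two relations. -/
theorem IsBFS.mem_sinkSide {G : SimpleGraph (Fin n)} {N : Network n m (natEdges G)} {v : Fin n}
    {r d : ℕ → ℕ} (hd : IsBFS N v (fun a => r (N.rev a)) d) (w : Fin n) :
    w ∈ sinkSide G (N.toFlow r) v ↔ 0 < d w := by
  rw [hd.pos_iff v.2 w.2, sinkSide, Set.mem_setOf_eq, ← Relation.reflTransGen_swap]
  refine reflTransGen_fin_iff (fun x y => ?_) ?_
  · rw [Function.swap, Network.IsFlow.residualArc_iff]
    constructor
    · rintro ⟨a, ha, hx, hy, hr⟩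
      exact ⟨N.rev a, N.rev_lt a ha, by rw [N.tail_rev ha, hy], hx, by rwa [N.rev_rev a ha]⟩
    · rintro ⟨a, ha, hx, hy, hr⟩
      exact ⟨N.rev a, N.rev_lt a ha, by rw [N.tail_rev ha, hy], hx, hr⟩
  · rintro x y ⟨a, ha, rfl, rfl, -⟩
    exact ⟨N.tail_lt ha, N.tgt_lt a ha⟩

/-- If there is no augmenting path in the level graph, the distance from `u` to `v` increases. -/
theorem IsBFS.lt_of_blocked {N : Network n m E} {u v : ℕ} {r r' d d' : ℕ → ℕ}
    (hd : IsBFS N u r d) (hd' : IsBFS N u r' d') {dead : ℕ → Prop} (hu : dead u) (hv : ¬ dead v)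
    (hr : ∀ a < m + m, 0 < r' a →
      0 < r a ∨ (0 < d (N.tgt a) ∧ d (N.tgt a) < d (N.tail a)))
    (hdead : ∀ a < m + m, dead (N.tail a) → 0 < r' a → d (N.tgt a) = d (N.tail a) + 1 →
      dead (N.tgt a)) (hvn : v < n) (hpos : 0 < d' v) : d v < d' v := by
  -- Induction along a shortest path of the new residual graph. On each arc the old level rises by
  -- at most one: old residual arcs obey `closed`, and new ones go down. Equality of old and new
  -- labels at `y` forces every arc of the path to be a level arc, and then `dead` is inherited all
  -- the way from `u`.
  have key : ∀ y < n, 0 < d' y → 0 < d y ∧ d y ≤ d' y ∧ (d y = d' y → dead y) := by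
    intro y hy hpos
    induction hk : d' y using Nat.strong_induction_on generalizing y with
    | _ k ih =>
      subst hk
      by_cases hyu : y = u
      · subst hyu
        rw [hd.root, hd'.root]
        exact ⟨by omega, le_rfl, fun _ => hu⟩
      · obtain ⟨a, ha, rfl, hra, hpa, he⟩ := hd'.pred y hy hpos hyu
        obtain ⟨h₁, h₂, h₃⟩ := ih _ (by omega) _ (N.tail_lt ha) hpa rfl
        rcases hr a ha hra with h | ⟨h₄, h₅⟩
        · obtain ⟨h₆, h₇⟩ := hd.closed a ha h₁ h
          exact ⟨h₆, by omega, fun heq => hdead a ha (h₃ (by omega)) hra (by omega)⟩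
        · exact ⟨h₄, by omega, fun heq => by omega⟩
  obtain ⟨h₁, h₂, h₃⟩ := key v hvn hpos
  exact lt_of_le_of_ne h₂ fun h => hv (h₃ h)

/-- In the level graph there is a path to every node that has been reached. -/
theorem IsBFS.not_blocked {N : Network n m E} {u v : ℕ} {r d : ℕ → ℕ} (hd : IsBFS N u r d)
    {dead : ℕ → Prop} (hu : dead u) (hv : ¬ dead v)
    (hdead : ∀ a < m + m, dead (N.tail a) → 0 < r a → d (N.tgt a) = d (N.tail a) + 1 →
      dead (N.tgt a)) (hvn : v < n) : d v = 0 := by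
  by_contra h
  -- With the same labels before and after, the distance would exceed itself.
  exact lt_irrefl _ (hd.lt_of_blocked hd hu hv (fun a _ h => .inl h) hdead hvn (by omega))

/-! ### Bounds for the missing flow from the layers of the level graph. -/

section Layers

variable {G : SimpleGraph (Fin n)} {N : Network n m (natEdges G)} {u v : Fin n} {r d : ℕ → ℕ}
  {F L : ℕ} {g : Fin n → Fin n → ℤ}

/-- Cut after layer `i`. By `closed`, a residual arc that leaves the nodes labelled `1, …, i` ends
at label `i + 1` and hence starts at label `i`. Unreached nodes have label `0` and belong to the
side of `v`. -/
theorem IsBFS.flowValue_le_layer (hd : IsBFS N u r d) (h : N.IsFlow u v r F)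
    (hv : d v = L + 1) (hg : IsUnitFlow G u v g) {i : ℕ} (hi : i ∈ Finset.Icc 1 L) :
    flowValue u g - F ≤ ∑ a ∈ Finset.range (m + m),
      if d (N.tail a) = i ∧ d (N.tgt a) = i + 1 then (r a : ℤ) else 0 := by
  rw [Finset.mem_Icc] at hi
  have := h.flowValue_le hg (fun x => 0 < d x ∧ d x ≤ i) (by simp [hd.root, hi])
    (by simp [hv]; omega)
  refine (sub_le_iff_le_add'.2 this).trans (Finset.sum_le_sum fun a ha => ?_)
  have ha := Finset.mem_range.1 ha
  by_cases hr : r a = 0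
  · simp [hr]
  · split_ifs with h₁ h₂ h₂
    · exact le_rfl
    · exfalso
      have := hd.closed a ha h₁.1.1 (by omega)
      omega
    · omega
    · exact le_rfl

theorem Network.IsFlow.sum_res (h : N.IsFlow u v r F) :
    ∑ a ∈ Finset.range (m + m), r a = m + m := by
  have h₁ := N.sum_rev r
  have h₂ : ∑ a ∈ Finset.range (m + m), (r a + r (N.rev a)) = (m + m) * 2 := by
    rw [Finset.sum_congr rfl fun a ha => h.pair a (Finset.mem_range.1 ha)]
    simp
  rw [Finset.sum_add_distrib] at h₂
  omega

/-- The `L` layer cuts use disjoint sets of arcs, and all residual capacities add up to `2m`. -/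
theorem IsBFS.remaining_mul_le (hd : IsBFS N u r d) (h : N.IsFlow u v r F)
    (hv : d v = L + 1) (hg : IsUnitFlow G u v g) :
    (flowValue u g - F) * L ≤ 2 * m := by
  have h₁ : ∑ _i ∈ Finset.Icc 1 L, (flowValue u g - F) ≤ ∑ i ∈ Finset.Icc 1 L,
      ∑ a ∈ Finset.range (m + m), if d (N.tail a) = i ∧ d (N.tgt a) = i + 1 then (r a : ℤ) else 0 :=
    Finset.sum_le_sum fun i hi => hd.flowValue_le_layer h hv hg hi
  rw [Finset.sum_comm] at h₁
  have h₂ : ∀ a ∈ Finset.range (m + m), (∑ i ∈ Finset.Icc 1 L,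
      if d (N.tail a) = i ∧ d (N.tgt a) = i + 1 then (r a : ℤ) else 0) ≤ r a := by
    intro a _
    calc _ ≤ ∑ i ∈ Finset.Icc 1 L, if d (N.tail a) = i then (r a : ℤ) else 0 := by
          refine Finset.sum_le_sum fun i _ => ?_
          split_ifs <;> first | omega | tauto
      _ ≤ r a := by
          rw [Finset.sum_ite_eq]
          split_ifs <;> omega
  have h₃ := h₁.trans (Finset.sum_le_sum h₂)
  have h₄ : ∑ a ∈ Finset.range (m + m), (r a : ℤ) = m + m := by exact_mod_cast h.sum_res
  rw [h₄] at h₃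
  simp at h₃
  linarith

/-- Between two layers there is at most one arc per ordered pair of nodes, and its residual capacity
is at most `2`. -/
theorem IsBFS.layer_le (h : N.IsFlow u v r F) (i : ℕ) :
    ∑ a ∈ Finset.range (m + m), (if d (N.tail a) = i ∧ d (N.tgt a) = i + 1 then (r a : ℤ) else 0) ≤
      2 * (((Finset.range n).filter fun x => d x = i).card *
        ((Finset.range n).filter fun x => d x = i + 1).card) := by
  rw [← Finset.sum_filter]
  have h₁ : ∀ a ∈ (Finset.range (m + m)).filter
      fun a => d (N.tail a) = i ∧ d (N.tgt a) = i + 1, (r a : ℤ) ≤ 2 := by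
    intro a ha
    have := h.pair a (Finset.mem_range.1 (Finset.mem_filter.1 ha).1)
    omega
  have h₂ : ((Finset.range (m + m)).filter
      fun a => d (N.tail a) = i ∧ d (N.tgt a) = i + 1).card ≤
      (((Finset.range n).filter fun x => d x = i) ×ˢ
        ((Finset.range n).filter fun x => d x = i + 1)).card := by
    refine Finset.card_le_card_of_injOn (fun a => (N.tail a, N.tgt a)) ?_ ?_
    · intro a ha
      simp only [Finset.coe_filter, Finset.mem_range, Set.mem_setOf_eq] at ha
      simp [ha, N.tail_lt ha.1, N.tgt_lt a ha.1]
    · intro a ha b hb hab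
      simp only [Finset.coe_filter, Finset.mem_range, Set.mem_setOf_eq] at ha hb
      rw [Prod.mk.injEq] at hab
      exact N.simple a ha.1 b hb.1 hab.1 hab.2
  rw [Finset.card_product] at h₂
  have h₃ := Finset.sum_le_card_nsmul _ _ _ h₁
  rw [nsmul_eq_mul] at h₃
  have h₄ : (((Finset.range (m + m)).filter
      fun a => d (N.tail a) = i ∧ d (N.tgt a) = i + 1).card : ℤ) ≤
      ((Finset.range n).filter fun x => d x = i).card *
        ((Finset.range n).filter fun x => d x = i + 1).card := by exact_mod_cast h₂
  linarith

theorem sum_card_layers_le (d : ℕ → ℕ) (n : ℕ) (s : Finset ℕ) :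
    ∑ i ∈ s, ((Finset.range n).filter fun x => d x = i).card ≤ n := by
  simp_rw [Finset.card_filter]
  rw [Finset.sum_comm]
  calc _ ≤ ∑ _x ∈ Finset.range n, 1 := by
        refine Finset.sum_le_sum fun x _ => ?_
        rw [Finset.sum_ite_eq]
        split_ifs <;> omega
    _ = n := by simp

/-- Otherwise any two consecutive layers contain together more than `2n / L` nodes. Summing over the
`L` pairs gives more than `2n`, although each node is counted at most twice. -/
theorem IsBFS.remaining_mul_sq_le (hd : IsBFS N u r d) (h : N.IsFlow u v r F)
    (hv : d v = L + 1) (hg : IsUnitFlow G u v g) :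
    (flowValue u g - F) * (L : ℤ) ^ 2 ≤ 2 * (n : ℤ) ^ 2 := by
  by_contra! hlt
  rcases Nat.eq_zero_or_pos L with rfl | hL
  · have : (0 : ℤ) ≤ 2 * (n : ℤ) ^ 2 := by positivity
    simp at hlt
    linarith
  set V : ℕ → ℕ := fun i => ((Finset.range n).filter fun x => d x = i).card with hV
  have h₁ : ∀ i ∈ Finset.Icc 1 L, 2 * n < (V i + V (i + 1)) * L := by
    intro i hi
    have h₂ := (hd.flowValue_le_layer h hv hg hi).trans (IsBFS.layer_le h i)
    have hL' : (0 : ℤ) < (L : ℤ) ^ 2 := by positivity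
    -- With `ρ` the missing flow and `a`, `b` the sizes of the two layers: `4n² < 2ρL² ≤ 4abL² ≤ (a
    -- + b)²L²`.
    have h₃ : (2 * (n : ℤ)) ^ 2 < (((V i : ℤ) + V (i + 1)) * L) ^ 2 := by
      have : (flowValue u g - F) * (L : ℤ) ^ 2 ≤ 2 * ((V i : ℤ) * V (i + 1)) * (L : ℤ) ^ 2 :=
        mul_le_mul_of_nonneg_right h₂ hL'.le
      have : 0 ≤ ((V i : ℤ) - V (i + 1)) ^ 2 * (L : ℤ) ^ 2 := by positivity
      nlinarith
    have := lt_of_pow_lt_pow_left₀ 2 (by positivity) h₃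
    exact_mod_cast this
  have h₂ : ∑ _i ∈ Finset.Icc 1 L, (2 * n) < ∑ i ∈ Finset.Icc 1 L, (V i + V (i + 1)) * L :=
    Finset.sum_lt_sum_of_nonempty (by simp; omega) h₁
  simp only [← Finset.sum_mul, Finset.sum_add_distrib] at h₂
  have h₃ : ∑ i ∈ Finset.Icc 1 L, V i ≤ n := sum_card_layers_le d n _
  have h₄ : ∑ i ∈ Finset.Icc 1 L, V (i + 1) ≤ n := by
    have := sum_card_layers_le d n ((Finset.Icc 1 L).map (addRightEmbedding 1))
    rw [Finset.sum_map] at this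
    simpa using this
  have h₅ := Nat.mul_le_mul_right L (Nat.add_le_add h₃ h₄)
  simp at h₂
  linarith

/-- When `v` is far away from `u`, the flow is almost maximal. -/
theorem IsBFS.remaining_le (hd : IsBFS N u r d) (h : N.IsFlow u v r F)
    (hv : d v = L + 1) (hg : IsUnitFlow G u v g) {D : ℕ}
    (hD : m < (D + 1) ^ 2 ∨ n ^ 2 < (D + 1) ^ 3) (hL : D < L) :
    flowValue u g ≤ F + (2 * D + 2) := by
  by_contra! hlt
  have hrem : 2 * ((D : ℤ) + 1) ≤ flowValue u g - F := by linarith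
  have hL' : (D : ℤ) + 1 ≤ L := by exact_mod_cast hL
  -- If more than `2D + 2` units were missing, the two preceding bounds with `L ≥ D + 1` would give
  -- `(D + 1)² ≤ m` and `(D + 1)³ ≤ n²`, respectively.
  rcases hD with hD | hD
  · have h₁ := hd.remaining_mul_le h hv hg
    have h₂ : 2 * ((D : ℤ) + 1) * ((D : ℤ) + 1) ≤ (flowValue u g - F) * L :=
      mul_le_mul hrem hL' (by positivity) (by linarith)
    have h₃ : (m : ℤ) < ((D : ℤ) + 1) ^ 2 := by exact_mod_cast hD
    nlinarith
  · have h₁ := hd.remaining_mul_sq_le h hv hg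
    have h₂ : 2 * ((D : ℤ) + 1) * ((D : ℤ) + 1) ^ 2 ≤ (flowValue u g - F) * (L : ℤ) ^ 2 :=
      mul_le_mul hrem (pow_le_pow_left₀ (by positivity) hL' 2) (by positivity) (by linarith)
    have h₃ : (n : ℤ) ^ 2 < ((D : ℤ) + 1) ^ 3 := by exact_mod_cast hD
    nlinarith

end Layers

end Flow

/-! ## Blocking flows -/

section BlockingFlow

variable {n m : ℕ} {E : Set (Sym2 ℕ)}

/-- The residual capacities after one unit of flow has been sent along the arc `a`. -/
def Network.push (N : Network n m E) (r : ℕ → ℕ) (a : ℕ) : ℕ → ℕ :=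
  Function.update (Function.update r a (r a - 1)) (N.rev a)
    (Function.update r a (r a - 1) (N.rev a) + 1)

theorem Network.rev_ne (N : Network n m E) {a : ℕ} (ha : a < m + m) : N.rev a ≠ a := by
  intro h
  have := N.loopless a ha
  rw [h] at this
  exact this rfl

theorem Network.push_apply (N : Network n m E) (r : ℕ → ℕ) {a : ℕ} (ha : a < m + m) (b : ℕ) :
    N.push r a b = if b = a then r a - 1 else if b = N.rev a then r (N.rev a) + 1 else r b := by
  have := N.rev_ne ha
  rw [Network.push]
  by_cases h₁ : b = N.rev a
  · subst h₁
    simp [this]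
  · by_cases h₂ : b = a
    · subst h₂
      simp [h₁]
    · simp [h₁, h₂]

/-- The total residual capacity of the arcs of the level graph. -/
def Network.weight (N : Network n m E) (d r : ℕ → ℕ) : ℕ :=
  ∑ a ∈ Finset.range (m + m), if d (N.tgt a) = d (N.tail a) + 1 then r a else 0

/-- The reversal of a level arc goes down one level, so it is not a level arc and its gain does not
count. -/
theorem Network.weight_push (N : Network n m E) {d r : ℕ → ℕ} {a : ℕ} (ha : a < m + m)
    (hr : 0 < r a) (hd : d (N.tgt a) = d (N.tail a) + 1) :
    N.weight d (N.push r a) + 1 = N.weight d r := by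
  have hmem := Finset.mem_range.2 ha
  rw [Network.weight, Network.weight, ← Finset.add_sum_erase _ _ hmem,
    ← Finset.add_sum_erase (Finset.range (m + m)) (fun a => ite _ (r a) _) hmem, if_pos hd,
    if_pos hd, N.push_apply r ha, if_pos rfl]
  have : ∑ b ∈ (Finset.range (m + m)).erase a,
        (if d (N.tgt b) = d (N.tail b) + 1 then N.push r a b else 0) =
      ∑ b ∈ (Finset.range (m + m)).erase a,
        (if d (N.tgt b) = d (N.tail b) + 1 then r b else 0) := by
    refine Finset.sum_congr rfl fun b hb => ?_
    split_ifs with hdb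
    · rw [N.push_apply r ha, if_neg (Finset.ne_of_mem_erase hb), if_neg]
      rintro rfl
      rw [N.tail_rev ha, ← Network.tail] at hdb
      omega
    · rfl
  omega

theorem Network.excess_push (N : Network n m E) {r : ℕ → ℕ} {a : ℕ} (ha : a < m + m)
    (hr : 0 < r a) (y : ℕ) : N.excess (N.push r a) y =
      N.excess r y + (if y = N.tail a then 1 else 0) - (if y = N.tgt a then 1 else 0) := by
  have hne := N.rev_ne ha
  have h : ∀ b ∈ Finset.range (m + m),
      (if N.tail b = y then 1 - (N.push r a b : ℤ) else 0) =
      (if N.tail b = y then 1 - (r b : ℤ) else 0) +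
        (if b = a then (if y = N.tail a then 1 else 0) else 0) -
        (if b = N.rev a then (if y = N.tgt a then 1 else 0) else 0) := by
    intro b _
    rw [N.push_apply r ha]
    by_cases hba : b = a
    · subst hba
      by_cases hy : N.tail b = y
      · simp [hy, Ne.symm hne]; omega
      · simp [hy, Ne.symm hne, Ne.symm (a := N.tail b) hy]
    · by_cases hbr : b = N.rev a
      · subst hbr
        rw [N.tail_rev ha]
        by_cases hy : N.tgt a = y
        · simp [hy, hne]
        · simp [hy, hne, Ne.symm (a := N.tgt a) hy]
      · simp [hba, hbr]
  rw [Network.excess, Finset.sum_congr rfl h, Finset.sum_sub_distrib, Finset.sum_add_distrib,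
    Finset.sum_ite_eq', Finset.sum_ite_eq', if_pos (Finset.mem_range.2 ha),
    if_pos (Finset.mem_range.2 (N.rev_lt a ha)), Network.excess]

/-- The nodes on a path that starts at `u`. -/
def Network.node (N : Network n m E) (u : ℕ) (path : ℕ → ℕ) : ℕ → ℕ
  | 0 => u
  | i + 1 => N.tgt (path i)

theorem Network.node_update (N : Network n m E) {u : ℕ} {path : ℕ → ℕ} {i k a : ℕ} (h : i ≤ k) :
    N.node u (Function.update path k a) i = N.node u path i := by
  cases i with
  | zero => rfl
  | succ i => simp [Network.node, show i ≠ k by omega]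

/-- The invariant of the depth-first search for a blocking flow. -/
structure DFSInv (N : Network n m E) (u v : ℕ) (d r₀ : ℕ → ℕ) (F₀ : ℕ) (cur r path : ℕ → ℕ)
    (x depth F : ℕ) (rem : ℕ → List ℕ) : Prop where
  chains : Chains n cur N.nxt rem
  sub : ∀ y < n, ∀ a ∈ rem y, a < m + m ∧ N.tail a = y
  arc : ∀ i < depth, path i < m + m ∧ N.tail (path i) = N.node u path i ∧
    d (N.tail (path i)) = i + 1 ∧ d (N.tgt (path i)) = i + 2 ∧ 0 < r (path i) ∧
    cur (N.tail (path i)) = path i + 1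
  x_eq : x = N.node u path depth
  flow : N.IsFlow u v r F
  dead : ∀ a < m + m, a ∉ rem (N.tail a) → 0 < r a → d (N.tgt a) = d (N.tail a) + 1 →
    N.tgt a ≠ v ∧ cur (N.tgt a) = 0
  back : ∀ a < m + m, 0 < r a → 0 < r₀ a ∨ (0 < d (N.tgt a) ∧ d (N.tgt a) < d (N.tail a))
  progress : F₀ < F ∨ (F₀ = F ∧ ∀ a < m + m, r a = r₀ a)

namespace DFSInv

variable {N : Network n m E} {u v : ℕ} {d r₀ : ℕ → ℕ} {F₀ : ℕ} {cur r path : ℕ → ℕ}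
  {x depth F : ℕ} {rem : ℕ → List ℕ}

theorem level_x (h : DFSInv N u v d r₀ F₀ cur r path x depth F rem) (hu : d u = 1) :
    d x = depth + 1 := by
  rw [h.x_eq]
  cases depth with
  | zero => exact hu
  | succ k => exact (h.arc k (by omega)).2.2.2.1

theorem x_lt (h : DFSInv N u v d r₀ F₀ cur r path x depth F rem) (hu : u < n) : x < n := by
  rw [h.x_eq]
  cases depth with
  | zero => exact hu
  | succ k => exact N.tgt_lt _ (h.arc k (by omega)).1

theorem depth_pos (h : DFSInv N u v d r₀ F₀ cur r path x depth F rem) (hx : x ≠ u) :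
    0 < depth := by
  rcases Nat.eq_zero_or_pos depth with rfl | h'
  · exact absurd h.x_eq hx
  · exact h'

/-- The arcs of the path lie on different levels, hence are distinct, and each has residual
capacity. This keeps the potential in `blockingFlow_runs` nonnegative, where the depth enters with a
negative sign. -/
theorem depth_le_weight (h : DFSInv N u v d r₀ F₀ cur r path x depth F rem) :
    depth ≤ N.weight d r := by
  have hinj : Set.InjOn path (Finset.range depth) := by
    intro i hi j hj hij
    have h₁ := (h.arc i (by simpa using hi)).2.2.1
    have h₂ := (h.arc j (by simpa using hj)).2.2.1
    rw [hij] at h₁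
    omega
  calc depth = ∑ _i ∈ Finset.range depth, 1 := by simp
    _ ≤ ∑ i ∈ Finset.range depth, (if d (N.tgt (path i)) = d (N.tail (path i)) + 1
          then r (path i) else 0) := by
        refine Finset.sum_le_sum fun i hi => ?_
        obtain ⟨-, -, h₁, h₂, h₃, -⟩ := h.arc i (Finset.mem_range.1 hi)
        rw [if_pos (by omega)]
        omega
    _ = ∑ a ∈ (Finset.range depth).image path, (if d (N.tgt a) = d (N.tail a) + 1
          then r a else 0) := (Finset.sum_image (f := fun a =>
          if d (N.tgt a) = d (N.tail a) + 1 then r a else 0) hinj).symm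
    _ ≤ N.weight d r := by
        refine Finset.sum_le_sum_of_subset ?_
        intro a ha
        obtain ⟨i, hi, rfl⟩ := Finset.mem_image.1 ha
        exact Finset.mem_range.2 (h.arc i (Finset.mem_range.1 hi)).1

theorem skip (h : DFSInv N u v d r₀ F₀ cur r path x depth F rem) (hu : d u = 1) {a : ℕ}
    {L : List ℕ} (hx : x < n) (hL : rem x = a :: L)
    (hs : ¬ (0 < r a ∧ d (N.tgt a) = d x + 1)) :
    DFSInv N u v d r₀ F₀ (Function.update cur x (N.nxt a)) r path x depth F
      (Function.update rem x L) where
  chains y hy := by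
    by_cases hyx : y = x
    · subst hyx
      have := h.chains y hy
      rw [hL] at this
      simpa using this.2
    · simpa [hyx] using h.chains y hy
  sub y hy b hb := by
    by_cases hyx : y = x
    · subst hyx
      exact h.sub y hy b (by rw [hL]; simp at hb; simp [hb])
    · exact h.sub y hy b (by simpa [hyx] using hb)
  arc i hi := by
    obtain ⟨h₁, h₂, h₃, h₄, h₅, h₆⟩ := h.arc i hi
    have hne : N.tail (path i) ≠ x := by
      intro he
      have := h.level_x hu
      rw [← he] at this
      omega
    exact ⟨h₁, h₂, h₃, h₄, h₅, by simpa [hne] using h₆⟩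
  x_eq := h.x_eq
  flow := h.flow
  dead b hb hbr hrb hdb := by
    have hnew : b ∉ rem (N.tail b) := by
      by_cases hyx : N.tail b = x
      · rw [hyx, Function.update_self] at hbr
        rw [hyx, hL, List.mem_cons, not_or]
        refine ⟨?_, hbr⟩
        rintro rfl
        exact hs ⟨hrb, by rw [hdb, hyx]⟩
      · simpa [hyx] using hbr
    obtain ⟨h₁, h₂⟩ := h.dead b hb hnew hrb hdb
    -- A dead head has pointer `0`, whereas the list of `x` is still nonempty.
    have hne : N.tgt b ≠ x := by
      intro he
      have := h.chains x hx
      rw [← he, h₂] at this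
      rw [← he, this.eq_nil] at hL
      simp at hL
    exact ⟨h₁, by simpa [hne] using h₂⟩
  back := h.back
  progress := h.progress

theorem advance (h : DFSInv N u v d r₀ F₀ cur r path x depth F rem) (hu : d u = 1) {a : ℕ}
    {L : List ℕ} (hx : x < n) (hL : rem x = a :: L) (hr : 0 < r a)
    (hd : d (N.tgt a) = d x + 1) :
    DFSInv N u v d r₀ F₀ cur r (Function.update path depth a) (N.tgt a) (depth + 1) F rem where
  chains := h.chains
  sub := h.sub
  arc i hi := by
    rcases Nat.lt_succ_iff_lt_or_eq.1 hi with hi | rfl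
    · rw [N.node_update hi.le, Function.update_of_ne hi.ne]
      exact h.arc i hi
    · obtain ⟨h₁, h₂⟩ := h.sub x hx a (by simp [hL])
      have h₃ := h.level_x hu
      have h₄ := h.chains x hx
      rw [hL] at h₄
      rw [N.node_update le_rfl, Function.update_self, h₂]
      exact ⟨h₁, h.x_eq, h₃, by omega, hr, h₄.1⟩
  x_eq := by simp [Network.node]
  flow := h.flow
  dead := h.dead
  back := h.back
  progress := h.progress

/-- The node `x` is exhausted, so the arc leading to it may be passed without violating `dead`. That
arc is the current arc of its tail, by the last clause of `arc`; moving the pointer drops exactly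
it. -/
theorem retreat (h : DFSInv N u v d r₀ F₀ cur r path x (depth + 1) F rem)
    (hxv : x ≠ v) (hcur : cur x = 0) :
    ∃ L, rem (N.tail (path depth)) = path depth :: L ∧
    DFSInv N u v d r₀ F₀ (Function.update cur (N.tail (path depth)) (N.nxt (path depth))) r path
      (N.tail (path depth)) depth F (Function.update rem (N.tail (path depth)) L) := by
  obtain ⟨ha, ht, hd₁, hd₂, hr, hc⟩ := h.arc depth (by omega)
  have hlt := N.tail_lt ha
  obtain ⟨a, L, hL, he, -⟩ := (h.chains _ hlt).eq_cons (by omega)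
  obtain rfl : path depth = a := by omega
  have hx := h.x_eq
  rw [Network.node] at hx
  refine ⟨L, hL, ?_, ?_, ?_, ht, h.flow, ?_, h.back, h.progress⟩
  · intro y hy
    by_cases hyx : y = N.tail (path depth)
    · subst hyx
      have := h.chains _ hy
      rw [hL] at this
      simpa using this.2
    · simpa [hyx] using h.chains y hy
  · intro y hy b hb
    by_cases hyx : y = N.tail (path depth)
    · subst hyx
      exact h.sub _ hy b (by rw [hL]; simp at hb; simp [hb])
    · exact h.sub y hy b (by simpa [hyx] using hb)
  · intro i hi
    obtain ⟨h₁, h₂, h₃, h₄, h₅, h₆⟩ := h.arc i (by omega)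
    have hne : N.tail (path i) ≠ N.tail (path depth) := by
      intro he
      rw [he] at h₃
      omega
    exact ⟨h₁, h₂, h₃, h₄, h₅, by simpa [hne] using h₆⟩
  · intro b hb hbr hrb hdb
    have hdead : N.tgt b ≠ v ∧ cur (N.tgt b) = 0 := by
      by_cases hba : b = path depth
      · subst hba
        rw [← hx]
        exact ⟨hxv, hcur⟩
      · refine h.dead b hb ?_ hrb hdb
        by_cases hyx : N.tail b = N.tail (path depth)
        · rw [hyx, Function.update_self] at hbr
          rw [hyx, hL, List.mem_cons, not_or]
          exact ⟨hba, hbr⟩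
        · simpa [hyx] using hbr
    have hne : N.tgt b ≠ N.tail (path depth) := by
      intro he
      rw [he] at hdead
      omega
    exact ⟨hdead.1, by simpa [hne] using hdead.2⟩

end DFSInv

/-- The invariant of the augmentation along a path: the arcs from number `k` on have been
treated. -/
structure AugInv (N : Network n m E) (u v : ℕ) (d r path : ℕ → ℕ) (depth k : ℕ) (r' : ℕ → ℕ) :
    Prop where
  pair : ∀ a < m + m, r' a + r' (N.rev a) = 2
  excess : ∀ y, N.excess r' y = N.excess r y + (if y = N.node u path k then 1 else 0) -
    (if y = v then 1 else 0)
  keep : ∀ i < k, r' (path i) = r (path i)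
  adm : ∀ a < m + m, d (N.tgt a) = d (N.tail a) + 1 → r' a ≤ r a
  back : ∀ a < m + m, 0 < r' a → 0 < r a ∨ (0 < d (N.tgt a) ∧ d (N.tgt a) < d (N.tail a))
  weight : N.weight d r' + depth ≤ N.weight d r + k

namespace AugInv

variable {N : Network n m E} {u v : ℕ} {d r₀ : ℕ → ℕ} {F₀ : ℕ} {cur r path : ℕ → ℕ}
  {x depth F k : ℕ} {rem : ℕ → List ℕ} {r' : ℕ → ℕ}

theorem init (h : DFSInv N u v d r₀ F₀ cur r path v depth F rem) :
    AugInv N u v d r path depth depth r where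
  pair := h.flow.pair
  excess y := by rw [← h.x_eq]; ring
  keep _ _ := rfl
  adm _ _ _ := le_rfl
  back _ _ := .inl
  weight := le_rfl

/-- Arcs are treated from `v` back to `u`. Meanwhile the capacities do not belong to a flow: the
unit is in surplus at node number `k` of the path and missing at `v`. Since the path arcs start on
different levels, the untreated ones still have their old capacities. -/
theorem step (h : DFSInv N u v d r₀ F₀ cur r path x depth F rem) (hk : k < depth)
    (hi : AugInv N u v d r path depth (k + 1) r') :
    AugInv N u v d r path depth k (N.push r' (path k)) := by
  obtain ⟨ha, ht, hd₁, hd₂, hr, -⟩ := h.arc k hk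
  have hne := N.rev_ne ha
  have hr' : 0 < r' (path k) := by rwa [hi.keep k (by omega)]
  have hadm : d (N.tgt (path k)) = d (N.tail (path k)) + 1 := by omega
  have hp := hi.pair _ ha
  refine ⟨fun b hb => ?_, fun y => ?_, fun i hik => ?_, fun b hb hdb => ?_, fun b hb hrb => ?_, ?_⟩
  · rw [N.push_apply _ ha, N.push_apply _ ha]
    have hpb := hi.pair b hb
    by_cases h₁ : b = path k
    · subst h₁
      rw [if_pos rfl, if_neg hne, if_pos rfl]
      omega
    · by_cases h₂ : b = N.rev (path k)
      · subst h₂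
        rw [if_neg h₁, if_pos rfl, N.rev_rev _ ha, if_pos rfl]
        omega
      · have h₃ : N.rev b ≠ path k := fun he => h₂ (by rw [← he, N.rev_rev b hb])
        have h₄ : N.rev b ≠ N.rev (path k) := fun he => h₁ (by
          rw [← N.rev_rev b hb, he, N.rev_rev _ ha])
        rw [if_neg h₁, if_neg h₂, if_neg h₃, if_neg h₄]
        exact hpb
  · have hnode : N.node u path (k + 1) = N.tgt (path k) := rfl
    rw [N.excess_push ha hr', hi.excess, ht, hnode]
    ring
  · obtain ⟨ha', -, hd₁', -⟩ := h.arc i (by omega)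
    rw [N.push_apply _ ha, if_neg, if_neg, hi.keep i (by omega)]
    · intro he
      rw [he, N.tail_rev ha] at hd₁'
      omega
    · intro he
      rw [he] at hd₁'
      omega
  · have := hi.adm b hb hdb
    rw [N.push_apply _ ha]
    split_ifs with h₁ h₂
    · subst h₁; omega
    · subst h₂
      rw [N.tail_rev ha, ← Network.tail] at hdb
      omega
    · exact this
  · rw [N.push_apply _ ha] at hrb
    split_ifs at hrb with h₁ h₂
    · subst h₁; exact .inl hr
    · subst h₂
      right
      rw [N.tail_rev ha, ← Network.tail]
      omega
    · exact hi.back b hb hrb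
  · have := N.weight_push ha hr' hadm
    have := hi.weight
    omega

/-- An augmentation only lowers the capacities of level arcs (`adm`), so no arc that has been passed
becomes admissible again. Hence `dead` survives and the pointers need not be reset. -/
theorem finish (h : DFSInv N u v d r₀ F₀ cur r path v depth F rem) (huv : u ≠ v)
    (hi : AugInv N u v d r path depth 0 r') :
    DFSInv N u v d r₀ F₀ cur r' path u 0 (F + 1) rem where
  chains := h.chains
  sub := h.sub
  arc i hi := absurd hi (by omega)
  x_eq := rfl
  flow := by
    refine ⟨hi.pair, fun y hy hyu hyv => ?_, ?_⟩
    · rw [hi.excess, h.flow.conservation y hy hyu hyv]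
      simp [Network.node, hyu, hyv]
    · rw [hi.excess, h.flow.value]
      simp [Network.node, huv]
  dead a ha har hra hda := h.dead a ha har (by have := hi.adm a ha hda; omega) hda
  back a ha hra := by
    rcases hi.back a ha hra with h' | h'
    · exact h.back a ha h'
    · exact .inr h'
  progress := by
    rcases h.progress with h' | ⟨h', -⟩ <;> left <;> omega

end AugInv

theorem sum_length_update {n x a : ℕ} {rem : ℕ → List ℕ} {L : List ℕ} (hx : x < n)
    (hL : rem x = a :: L) :
    ∑ y ∈ Finset.range n, (Function.update rem x L y).length + 1 =
      ∑ y ∈ Finset.range n, (rem y).length := by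
  have hmem := Finset.mem_range.2 hx
  rw [← Finset.add_sum_erase _ _ hmem, ← Finset.add_sum_erase _ (fun y => (rem y).length) hmem, hL]
  have : ∑ y ∈ (Finset.range n).erase x, (Function.update rem x L y).length =
      ∑ y ∈ (Finset.range n).erase x, (rem y).length :=
    Finset.sum_congr rfl fun y hy => by simp [Finset.ne_of_mem_erase hy]
  simp
  omega

theorem augment_runs {N : Network n m E} {s : State} {d r₀ : ℕ → ℕ} {F₀ : ℕ}
    {rem : ℕ → List ℕ} (hrev : s.arr .rev = N.rev) (huv : s.reg .u ≠ s.reg .v)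
    (h : DFSInv N (s.reg .u) (s.reg .v) d r₀ F₀ (s.arr .cur) (s.arr .res) (s.arr .path)
      (s.reg .v) (s.reg .depth) (s.reg .flow) rem) :
    Runs Prog.augment s (fun s' t => Frame Prog.augment s s' ∧
      DFSInv N (s.reg .u) (s.reg .v) d r₀ F₀ (s'.arr .cur) (s'.arr .res) (s'.arr .path)
        (s'.reg .x) (s'.reg .depth) (s'.reg .flow) rem ∧ s'.reg .depth = 0 ∧
      N.weight d (s'.arr .res) + s.reg .depth ≤ N.weight d (s.arr .res) ∧
      t ≤ 60 * s.reg .depth + 20) := by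
  apply Runs.frame
  simp only [Prog.augment, Prog.block, runs_seq]
  refine (Runs.loop (fun s' φ => AugInv N (s.reg .u) (s.reg .v) d (s.arr .res) (s.arr .path)
    (s.reg .depth) (s'.reg .depth) (s'.arr .res) ∧ s'.reg .depth ≤ s.reg .depth ∧
    φ = 60 * s'.reg .depth) ⟨AugInv.init h, le_rfl, rfl⟩ ?_).mono ?_
  · rintro s' φ hf ⟨hI, hle, rfl⟩ hc
    simp only [Test.eval, Expr.eval, Expr.eval_zero] at hc
    obtain ⟨k, hk⟩ : ∃ k, s'.reg .depth = k + 1 := ⟨s'.reg .depth - 1, by omega⟩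
    have hpath : s'.arr .path = s.arr .path := hf.arr .path rfl
    have hrev' : s'.arr .rev = N.rev := (hf.arr .rev rfl).trans hrev
    rw [hk] at hI hle
    simp only [runs_set, runs_put, runs_seq]
    refine ⟨_, ⟨?_, ?_, rfl⟩, ?_⟩
    · simpa [hk, hpath, hrev', Network.push] using AugInv.step h (by omega) hI
    · simp; omega
    · simp; omega
  · rintro s' t ⟨hf, hc, φ', ⟨hI, hle, rfl⟩, ht⟩
    simp only [Test.eval, Expr.eval, Expr.eval_zero] at hc
    have hz : s'.reg .depth = 0 := by omega
    rw [hz] at hI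
    have hu : s'.reg .u = s.reg .u := hf.reg .u rfl
    have hfl : s'.reg .flow = s.reg .flow := hf.reg .flow rfl
    have hpath : s'.arr .path = s.arr .path := hf.arr .path rfl
    have hcur : s'.arr .cur = s.arr .cur := hf.arr .cur rfl
    simp only [runs_set]
    refine ⟨?_, by simpa using hz, by simpa using hI.weight, ?_⟩
    · simpa [hpath, hcur, hu, hfl, hz] using AugInv.finish h huv hI
    · simp at ht ⊢
      omega

theorem blockingFlow_runs {N : Network n m E} {s : State} (hN : N.Holds s) (hu : s.reg .u < n)
    (huv : s.reg .u ≠ s.reg .v) (hd : s.arr .level (s.reg .u) = 1)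
    (hflow : N.IsFlow (s.reg .u) (s.reg .v) (s.arr .res) (s.reg .flow)) :
    Runs Prog.blockingFlow s (fun s' t => Frame Prog.blockingFlow s s' ∧
      N.IsFlow (s.reg .u) (s.reg .v) (s'.arr .res) (s'.reg .flow) ∧
      (∃ dead : ℕ → Prop, dead (s.reg .u) ∧ ¬ dead (s.reg .v) ∧
        ∀ a < m + m, dead (N.tail a) → 0 < s'.arr .res a →
          s.arr .level (N.tgt a) = s.arr .level (N.tail a) + 1 → dead (N.tgt a)) ∧
      (∀ a < m + m, 0 < s'.arr .res a → 0 < s.arr .res a ∨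
        (0 < s.arr .level (N.tgt a) ∧ s.arr .level (N.tgt a) < s.arr .level (N.tail a))) ∧
      (s.reg .flow < s'.reg .flow ∨
        (s.reg .flow = s'.reg .flow ∧ ∀ a < m + m, s'.arr .res a = s.arr .res a)) ∧
      t ≤ 1200 * (n + m) + 500) := by
  apply Runs.frame
  simp only [Prog.blockingFlow, Prog.block, runs_seq]
  refine (Runs.upTo (fun i s' => ∀ x < i, s'.arr .cur x = N.head x) 10 rfl rfl (by simp)
    (by simp) ?_).mono ?_
  · intro i s' hi hf hri h
    have hhead : s'.arr .head = N.head := (hf.arr .head rfl).trans hN.head_eq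
    simp only [runs_put]
    refine ⟨by simp, fun x hx => ?_⟩
    rcases Nat.lt_succ_iff_lt_or_eq.1 hx with hx | rfl
    · simpa [hri, hx.ne] using h x hx
    · simp [hri, hhead]
  rintro s₁ t₁ ⟨hf₁, h₁, ht₁⟩
  have hN₁ : N.Holds s₁ := hN.frame hf₁ rfl
  have hu₁ : s₁.reg .u = s.reg .u := hf₁.reg .u rfl
  have hv₁ : s₁.reg .v = s.reg .v := hf₁.reg .v rfl
  have hl₁ : s₁.arr .level = s.arr .level := hf₁.arr .level rfl
  have hr₁ : s₁.arr .res = s.arr .res := hf₁.arr .res rfl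
  have hF₁ : s₁.reg .flow = s.reg .flow := hf₁.reg .flow rfl
  rw [hN.n_eq] at h₁ ht₁
  simp only [runs_set]
  have hW : N.weight (s.arr .level) (s.arr .res) ≤ m + m := by
    have h₁ := N.sum_rev (s.arr .res)
    have h₂ : ∑ a ∈ Finset.range (m + m), (s.arr .res a + s.arr .res (N.rev a)) = (m + m) * 2 := by
      rw [Finset.sum_congr rfl fun a ha => hflow.pair a (Finset.mem_range.1 ha)]
      simp
    rw [Finset.sum_add_distrib] at h₂
    have h₃ : N.weight (s.arr .level) (s.arr .res) ≤ ∑ a ∈ Finset.range (m + m), s.arr .res a :=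
      Finset.sum_le_sum fun a _ => by split_ifs <;> omega
    omega
  -- The potential drops by 100 on an advance (one level deeper), by 200 on a skip (one list entry
  -- less), and by 200 - 100 on a retreat. An augmentation of length `ℓ` lowers the weight by at
  -- least `ℓ` and resets the depth, a drop of at least `300ℓ - 100ℓ`, while `augment` costs `60ℓ +
  -- 20`. The last 200 pay for the end of the search.
  refine (Runs.loop (fun s' φ => ∃ rem, DFSInv N (s.reg .u) (s.reg .v) (s.arr .level)
    (s.arr .res) (s.reg .flow) (s'.arr .cur) (s'.arr .res) (s'.arr .path) (s'.reg .x)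
    (s'.reg .depth) (s'.reg .flow) rem ∧ (s'.reg .fin ≠ 0 → s'.arr .cur (s.reg .u) = 0) ∧
    φ + 100 * s'.reg .depth = 200 * (∑ y ∈ Finset.range n, (rem y).length) +
      300 * N.weight (s.arr .level) (s'.arr .res) + (if s'.reg .fin = 0 then 200 else 0))
    (φ := 200 * (m + m) + 300 * N.weight (s.arr .level) (s.arr .res) + 200) ?_ ?_).mono ?_
  · refine ⟨N.adj, ⟨?_, ?_, by simp, by simp [Network.node, hu₁], by simpa [hr₁, hF₁] using hflow,
      ?_, ?_, ?_⟩, by simp, ?_⟩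
    · intro y hy
      simpa [h₁ y hy] using N.chains y hy
    · intro y hy a ha
      exact (N.mem_adj y hy a).1 ha
    · intro a ha hn
      exact absurd ((N.mem_adj _ (N.tail_lt ha) a).2 ⟨ha, rfl⟩) hn
    · intro a _ h
      exact .inl (by simpa [hr₁] using h)
    · right
      simp [hF₁, hr₁]
    · simp [N.sum_length_adj, hr₁]
  · rintro s₂ φ hf₂ ⟨rem, hI, hfin, hφ⟩ hc
    simp only [Test.eval, Expr.eval, Expr.eval_zero] at hc
    have hu₂ : s₂.reg .u = s.reg .u := by rw [hf₂.reg .u rfl]; simpa using hu₁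
    have hv₂ : s₂.reg .v = s.reg .v := by rw [hf₂.reg .v rfl]; simpa using hv₁
    have hl₂ : s₂.arr .level = s.arr .level := by rw [hf₂.arr .level rfl]; simpa using hl₁
    have ht₂ : s₂.arr .target = N.tgt := by rw [hf₂.arr .target rfl]; simpa using hN₁.tgt_eq
    have hrev₂ : s₂.arr .rev = N.rev := by rw [hf₂.arr .rev rfl]; simpa using hN₁.rev_eq
    have hn₂ : s₂.arr .nxt = N.nxt := by rw [hf₂.arr .nxt rfl]; simpa using hN₁.nxt_eq
    have hxlt := hI.x_lt hu
    have hW₂ := hI.depth_le_weight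
    rw [if_pos hc] at hφ
    simp only [runs_ite, Test.eval, Expr.eval, Expr.eval_zero, hv₂, hu₂]
    refine ⟨fun hxv => ?_, fun hxv => ⟨fun hcx => ⟨fun hxu => ?_, fun hxu => ?_⟩, fun hcx => ?_⟩⟩
    · have hpos := hI.depth_pos (hxv ▸ huv.symm)
      refine (augment_runs hrev₂ (by rw [hu₂, hv₂]; exact huv)
        (by rw [hu₂, hv₂, ← hxv]; rw [hxv]; rw [hxv] at hI; exact hI)).mono ?_
      rintro s₃ t₃ ⟨hf₃, hI₃, hdep, hw, ht₃⟩
      rw [hu₂, hv₂] at hI₃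
      have hcur₃ : s₃.arr .cur = s₂.arr .cur := hf₃.arr .cur rfl
      have hfin₃ : s₃.reg .fin = s₂.reg .fin := hf₃.reg .fin rfl
      refine ⟨200 * (∑ y ∈ Finset.range n, (rem y).length) +
        300 * N.weight (s.arr .level) (s₃.arr .res) + 200, ⟨rem, hI₃, ?_, ?_⟩, ?_⟩
      · rw [hfin₃, hcur₃]; exact hfin
      · rw [hdep, hfin₃, if_pos hc]
      · simp
        omega
    · simp only [runs_set]
      refine ⟨φ - 200, ⟨rem, by simpa using hI, ?_, ?_⟩, ?_⟩
      · intro _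
        simpa [← hxu] using hcx
      · simp
        omega
      · simp
        omega
    · obtain ⟨k, hk⟩ : ∃ k, s₂.reg .depth = k + 1 := ⟨s₂.reg .depth - 1, by
        have := hI.depth_pos hxu; omega⟩
      rw [hk] at hI
      obtain ⟨L, hL, hI'⟩ := hI.retreat hxv hcx
      have hlt := N.tail_lt (hI.arc k (by omega)).1
      have hsum := sum_length_update hlt hL
      have hcur := (hI.arc k (by omega)).2.2.2.2.2
      simp only [Network.tail] at hI' hsum hcur
      simp only [runs_seq, runs_set, runs_put]
      refine ⟨φ - 100, ⟨Function.update rem (N.tgt (N.rev (s₂.arr .path k))) L, ?_, ?_, ?_⟩, ?_⟩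
      · simpa [hk, ht₂, hrev₂, hn₂, hcur] using hI'
      · simp [hc]
      · simp [hk, hc] at hφ ⊢
        omega
      · simp
        omega
    · obtain ⟨a, L, hL, ha, hL'⟩ := (hI.chains _ hxlt).eq_cons hcx
      have hsum := sum_length_update hxlt hL
      simp only [runs_seq, runs_set, runs_put, runs_ite]
      constructor
      · intro hadm
        simp [ha, ht₂, hl₂] at hadm
        refine ⟨φ - 100, ⟨rem, ?_, ?_, ?_⟩, ?_⟩
        · simpa [ha, ht₂] using hI.advance hd hxlt hL hadm.1 hadm.2
        · simp [hc]
        · simp [hc]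
          omega
        · simp
          omega
      · intro hadm
        refine ⟨φ - 200, ⟨Function.update rem (s₂.reg .x) L, ?_, ?_, ?_⟩, ?_⟩
        · simpa [ha, hn₂] using hI.skip hd hxlt hL (by simpa [ha, ht₂, hl₂] using hadm)
        · simp [hc]
        · simp [hc]
          omega
        · simp
          omega
  · rintro s₂ t₂ ⟨hf₂, hc, φ', ⟨rem, hI, hfin, hφ⟩, ht₂⟩
    simp only [Test.eval, Expr.eval, Expr.eval_zero] at hc
    -- The dead nodes are those other than `v` whose pointer has reached the end of the list; the
    -- search stops when `u` is one of them.
    refine ⟨hI.flow, ⟨fun y => y < n ∧ y ≠ s.reg .v ∧ s₂.arr .cur y = 0,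
      ⟨hu, huv, hfin hc⟩, fun h => h.2.1 rfl, ?_⟩, hI.back, hI.progress, ?_⟩
    · rintro a ha ⟨h₁, h₂, h₃⟩ hr hda
      have := hI.chains _ h₁
      rw [h₃] at this
      have hnil := this.eq_nil
      obtain ⟨h₄, h₅⟩ := hI.dead a ha (by simp [hnil]) hr hda
      exact ⟨N.tgt_lt a ha, h₄, h₅⟩
    · simp at ht₂ ⊢
      omega

end BlockingFlow

/-! ## Dinic's algorithm and HandleDeletion -/

@[simp] theorem forward_eval (s : State) :
    Prog.forward.eval s = s.arr .res (s.reg .a - 1) := rfl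

@[simp] theorem backward_eval (s : State) :
    Prog.backward.eval s = s.arr .res (s.arr .rev (s.reg .a - 1)) := rfl

theorem Network.isFlow_zero {n m : ℕ} {E : Set (Sym2 ℕ)} (N : Network n m E) {u v : ℕ} {r : ℕ → ℕ}
    (hr : ∀ a < m + m, r a = 1) : N.IsFlow u v r 0 := by
  have h : ∀ x, N.excess r x = 0 := fun x => by
    refine Finset.sum_eq_zero fun a ha => ?_
    rw [hr a (Finset.mem_range.1 ha)]
    simp
  exact ⟨fun a ha => by rw [hr a ha, hr _ (N.rev_lt a ha)], fun x _ _ _ => h x, h u⟩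

theorem dinicMaxFlow_runs {n : ℕ} {G : SimpleGraph (Fin n)} {u v : Fin n} (huv : u ≠ v)
    {s : State} (hn : s.reg .n = n) (hu : s.reg .u = u) (hv : s.reg .v = v)
    (hE : HasEdges s (natEdges G)) {D : ℕ}
    (hD : s.reg .m < (D + 1) ^ 2 ∨ n ^ 2 < (D + 1) ^ 3) :
    Runs Prog.dinicMaxFlow s (fun s' t => Frame Prog.dinicMaxFlow s s' ∧
      (∃ N : Network n (s.reg .m) (natEdges G), N.Holds s' ∧
        N.IsFlow u v (s'.arr .res) (s'.reg .flow) ∧ IsBFS N u (s'.arr .res) (s'.arr .level) ∧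
        s'.arr .level v = 0) ∧
      t ≤ 5000 * ((D + 1) * (n + s.reg .m + 1))) := by
  have huv' : (u : ℕ) ≠ v := fun h => huv (Fin.ext h)
  apply Runs.frame
  simp only [Prog.dinicMaxFlow, Prog.block, runs_seq]
  refine (buildNetwork_runs hn hE (validEdges_natEdges G)).mono ?_
  rintro s₁ t₁ ⟨hf₁, ht₁, hres₁, -, N, hN₁⟩
  have hu₁ : s₁.reg .u = u := (hf₁.reg .u rfl).trans hu
  have hv₁ : s₁.reg .v = v := (hf₁.reg .v rfl).trans hv
  simp only [runs_set]
  have hN₁' : N.Holds (s₁.setReg .flow 0) :=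
    ⟨by simpa using hN₁.n_eq, by simpa using hN₁.m_eq, hN₁.tgt_eq, hN₁.rev_eq, hN₁.head_eq,
      hN₁.nxt_eq⟩
  refine (search_runs N hN₁' (.inl rfl) (.inl rfl) (κ := s₁.arr .res) (by simp [hu₁])
    (by simp [Prog.forward]) (fun s' _ h => by simp [h])).mono ?_
  rintro s₂ t₂ ⟨hf₂, hbfs₂, ht₂⟩
  simp [hu₁] at hbfs₂
  have hN₂ := hN₁'.frame hf₂ rfl
  have hu₂ : s₂.reg .u = u := by rw [hf₂.reg .u rfl]; simpa using hu₁
  have hv₂ : s₂.reg .v = v := by rw [hf₂.reg .v rfl]; simpa using hv₁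
  have hres₂ : s₂.arr .res = s₁.arr .res := by rw [hf₂.arr .res rfl]; simp
  have hfl₂ : s₂.reg .flow = 0 := by rw [hf₂.reg .flow rfl]; simp
  -- The number `j` bounds the remaining phases. While the distance `L` is at most `D`, a phase
  -- increases `L`; beyond `D`, at most `2D + 2` units are missing and a phase supplies at least
  -- one. Starting from `L ≥ 0` this makes `D + (2D + 2) + 1 = 3D + 3` phases at most.
  refine (Runs.loop (fun s' φ => N.IsFlow u v (s'.arr .res) (s'.reg .flow) ∧
    IsBFS N u (s'.arr .res) (s'.arr .level) ∧ ∃ j, φ = (1400 * (n + s.reg .m) + 700) * j ∧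
      (s'.arr .level v = 0 ∨ ∃ L, s'.arr .level v = L + 1 ∧
        ((L ≤ D ∧ D - L + (2 * D + 2) + 1 ≤ j) ∨
          ∀ g, IsUnitFlow G u v g → flowValue u g ≤ s'.reg .flow + (j : ℤ))))
    (φ := (1400 * (n + s.reg .m) + 700) * (3 * D + 3)) ?_ ?_).mono ?_
  · have hflow : N.IsFlow u v (s₂.arr .res) (s₂.reg .flow) := by
      rw [hres₂, hfl₂]
      exact N.isFlow_zero hres₁
    have hbfs : IsBFS N u (s₂.arr .res) (s₂.arr .level) := by rwa [hres₂]
    refine ⟨hflow, hbfs, _, rfl, ?_⟩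
    rcases Nat.eq_zero_or_pos (s₂.arr .level v) with h | h
    · exact .inl h
    · obtain ⟨L, hL⟩ : ∃ L, s₂.arr .level v = L + 1 := ⟨s₂.arr .level v - 1, by omega⟩
      refine .inr ⟨L, hL, ?_⟩
      by_cases hLD : L ≤ D
      · exact .inl ⟨hLD, by omega⟩
      · refine .inr fun g hg => ?_
        have := hbfs.remaining_le hflow hL hg hD (by omega)
        push_cast
        linarith
  · rintro s₃ φ hf₃ ⟨hflow, hbfs, j, rfl, hj⟩ hc
    have hu₃ : s₃.reg .u = u := (hf₃.reg .u rfl).trans hu₂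
    have hv₃ : s₃.reg .v = v := (hf₃.reg .v rfl).trans hv₂
    have hN₃ := hN₂.frame hf₃ rfl
    simp only [Test.eval, Expr.eval, Expr.eval_zero, hv₃] at hc
    simp only [runs_seq]
    refine (blockingFlow_runs hN₃ (by rw [hu₃]; exact u.2) (by rwa [hu₃, hv₃])
      (by rw [hu₃]; exact hbfs.root) (by rwa [hu₃, hv₃])).mono ?_
    rintro s₄ t₄ ⟨hf₄, hflow₄, ⟨dead, hdu, hdv, hdead⟩, hback, hprog, ht₄⟩
    rw [hu₃] at hdu
    rw [hv₃] at hdv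
    rw [hu₃, hv₃] at hflow₄
    have hN₄ := hN₃.frame hf₄ rfl
    have hu₄ : s₄.reg .u = u := (hf₄.reg .u rfl).trans hu₃
    -- Without an augmentation the capacities would be unchanged and already blocked, so `v` would
    -- not have been reached by the search.
    have hlt : s₃.reg .flow < s₄.reg .flow := by
      rcases hprog with h | ⟨-, h⟩
      · exact h
      · have := hbfs.not_blocked hdu hdv
          (fun a ha h₁ h₂ h₃ => hdead a ha h₁ (by rwa [h a ha]) h₃) v.2
        omega
    refine (search_runs N hN₄ (.inl rfl) (.inl rfl) (κ := s₄.arr .res) (by rw [hu₄]; exact u.2)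
      (by simp [Prog.forward]) (fun s' _ h => by simp [h])).mono ?_
    rintro s₅ t₅ ⟨hf₅, hbfs₅, ht₅⟩
    rw [hu₄] at hbfs₅
    have hres₅ : s₅.arr .res = s₄.arr .res := hf₅.arr .res rfl
    have hfl₅ : s₅.reg .flow = s₄.reg .flow := hf₅.reg .flow rfl
    rw [← hres₅] at hbfs₅ hflow₄
    rw [← hfl₅] at hflow₄ hlt
    obtain ⟨L, hL, hj⟩ := hj.resolve_left (by omega)
    have hj₁ : 1 ≤ j := by
      rcases hj with ⟨-, hj⟩ | hj
      · omega
      · have := hj _ hflow₄.isUnitFlow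
        rw [hflow₄.flowValue_eq] at this
        omega
    refine ⟨_, ⟨hflow₄, hbfs₅, j - 1, rfl, ?_⟩, ?_⟩
    · rcases Nat.eq_zero_or_pos (s₅.arr .level v) with h | h
      · exact .inl h
      · have hinc := hbfs.lt_of_blocked hbfs₅ hdu hdv (fun a ha h => hback a ha (by rwa [← hres₅]))
          (fun a ha h₁ h₂ h₃ => hdead a ha h₁ (by rwa [← hres₅]) h₃) v.2 h
        obtain ⟨L', hL'⟩ : ∃ L, s₅.arr .level v = L + 1 := ⟨s₅.arr .level v - 1, by omega⟩
        refine .inr ⟨L', hL', ?_⟩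
        rcases hj with ⟨h₁, h₂⟩ | hj
        · by_cases hLD : L' ≤ D
          · exact .inl ⟨hLD, by omega⟩
          · refine .inr fun g hg => ?_
            have := hbfs₅.remaining_le hflow₄ hL' hg hD (by omega)
            omega
        · refine .inr fun g hg => ?_
          have := hj g hg
          omega
    · obtain ⟨i, rfl⟩ : ∃ i, j = i + 1 := ⟨j - 1, by omega⟩
      simp
      rw [Nat.mul_succ]
      omega
  · rintro s₃ t₃ ⟨hf₃, hc, φ', ⟨hflow, hbfs, -⟩, ht₃⟩
    have hv₃ : s₃.reg .v = v := (hf₃.reg .v rfl).trans hv₂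
    simp only [Test.eval, Expr.eval, Expr.eval_zero, hv₃] at hc
    refine ⟨⟨N, hN₂.frame hf₃ rfl, hflow, hbfs, by omega⟩, ?_⟩
    simp at ht₃ ⊢
    nlinarith

/-- The loop does not stop at a hit, so the register ends with some index satisfying `p`, or with
its old value. In `bridge` the old values `u`, `v` and `n` signal failure. -/
theorem find_runs {s : State} {r : Reg} {c : Test} {p : ℕ → Prop} {n : ℕ} (hn : s.reg .n = n)
    (hr : r ≠ .i ∧ r ≠ .n) (hcost : c.cost ≤ 30)
    (hc : ∀ s', Frame (Prog.upTo .i (.reg .n) (.when c (.set r (.reg .i)))) s s' →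
      (c.eval s' ↔ p (s'.reg .i))) :
    Runs (Prog.upTo .i (.reg .n) (.when c (.set r (.reg .i)))) s (fun s' t =>
      Frame (Prog.upTo .i (.reg .n) (.when c (.set r (.reg .i)))) s s' ∧
      ((s'.reg r = s.reg r ∧ ∀ x < n, ¬ p x) ∨ (s'.reg r < n ∧ p (s'.reg r))) ∧
      t ≤ 60 * n + 6) := by
  refine (Runs.upTo (fun i s' => (s'.reg r = s.reg r ∧ ∀ x < i, ¬ p x) ∨
    (s'.reg r < n ∧ p (s'.reg r))) 40 (by simp [Prog.modR, Prog.when, hr.1.symm])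
    (by simp [Prog.modR, Prog.when, hr.2.symm]) (by simp) (.inl ⟨by simp [hr.1], by simp⟩) ?_).mono ?_
  · intro i s' hi hf hri hI
    rw [hn] at hi
    simp only [runs_when, runs_set, hc s' hf, hri]
    refine ⟨fun hp => ⟨by simp; omega, .inr ?_⟩, fun hp => ⟨by omega, ?_⟩⟩
    · simpa [hr.1, hri] using ⟨hi, hp⟩
    · rcases hI with ⟨h₁, h₂⟩ | h
      · refine .inl ⟨by simpa [hr.1] using h₁, fun x hx => ?_⟩
        rcases Nat.lt_succ_iff_lt_or_eq.1 hx with hx | rfl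
        · exact h₂ x hx
        · exact hp
      · exact .inr (by simpa [hr.1] using h)
  · rintro s' t ⟨hf, hI, ht⟩
    rw [hn] at hI ht
    exact ⟨hf, hI, by omega⟩

/-- Maximality separates `S` from `v` and `T` from `u`. So a node of `S` other than `u` can be
joined to `v`, and failing that, `u` to a node of `T` other than `v`: in both cases the ends differ
and the pair is not `{u, v}`. -/
theorem bridge_runs {n m : ℕ} {G : SimpleGraph (Fin n)} {u v : Fin n} (huv : u ≠ v)
    {s : State} (hu : s.reg .u = u) (hv : s.reg .v = v) (hE : HasEdges s (natEdges G))
    {N : Network n m (natEdges G)} (hN : N.Holds s)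
    (hvS : v ∉ sourceSide G (N.toFlow (s.arr .res)) u) :
    Runs Prog.bridge s (fun s' t => Frame Prog.bridge s s' ∧
      (∃ G'' : SimpleGraph (Fin n), HasEdges s' (natEdges G'') ∧
        ((sourceSide G (N.toFlow (s.arr .res)) u = {u} ∧
            sinkSide G (N.toFlow (s.arr .res)) v = {v} →
          (∃ w, w ≠ u ∧ w ≠ v ∧ G'' = G ⊔ SimpleGraph.edge u w ⊔ SimpleGraph.edge w v) ∨
          ((∀ w, w = u ∨ w = v) ∧ G'' = G)) ∧
        (¬ (sourceSide G (N.toFlow (s.arr .res)) u = {u} ∧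
            sinkSide G (N.toFlow (s.arr .res)) v = {v}) →
          ∃ u' ∈ sourceSide G (N.toFlow (s.arr .res)) u,
          ∃ v' ∈ sinkSide G (N.toFlow (s.arr .res)) v,
            u' ≠ v' ∧ s(u', v') ≠ s(u, v) ∧ G'' = G ⊔ SimpleGraph.edge u' v'))) ∧
      t ≤ 1000 * (n + m) + 1000) := by
  apply Runs.frame
  simp only [Prog.bridge, Prog.block, runs_seq]
  refine (search_runs N hN (.inl rfl) (.inr (.inl rfl)) (κ := s.arr .res) (by rw [hu]; exact u.2)
    (by simp [Prog.forward]) (fun s' _ h => by simp [h])).mono ?_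
  rintro s₁ t₁ ⟨hf₁, hS, ht₁⟩
  rw [hu] at hS
  have hu₁ : s₁.reg .u = u := (hf₁.reg .u rfl).trans hu
  have hv₁ : s₁.reg .v = v := (hf₁.reg .v rfl).trans hv
  have hres₁ : s₁.arr .res = s.arr .res := hf₁.arr .res rfl
  have hN₁ := hN.frame hf₁ rfl
  refine (search_runs N hN₁ (.inr rfl) (.inr (.inr rfl)) (κ := fun a => s.arr .res (N.rev a))
    (by rw [hv₁]; exact v.2) (by simp [Prog.backward])
    (fun s' h h' => by simp [h', h.rev_eq, hres₁])).mono ?_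
  rintro s₂ t₂ ⟨hf₂, hT, ht₂⟩
  rw [hv₁] at hT
  have hu₂ : s₂.reg .u = u := (hf₂.reg .u rfl).trans hu₁
  have hv₂ : s₂.reg .v = v := (hf₂.reg .v rfl).trans hv₁
  have hN₂ := hN₁.frame hf₂ rfl
  have hS₂ : s₂.arr .inS = s₁.arr .inS := hf₂.arr .inS rfl
  have hE₂ : HasEdges s₂ (natEdges G) := by
    rw [HasEdges, hf₂.reg .m rfl, hf₂.arr .src rfl, hf₂.arr .dst rfl, hf₁.reg .m rfl,
      hf₁.arr .src rfl, hf₁.arr .dst rfl]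
    exact hE
  have hmemS := fun w => hS.mem_sourceSide w
  have hmemT := fun w => hT.mem_sinkSide w
  have hvS' : ¬ 0 < s₁.arr .inS v := fun h => hvS ((hmemS v).2 h)
  -- `u ∈ T` and `v ∈ S` unfold to the same statement, a residual path from `u` to `v`.
  have huT' : ¬ 0 < s₂.arr .inT u := fun h => hvS ((hmemT u).2 h)
  have huS : u ∈ sourceSide G (N.toFlow (s.arr .res)) u := Relation.ReflTransGen.refl
  have hvT : v ∈ sinkSide G (N.toFlow (s.arr .res)) v := Relation.ReflTransGen.refl
  generalize sourceSide G (N.toFlow (s.arr .res)) u = S at *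
  generalize sinkSide G (N.toFlow (s.arr .res)) v = T at *
  simp only [runs_set]
  refine (find_runs (n := n) (p := fun x => 0 < s₁.arr .inS x ∧ x ≠ u) (by simpa using hN₂.n_eq) (by simp)
    (by simp) ?_).mono ?_
  · intro s' hf
    have h₁ : s'.arr .inS = s₁.arr .inS := by rw [hf.arr .inS rfl]; simpa using hS₂
    have h₂ : s'.reg .u = u := by rw [hf.reg .u rfl]; simpa using hu₂
    simp [h₁, h₂]
  rintro s₃ t₃ ⟨hf₃, hp, ht₃⟩
  have hu₃ : s₃.reg .u = u := by rw [hf₃.reg .u rfl]; simpa using hu₂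
  have hv₃ : s₃.reg .v = v := by rw [hf₃.reg .v rfl]; simpa using hv₂
  have hq₃ : s₃.reg .q = v := by rw [hf₃.reg .q rfl]; simpa using hv₂
  have hn₃ : s₃.reg .n = n := by rw [hf₃.reg .n rfl]; simpa using hN₂.n_eq
  have hm₃ : s₃.reg .m = m := by rw [hf₃.reg .m rfl]; simpa using hN₂.m_eq
  have hT₃ : s₃.arr .inT = s₂.arr .inT := by rw [hf₃.arr .inT rfl]; simp
  have hE₃ : HasEdges s₃ (natEdges G) := by
    rw [HasEdges, hf₃.reg .m rfl, hf₃.arr .src rfl, hf₃.arr .dst rfl]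
    simpa [HasEdges] using hE₂
  -- The rest of the program is shared by the two outcomes of the conditional search in `T`; the
  -- steps spent so far are carried along in the postcondition.
  have key : ∀ (s₄ : State) (t₄ : ℕ), s₄.reg .u = u → s₄.reg .v = v → s₄.reg .n = n → s₄.reg .m = m →
      HasEdges s₄ (natEdges G) → t₄ ≤ 70 * n + 50 →
      ((s₄.reg .p = u ∧ s₄.reg .q = v ∧ S = {u} ∧ T = {v}) ∨
        (∃ u' v' : Fin n, s₄.reg .p = u' ∧ s₄.reg .q = v' ∧ u' ∈ S ∧ v' ∈ T ∧ u' ≠ v' ∧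
          s(u', v') ≠ s(u, v))) →
      Runs (Prog.ite (.and (.eq (.reg .p) (.reg .u)) (.eq (.reg .q) (.reg .v)))
        (Prog.block [.set .j (.reg .n),
          .upTo .i (.reg .n) (.when (.and (.not (.eq (.reg .i) (.reg .u)))
            (.not (.eq (.reg .i) (.reg .v)))) (.set .j (.reg .i))),
          .when (.lt (.reg .j) (.reg .n)) (Prog.block [.set .q (.reg .j), Prog.addEdge,
            .set .p (.reg .j), .set .q (.reg .v), Prog.addEdge])]) Prog.addEdge) s₄
      (fun s' t => (∃ G'' : SimpleGraph (Fin n), HasEdges s' (natEdges G'') ∧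
        ((S = {u} ∧ T = {v} →
          (∃ w, w ≠ u ∧ w ≠ v ∧ G'' = G ⊔ SimpleGraph.edge u w ⊔ SimpleGraph.edge w v) ∨
          ((∀ w, w = u ∨ w = v) ∧ G'' = G)) ∧
        (¬ (S = {u} ∧ T = {v}) → ∃ u' ∈ S, ∃ v' ∈ T,
            u' ≠ v' ∧ s(u', v') ≠ s(u, v) ∧ G'' = G ⊔ SimpleGraph.edge u' v'))) ∧
      t₁ + (t₂ + (2 + (2 + (t₃ + (t₄ + t))))) ≤ 1000 * (n + m) + 1000) := by
    intro s₄ t₄ hu₄ hv₄ hn₄ hm₄ hE₄ ht₄ hpq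
    rw [runs_ite]
    simp only [Test.eval, Expr.eval]
    rcases hpq with ⟨hp₄, hq₄, hST⟩ | ⟨u', v', hp₄, hq₄, hu', hv', hne, hne'⟩
    · refine ⟨fun _ => ?_, fun h => absurd ⟨hp₄.trans hu₄.symm, hq₄.trans hv₄.symm⟩ h⟩
      simp only [Prog.block, runs_seq, runs_set]
      refine (find_runs (n := n) (p := fun x => x ≠ u ∧ x ≠ v) (by simpa using hn₄) (by simp)
        (by simp) ?_).mono ?_
      · intro s' hf
        have h₁ : s'.reg .u = u := by rw [hf.reg .u rfl]; simpa using hu₄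
        have h₂ : s'.reg .v = v := by rw [hf.reg .v rfl]; simpa using hv₄
        simp [h₁, h₂]
      rintro s₅ t₅ ⟨hf₅, hj, ht₅⟩
      have hn₅ : s₅.reg .n = n := by rw [hf₅.reg .n rfl]; simpa using hn₄
      have hm₅ : s₅.reg .m = m := by rw [hf₅.reg .m rfl]; simpa using hm₄
      have hp₅ : s₅.reg .p = u := by rw [hf₅.reg .p rfl]; simpa using hp₄
      have hv₅ : s₅.reg .v = v := by rw [hf₅.reg .v rfl]; simpa using hv₄
      have hE₅ : HasEdges s₅ (natEdges G) := by
        rw [HasEdges, hf₅.reg .m rfl, hf₅.arr .src rfl, hf₅.arr .dst rfl]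
        simpa [HasEdges] using hE₄
      simp only [runs_when, Test.eval, Expr.eval, hn₅]
      refine ⟨fun hlt => ?_, fun hlt => ?_⟩
      · obtain ⟨hw, hwu, hwv⟩ : s₅.reg .j < n ∧ s₅.reg .j ≠ u ∧ s₅.reg .j ≠ v := by
          rcases hj with ⟨hj, -⟩ | hj
          · simp [hn₄] at hj; omega
          · exact hj
        obtain ⟨w, hwj⟩ : ∃ w : Fin n, s₅.reg .j = w := ⟨⟨_, hw⟩, rfl⟩
        rw [hwj] at hwu hwv
        have hwu' : w ≠ u := fun h => hwu (by rw [h])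
        have hwv' : w ≠ v := fun h => hwv (by rw [h])
        simp only [runs_seq, runs_set]
        refine (addEdge_runs (E := natEdges G) (by simpa [HasEdges] using hE₅)).mono ?_
        rintro s₆ t₆ ⟨hf₆, hE₆, hm₆, ht₆⟩
        have hj₆ : s₆.reg .j = w := by rw [hf₆.reg .j rfl]; simpa using hwj
        have hv₆ : s₆.reg .v = v := by rw [hf₆.reg .v rfl]; simpa using hv₅
        simp [hp₅, hwj] at hE₆
        simp [hm₅] at hm₆ ht₆
        rw [← natEdges_sup_edge G hwu'.symm] at hE₆
        refine (addEdge_runs (by simpa [HasEdges] using hE₆)).mono ?_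
        rintro s₇ t₇ ⟨hf₇, hE₇, hm₇, ht₇⟩
        simp [hj₆, hv₆] at hE₇
        rw [← natEdges_sup_edge _ hwv'] at hE₇
        refine ⟨⟨_, hE₇, fun _ => .inl ⟨w, hwu', hwv', rfl⟩, fun h => absurd hST h⟩, ?_⟩
        simp at ht₇ ht₅ ⊢
        omega
      · refine ⟨⟨G, hE₅, fun _ => .inr ⟨fun w => ?_, rfl⟩, fun h => absurd hST h⟩, ?_⟩
        · rcases hj with ⟨-, hj⟩ | hj
          · have := hj w w.2
            by_contra! hw
            exact this ⟨fun h => hw.1 (Fin.ext h), fun h => hw.2 (Fin.ext h)⟩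
          · omega
        · simp at ht₅ ⊢
          omega
    · refine ⟨fun h => absurd ?_ hne', fun _ => ?_⟩
      · rw [Fin.ext (hp₄.symm.trans (h.1.trans hu₄)), Fin.ext (hq₄.symm.trans (h.2.trans hv₄))]
      · refine (addEdge_runs hE₄).mono ?_
        rintro s₅ t₅ ⟨hf₅, hE₅, hm₅, ht₅⟩
        rw [hp₄, hq₄, ← natEdges_sup_edge _ hne] at hE₅
        refine ⟨⟨_, hE₅, fun ⟨hS', hT'⟩ => ?_, fun _ => ⟨u', hu', v', hv', hne, hne', rfl⟩⟩, ?_⟩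
        · rw [hS'] at hu'
          rw [hT'] at hv'
          exact absurd (by rw [Set.mem_singleton_iff.1 hu', Set.mem_singleton_iff.1 hv']) hne'
        · simp
          omega
  simp only [runs_when, Test.eval, Expr.eval, hu₃]
  constructor
  · intro hpu
    refine (find_runs (p := fun x => 0 < s₂.arr .inT x ∧ x ≠ v) hn₃ (by simp) (by simp) ?_).mono ?_
    · intro s' hf
      have h₁ : s'.arr .inT = s₂.arr .inT := by rw [hf.arr .inT rfl]; exact hT₃
      have h₂ : s'.reg .v = v := by rw [hf.reg .v rfl]; exact hv₃
      simp [h₁, h₂]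
    rintro s₄ t₄ ⟨hf₄, hq, ht₄⟩
    refine key s₄ _ ((hf₄.reg .u rfl).trans hu₃) ((hf₄.reg .v rfl).trans hv₃)
      ((hf₄.reg .n rfl).trans hn₃) ((hf₄.reg .m rfl).trans hm₃) ?_ ?_ ?_
    · rw [HasEdges, hf₄.reg .m rfl, hf₄.arr .src rfl, hf₄.arr .dst rfl]
      exact hE₃
    · simp
      omega
    · have hp₄ : s₄.reg .p = u := (hf₄.reg .p rfl).trans hpu
      have hSu : S = {u} := by
        ext w
        rw [Set.mem_singleton_iff]
        refine ⟨fun hw => ?_, fun h => h ▸ huS⟩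
        rcases hp with ⟨-, hp⟩ | hp
        · by_contra hne
          exact hp w w.2 ⟨(hmemS w).1 hw, fun h => hne (Fin.ext h)⟩
        · exact absurd hpu hp.2.2
      rcases hq with ⟨hqv, hq⟩ | ⟨hlt, hq, hqv⟩
      · refine .inl ⟨hp₄, hqv.trans hq₃, hSu, ?_⟩
        ext w
        rw [Set.mem_singleton_iff]
        refine ⟨fun hw => ?_, fun h => h ▸ hvT⟩
        by_contra hne
        exact hq w w.2 ⟨(hmemT w).1 hw, fun h => hne (Fin.ext h)⟩
      · obtain ⟨w, hw⟩ : ∃ w : Fin n, s₄.reg .q = w := ⟨⟨_, hlt⟩, rfl⟩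
        rw [hw] at hq hqv
        have hwv : w ≠ v := fun h => hqv (by rw [h])
        have hwu : u ≠ w := fun h => huT' (by rwa [h])
        refine .inr ⟨u, w, hp₄, hw, huS, (hmemT w).2 hq, hwu, fun h => ?_⟩
        rcases Sym2.eq_iff.1 h with ⟨-, h⟩ | ⟨h, -⟩
        · exact hwv h
        · exact huv h
  · intro hpu
    refine key s₃ _ hu₃ hv₃ hn₃ hm₃ hE₃ (by simp) (.inr ?_)
    rcases hp with ⟨hp, -⟩ | ⟨hlt, hp, -⟩
    · exact absurd (hp.trans (by simpa using hu₂)) hpu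
    · obtain ⟨w, hw⟩ : ∃ w : Fin n, s₃.reg .p = w :=
        ⟨⟨_, hlt⟩, rfl⟩
      rw [hw] at hp hpu
      have hwu : w ≠ u := fun h => hpu (by rw [h])
      have hwv : w ≠ v := fun h => hvS' (by rwa [← h])
      refine ⟨w, v, hw, hq₃, (hmemS w).2 hp, hvT, hwv, fun h => ?_⟩
      rcases Sym2.eq_iff.1 h with ⟨h, -⟩ | ⟨h, -⟩
      · exact hwu h
      · exact hwv h

theorem handleDeletion_runs {n : ℕ} {G : SimpleGraph (Fin n)} {u v : Fin n} (huv : u ≠ v) {k : ℕ}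
    {s : State} (hs : EncodesDeletion s G k u v) {D : ℕ}
    (hD : G.edgeSet.ncard < (D + 1) ^ 2 ∨ n ^ 2 < (D + 1) ^ 3) :
    Runs Prog.handleDeletion s (fun s' t =>
      t ≤ 8000 * ((D + 1) * (n + G.edgeSet.ncard + 1)) ∧
      ∃ (G'' : SimpleGraph (Fin n)) (f : Fin n → Fin n → ℤ),
        IsMaxUnitFlow (G.deleteEdges {s(u, v)}) u v f ∧ (s'.reg .flow : ℤ) = flowValue u f ∧
        IsRestoration G u v k f G'' ∧ Encodes s' G'') := by
  obtain ⟨hn, hE⟩ := encodes_iff.1 hs.graph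
  have hm := hs.graph.numEdges
  simp only [Prog.handleDeletion, Prog.block, runs_seq]
  refine (removeEdge_runs hE).mono ?_
  rintro s₁ t₁ ⟨hf₁, hE₁, hm₁, ht₁⟩
  rw [hs.fst, hs.snd, ← natEdges_deleteEdges] at hE₁
  rw [hm] at hm₁ ht₁
  have hu₁ : s₁.reg .u = u := (hf₁.reg .u rfl).trans hs.fst
  have hv₁ : s₁.reg .v = v := (hf₁.reg .v rfl).trans hs.snd
  have hn₁ : s₁.reg .n = n := (hf₁.reg .n rfl).trans hn
  have hk₁ : s₁.reg .k = k := (hf₁.reg .k rfl).trans hs.param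
  refine (dinicMaxFlow_runs huv hn₁ hu₁ hv₁ hE₁ (D := D)
    (hD.imp_left fun h => by omega)).mono ?_
  rintro s₂ t₂ ⟨hf₂, ⟨N, hN, hflow, hbfs, hlv⟩, ht₂⟩
  have hu₂ : s₂.reg .u = u := (hf₂.reg .u rfl).trans hu₁
  have hv₂ : s₂.reg .v = v := (hf₂.reg .v rfl).trans hv₁
  have hk₂ : s₂.reg .k = k := (hf₂.reg .k rfl).trans hk₁
  have hE₂ : HasEdges s₂ (natEdges (G.deleteEdges {s(u, v)})) := by
    rw [HasEdges, hf₂.reg .m rfl, hf₂.arr .src rfl, hf₂.arr .dst rfl]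
    exact hE₁
  have hmax := hbfs.isMax hflow hlv
  have hval := hflow.flowValue_eq
  have ht : t₂ ≤ 5000 * ((D + 1) * (n + G.edgeSet.ncard + 1)) :=
    ht₂.trans (Nat.mul_le_mul_left _ (Nat.mul_le_mul_left _ (by omega)))
  have hbase : n + G.edgeSet.ncard + 1 ≤ (D + 1) * (n + G.edgeSet.ncard + 1) :=
    Nat.le_mul_of_pos_left _ (by omega)
  simp only [runs_when, Test.eval, Expr.eval, Expr.eval_add', Expr.eval_one, hk₂]
  constructor
  · intro hfk
    refine (bridge_runs huv hu₂ hv₂ hE₂ hN ?_).mono ?_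
    · rw [hbfs.mem_sourceSide]
      omega
    rintro s₃ t₃ ⟨hf₃, ⟨G'', hE₃, hr₁, hr₂⟩, ht₃⟩
    refine ⟨by simp; omega, G'', _, hmax, ?_, ⟨fun h => ?_, fun _ => ⟨hr₁, hr₂⟩⟩, ?_⟩
    · rw [hval, hf₃.reg .flow rfl]
    · rw [hval] at h
      exact absurd (by exact_mod_cast hfk) h
    · exact encodes_iff.2 ⟨((hf₃.reg .n rfl).trans hN.n_eq), hE₃⟩
  · intro hfk
    refine ⟨by simp; omega, _, _, hmax, hval.symm, ⟨fun _ => rfl, fun h => ?_⟩,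
      encodes_iff.2 ⟨hN.n_eq, hE₂⟩⟩
    rw [hval] at h
    exact absurd (by exact_mod_cast h) hfk

/-! ## Forest decompositions -/

section Sparsification

variable {n m : ℕ} {E : Set (Sym2 ℕ)}

/-- The number of the edge that the arc `a` belongs to. -/
def edgeId (m a : ℕ) : ℕ := if a < m then a else a - m

theorem edgeId_lt {m a : ℕ} (ha : a < m + m) : edgeId m a < m := by
  rw [edgeId]; split_ifs <;> omega

theorem edgeId_of_lt {m a : ℕ} (ha : a < m) : edgeId m a = a := if_pos ha

theorem Network.edgeId_rev (N : Network n m E) (hrev : ∀ a < m, N.rev a = a + m) {a : ℕ}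
    (ha : a < m + m) : edgeId m (N.rev a) = edgeId m a := by
  rcases arc_cases ha with h | ⟨b, hb, rfl⟩
  · rw [hrev a h, edgeId, edgeId, if_pos h, if_neg (by omega)]; omega
  · rw [← hrev b hb, N.rev_rev b (by omega), hrev b hb, edgeId, edgeId, if_pos hb,
      if_neg (by omega)]; omega

/-- The arc joins a node in `X` and a node outside `X`. -/
def Network.Cross (N : Network n m E) (X : ℕ → Prop) (a : ℕ) : Prop :=
  ¬ (X (N.tail a) ↔ X (N.tgt a))

theorem Network.cross_edgeId (N : Network n m E) (hrev : ∀ a < m, N.rev a = a + m) {a : ℕ}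
    (ha : a < m + m) (X : ℕ → Prop) : N.Cross X (edgeId m a) ↔ N.Cross X a := by
  rcases arc_cases ha with h | ⟨b, hb, rfl⟩
  · rw [edgeId_of_lt h]
  · have : edgeId m (b + m) = b := by rw [edgeId, if_neg (by omega)]; omega
    rw [this, ← hrev b hb, Network.Cross, Network.Cross, N.tail_rev (by omega), Network.tail]
    exact not_congr iff_comm

/-- The number of used edges at a node. -/
def Network.usedDeg (N : Network n m E) (used : ℕ → ℕ) (y : ℕ) : ℕ :=
  ((Finset.range (m + m)).filter fun a => N.tail a = y ∧ used (edgeId m a) ≠ 0).card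

/-- The other ends of the edges at `y` are distinct and differ from `y`. Through `deg` this keeps
all ranks below `n`, so that `n` buckets suffice. -/
theorem Network.usedDeg_lt (N : Network n m E) (used : ℕ → ℕ) {y : ℕ} (hy : y < n) :
    N.usedDeg used y < n := by
  have h : N.usedDeg used y ≤ ((Finset.range n).erase y).card := by
    refine Finset.card_le_card_of_injOn N.tgt ?_ ?_
    · intro a ha
      simp only [Finset.coe_filter, Finset.mem_range, Set.mem_setOf_eq] at ha
      have := N.loopless a ha.1
      rw [← Network.tail, ha.2.1] at this
      simpa [N.tgt_lt a ha.1] using this.symm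
    · intro a ha b hb hab
      simp only [Finset.coe_filter, Finset.mem_range, Set.mem_setOf_eq] at ha hb
      exact N.simple a ha.1 b hb.1 (ha.2.1.trans hb.2.1.symm) hab
  rw [Finset.card_erase_of_mem (Finset.mem_range.2 hy), Finset.card_range] at h
  omega

/-- The invariant of the Nagamochi–Ibaraki algorithm: the used edge `b` belongs to the forest number
`forest b`, and the nodes of rank at least `j` that are still active lie in one component of the
forest number `j`. -/
structure ForestInv (N : Network n m E) (k : ℕ) (rank used keep : ℕ → ℕ) (active : ℕ → Prop)
    (forest : ℕ → ℕ) : Prop where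
  cut : ∀ X : ℕ → Prop, ∀ j, 1 ≤ j → (∃ b < m, used b ≠ 0 ∧ N.Cross X b ∧ forest b = j) ∨
    ∀ y < n, ∀ z < n, active y → active z → j ≤ rank y → j ≤ rank z → (X y ↔ X z)
  lower : ∀ X : ℕ → Prop, ∀ b < m, used b ≠ 0 → N.Cross X b → ∀ j, 1 ≤ j → j < forest b →
    ∃ b' < m, used b' ≠ 0 ∧ N.Cross X b' ∧ forest b' = j
  keep_le : ∀ b < m, keep b ≤ 1
  keep_iff : ∀ b < m, keep b ≠ 0 ↔ used b ≠ 0 ∧ forest b ≤ k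
  count : ∑ b ∈ Finset.range m, keep b ≤ ∑ y ∈ Finset.range n, min (rank y) k
  deg : ∀ y < n, rank y ≤ N.usedDeg used y
  closed : ∀ a < m + m, ¬ active (N.tail a) → used (edgeId m a) ≠ 0

namespace ForestInv

variable {N : Network n m E} {k : ℕ} {rank used keep : ℕ → ℕ} {active : ℕ → Prop}
  {forest : ℕ → ℕ}

theorem rank_lt (h : ForestInv N k rank used keep active forest) {y : ℕ} (hy : y < n) :
    rank y < n :=
  (h.deg y hy).trans_lt (N.usedDeg_lt used hy)

theorem init {rank used keep : ℕ → ℕ} (hr : ∀ y < n, rank y = 0) (hu : ∀ b < m, used b = 0)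
    (hk : ∀ b < m, keep b = 0) (ha : ∀ y < n, active y) :
    ForestInv N k rank used keep active fun _ => 0 where
  cut X j hj := .inr fun y hy z _ _ _ hjy => by rw [hr y hy] at hjy; omega
  lower X b hb hub := absurd (hu b hb) hub
  keep_le b hb := by rw [hk b hb]; omega
  keep_iff b hb := by simp [hk b hb, hu b hb]
  count := by
    rw [Finset.sum_eq_zero fun b hb => hk b (Finset.mem_range.1 hb)]
    exact Nat.zero_le _
  deg y hy := by rw [hr y hy]; exact Nat.zero_le _
  closed a ha' hn := absurd (ha _ (N.tail_lt ha')) hn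

/-- Fewer active nodes make `cut` weaker; only `closed` needs that all edges at `x` have been used.
-/
theorem finishNode (h : ForestInv N k rank used keep active forest) {active' : ℕ → Prop} {x : ℕ}
    (ha : ∀ z, active' z → active z) (ha' : ∀ z, active z → z ≠ x → active' z)
    (hx : ∀ a < m + m, N.tail a = x → used (edgeId m a) ≠ 0) :
    ForestInv N k rank used keep active' forest where
  cut X j hj := (h.cut X j hj).imp_right fun h' y hy z hz hay haz =>
    h' y hy z hz (ha y hay) (ha z haz)
  lower := h.lower
  keep_le := h.keep_le
  keep_iff := h.keep_iff
  count := h.count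
  deg := h.deg
  closed a halt hn := by
    by_cases hax : N.tail a = x
    · exact hx a halt hax
    · exact h.closed a halt fun hact => hn (ha' _ hact hax)

theorem usedDeg_le {b y : ℕ} (used : ℕ → ℕ) :
    N.usedDeg used y ≤ N.usedDeg (Function.update used b 1) y := by
  refine Finset.card_le_card fun a ha => ?_
  simp only [Finset.mem_filter] at ha ⊢
  refine ⟨ha.1, ha.2.1, ?_⟩
  by_cases hab : edgeId m a = b
  · simp [hab]
  · simpa [hab] using ha.2.2

theorem usedDeg_lt_update {a : ℕ} (ha : a < m + m) (hu : used (edgeId m a) = 0) :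
    N.usedDeg used (N.tail a) < N.usedDeg (Function.update used (edgeId m a) 1) (N.tail a) := by
  refine Finset.card_lt_card ⟨fun c hc => ?_, fun hsub => ?_⟩
  · simp only [Finset.mem_filter] at hc ⊢
    refine ⟨hc.1, hc.2.1, ?_⟩
    by_cases hab : edgeId m c = edgeId m a
    · simp [hab]
    · simpa [hab] using hc.2.2
  · have := @hsub a (by simp [ha])
    simp [hu] at this

/-- Let `y` be the other end; its rank is at most that of `x`. For `j ≤ rank y` both ends have rank
at least `j`, so if the edge crosses a cut, forest `j` crossed it before: this is `lower`. For `j =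
rank y + 1` the edge itself crosses, or `x` and `y` are on the same side. In the latter case an
active node of rank at least `j` forces `rank x ≥ j` by maximality and lies on the side of `x` by
the old invariant, so `y` may join. For other `j` no node newly reaches rank `j`. -/
theorem scanEdge (h : ForestInv N k rank used keep active forest)
    (hrev : ∀ a < m, N.rev a = a + m) {a x : ℕ} (ha : a < m + m) (hx : N.tail a = x)
    (hact : active x) (hmax : ∀ z < n, active z → rank z ≤ rank x)
    (hb : used (edgeId m a) = 0) {rank' : ℕ → ℕ} (hy' : rank' (N.tgt a) = rank (N.tgt a) + 1)
    (hx' : rank' x = if rank x = rank (N.tgt a) then rank x + 1 else rank x)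
    (hz' : ∀ z, z ≠ x → z ≠ N.tgt a → rank' z = rank z) :
    active (N.tgt a) ∧ (∀ z < n, active z → rank' z ≤ rank' x) ∧
    ForestInv N k rank' (Function.update used (edgeId m a) 1)
      (Function.update keep (edgeId m a)
        (if rank (N.tgt a) < k then 1 else keep (edgeId m a))) active
      (Function.update forest (edgeId m a) (rank (N.tgt a) + 1)) := by
  have hxn : x < n := hx ▸ N.tail_lt ha
  have hyn : N.tgt a < n := N.tgt_lt a ha
  have hbm := edgeId_lt ha
  -- All edges at an inactive node have been used, but this one has not.
  have hacty : active (N.tgt a) := by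
    by_contra hn
    rw [← N.tail_rev ha] at hn
    have := h.closed _ (N.rev_lt a ha) hn
    rw [N.edgeId_rev hrev ha] at this
    exact this hb
  have hyx : rank (N.tgt a) ≤ rank x := hmax _ hyn hacty
  have hcross : ∀ X : ℕ → Prop, N.Cross X (edgeId m a) ↔ ¬ (X x ↔ X (N.tgt a)) := fun X => by
    rw [N.cross_edgeId hrev ha, Network.Cross, hx]
  have hrx : rank x ≤ rank' x := by rw [hx']; split_ifs <;> omega
  have hmono : ∀ z, rank z ≤ rank' z := by
    intro z
    by_cases h₁ : z = x
    · rw [h₁]; exact hrx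
    · by_cases h₂ : z = N.tgt a
      · rw [h₂, hy']; omega
      · rw [hz' z h₁ h₂]
  generalize hbdef : edgeId m a = b at *
  have hold : ∀ b', used b' ≠ 0 → b' ≠ b := by
    rintro b' h' rfl
    exact h' hb
  have hused : ∀ b', used b' ≠ 0 → Function.update used b 1 b' ≠ 0 := fun b' h' => by
    rwa [Function.update_of_ne (hold b' h')]
  have hlift : ∀ (X : ℕ → Prop) (j : ℕ), (∃ b' < m, used b' ≠ 0 ∧ N.Cross X b' ∧ forest b' = j) →
      ∃ b' < m, Function.update used b 1 b' ≠ 0 ∧ N.Cross X b' ∧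
        Function.update forest b (rank (N.tgt a) + 1) b' = j := by
    rintro X j ⟨b', h₁, h₂, h₃, h₄⟩
    exact ⟨b', h₁, hused b' h₂, h₃, by rwa [Function.update_of_ne (hold b' h₂)]⟩
  have hkb : keep b = 0 := by
    by_contra hne
    exact ((h.keep_iff b hbm).1 hne).1 hb
  refine ⟨hacty, fun z hz hza => ?_, fun X j hj => ?_, fun X b' hb' hub' hc j hj hjf => ?_,
    fun b' hb' => ?_, fun b' hb' => ?_, ?_, fun z hz => ?_, fun c hc hn => ?_⟩
  · have := hmax z hz hza
    by_cases h₁ : z = x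
    · rw [h₁]
    · by_cases h₂ : z = N.tgt a
      · rw [h₂, hy', hx']
        split_ifs <;> omega
      · rw [hz' z h₁ h₂]; omega
  · rcases h.cut X j hj with h' | h'
    · exact .inl (hlift X j h')
    · by_cases hjy : j = rank (N.tgt a) + 1
      · by_cases hcr : N.Cross X b
        · exact .inl ⟨b, hbm, by simp, hcr, by simp [hjy]⟩
        · right
          rw [hcross, not_not] at hcr
          have key : ∀ z < n, active z → j ≤ rank' z → (X z ↔ X x) := by
            intro z hz hza hjz
            by_cases h₁ : z = x
            · rw [h₁]
            · by_cases h₂ : z = N.tgt a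
              · rw [h₂]; exact hcr.symm
              · rw [hz' z h₁ h₂] at hjz
                exact h' z hz x hxn hza hact hjz (hjz.trans (hmax z hz hza))
          intro y hy z hz hya hza hjy hjz
          rw [key y hy hya hjy, key z hz hza hjz]
      · right
        have key : ∀ z, j ≤ rank' z → j ≤ rank z := by
          intro z hjz
          by_cases h₂ : z = N.tgt a
          · rw [h₂, hy'] at hjz; rw [h₂]; omega
          · by_cases h₁ : z = x
            · rw [h₁, hx'] at hjz
              rw [h₁]
              split_ifs at hjz <;> omega
            · rwa [hz' z h₁ h₂] at hjz
        exact fun y hy z hz hya hza hjy hjz => h' y hy z hz hya hza (key y hjy) (key z hjz)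
  · by_cases hbb : b' = b
    · subst hbb
      rw [Function.update_self] at hjf
      rcases h.cut X j hj with h' | h'
      · exact hlift X j h'
      · exact absurd (h' x hxn _ hyn hact hacty (by omega) (by omega)) ((hcross X).1 hc)
    · rw [Function.update_of_ne hbb] at hub' hjf
      exact hlift X j (h.lower X b' hb' hub' hc j hj hjf)
  · by_cases hbb : b' = b
    · subst hbb
      rw [Function.update_self]
      split_ifs <;> omega
    · rw [Function.update_of_ne hbb]; exact h.keep_le b' hb'
  · by_cases hbb : b' = b
    · subst hbb
      simp only [Function.update_self]
      split_ifs <;> simp <;> omega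
    · simp only [Function.update_of_ne hbb]; exact h.keep_iff b' hb'
  · have h₁ := h.count
    have hmemb := Finset.mem_range.2 hbm
    have hmemy := Finset.mem_range.2 hyn
    rw [Finset.sum_update_of_mem hmemb]
    rw [← Finset.add_sum_erase _ _ hmemb, ← Finset.add_sum_erase _ _ hmemy, hkb,
      ← Finset.sdiff_singleton_eq_erase] at h₁
    -- A newly kept edge is charged to `y`: it is kept only if `rank y < k`, and then `min (rank y)
    -- k` grows by one as well.
    rw [← Finset.add_sum_erase _ _ hmemy, hy', hkb]
    have h₂ : ∑ z ∈ (Finset.range n).erase (N.tgt a), min (rank z) k ≤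
        ∑ z ∈ (Finset.range n).erase (N.tgt a), min (rank' z) k :=
      Finset.sum_le_sum fun z _ => min_le_min_right k (hmono z)
    split_ifs <;> omega
  · have hle : N.usedDeg used z ≤ N.usedDeg (Function.update used b 1) z := usedDeg_le used
    have hdeg := h.deg z hz
    by_cases h₂ : z = N.tgt a
    · subst h₂
      have := usedDeg_lt_update (N := N) (used := used) (N.rev_lt a ha)
        (by rw [N.edgeId_rev hrev ha, hbdef, hb])
      rw [N.edgeId_rev hrev ha, hbdef, N.tail_rev ha] at this
      omega
    · by_cases h₁ : z = x
      · subst h₁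
        have := usedDeg_lt_update (N := N) (used := used) ha (by rw [hbdef, hb])
        rw [hbdef, hx] at this
        rw [hx']
        split_ifs <;> omega
      · rw [hz' z h₁ h₂]; omega
  · exact hused _ (h.closed c hc hn)

/-- Either all edges of a cut are kept, or edges of `k` different forests. -/
theorem cut_kept (h : ForestInv N k rank used keep active forest) (hu : ∀ b < m, used b ≠ 0)
    (X : ℕ → Prop) : (∀ b < m, N.Cross X b → keep b ≠ 0) ∨
      ∀ j, 1 ≤ j → j ≤ k → ∃ b < m, keep b ≠ 0 ∧ N.Cross X b ∧ forest b = j := by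
  by_cases hall : ∀ b < m, N.Cross X b → keep b ≠ 0
  · exact .inl hall
  · right
    push Not at hall
    obtain ⟨b, hb, hc, hk⟩ := hall
    intro j hj hjk
    -- A crossing edge that is not kept has forest number above `k`, so `lower` supplies crossing
    -- edges in the forests `1, …, k`.
    have hkb : ¬ forest b ≤ k := fun hle => (h.keep_iff b hb).2 ⟨hu b hb, hle⟩ hk
    obtain ⟨b', hb', hu', hc', hf'⟩ := h.lower X b hb (hu b hb) hc j hj (by omega)
    exact ⟨b', hb', (h.keep_iff b' hb').2 ⟨hu', by omega⟩, hc', hf'⟩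

end ForestInv

/-! ### Buckets of nodes by rank, with stale entries left in place. -/

/-- The invariant of the buckets: the list `bl r` consists of entries for nodes of rank at least
`r`, each node that satisfies `need` has an entry for its rank, and all buckets above `top` are
empty. -/
structure BucketInv (n : ℕ) (rank bucket entNode entNext : ℕ → ℕ) (j top : ℕ) (need : ℕ → Prop)
    (bl : ℕ → List ℕ) : Prop where
  chains : Chains n bucket entNext bl
  fresh : ∀ r < n, ∀ e ∈ bl r, e < j
  node : ∀ r < n, ∀ e ∈ bl r, entNode e < n ∧ r ≤ rank (entNode e)
  cover : ∀ y < n, need y → rank y < n ∧ ∃ e ∈ bl (rank y), entNode e = y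
  above : ∀ r < n, top < r → bl r = []
  top_lt : top < n

namespace BucketInv

variable {rank bucket entNode entNext : ℕ → ℕ} {j top : ℕ} {need : ℕ → Prop} {bl : ℕ → List ℕ}

/-- Ranks only grow, so an outdated entry stays legal: its bucket number is still at most the rank
of its node. -/
theorem mono (h : BucketInv n rank bucket entNode entNext j top need bl) {rank' : ℕ → ℕ}
    {need' : ℕ → Prop} (hr : ∀ z, rank z ≤ rank' z)
    (hn : ∀ z, need' z → need z ∧ rank' z = rank z) :
    BucketInv n rank' bucket entNode entNext j top need' bl where
  chains := h.chains
  fresh := h.fresh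
  node r hr' e he := ⟨(h.node r hr' e he).1, (h.node r hr' e he).2.trans (hr _)⟩
  cover y hy hny := by
    rw [(hn y hny).2]
    exact h.cover y hy (hn y hny).1
  above := h.above
  top_lt := h.top_lt

theorem push (h : BucketInv n rank bucket entNode entNext j top need bl) {y top' : ℕ} (hy : y < n)
    (hr : rank y ≤ top') (ht : top ≤ top') (hlt : top' < n) {need' : ℕ → Prop}
    (hn : ∀ z, need' z → z ≠ y → need z) :
    BucketInv n rank (Function.update bucket (rank y) (j + 1)) (Function.update entNode j y)
      (Function.update entNext j (bucket (rank y))) (j + 1) top' need'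
      (Function.update bl (rank y) (j :: bl (rank y))) where
  chains := h.chains.push fun r hr' hj => absurd (h.fresh r hr' j hj) (lt_irrefl j)
  fresh r hr' e he := by
    rcases mem_update_cons.1 he with ⟨rfl, -⟩ | he
    · omega
    · have := h.fresh r hr' e he
      omega
  node r hr' e he := by
    rcases mem_update_cons.1 he with ⟨rfl, rfl⟩ | he
    · simpa using hy
    · have := h.fresh r hr' e he
      rw [Function.update_of_ne (by omega)]
      exact h.node r hr' e he
  cover z hz hnz := by
    by_cases hzy : z = y
    · exact ⟨by rw [hzy]; omega, j, mem_update_cons.2 (.inl ⟨rfl, by rw [hzy]⟩), by simp [hzy]⟩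
    · obtain ⟨hrz, e, he, hez⟩ := h.cover z hz (hn z hnz hzy)
      have := h.fresh _ hrz e he
      exact ⟨hrz, e, mem_update_cons.2 (.inr he), by rwa [Function.update_of_ne (by omega)]⟩
  above r hr' htr := by
    rw [Function.update_of_ne (by omega)]
    exact h.above r hr' (by omega)
  top_lt := hlt

theorem rank_le_top (h : BucketInv n rank bucket entNode entNext j top need bl) {y : ℕ}
    (hy : y < n) (hn : need y) : rank y ≤ top := by
  obtain ⟨hr, e, he, -⟩ := h.cover y hy hn
  by_contra hlt
  rw [h.above _ hr (by omega)] at he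
  simp at he

theorem lower_top (h : BucketInv n rank bucket entNode entNext j (top + 1) need bl)
    (h₀ : bucket (top + 1) = 0) : BucketInv n rank bucket entNode entNext j top need bl where
  chains := h.chains
  fresh := h.fresh
  node := h.node
  cover := h.cover
  above r hr htr := by
    by_cases hrt : r = top + 1
    · have := h.chains r hr
      rw [hrt, h₀] at this
      rw [hrt, this.eq_nil]
    · exact h.above r hr (by omega)
  top_lt := by have := h.top_lt; omega

/-- The popped node has rank at least `top`, and by `rank_le_top` no node that needs an entry has a
larger rank than `top`. This is how a node of largest rank is found. -/
theorem pop (h : BucketInv n rank bucket entNode entNext j top need bl) (h₀ : bucket top ≠ 0) :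
    ∃ e L, bl top = e :: L ∧ bucket top = e + 1 ∧ entNode e < n ∧ top ≤ rank (entNode e) ∧
      ∀ need' : ℕ → Prop, (∀ z, need' z → need z ∧ z ≠ entNode e) →
        BucketInv n rank (Function.update bucket top (entNext e)) entNode entNext j top need'
          (Function.update bl top L) := by
  obtain ⟨e, L, hL, hb, hc⟩ := (h.chains top h.top_lt).eq_cons h₀
  obtain ⟨h₁, h₂⟩ := h.node top h.top_lt e (by simp [hL])
  have hmem : ∀ r, ∀ e' ∈ Function.update bl top L r, e' ∈ bl r := by
    intro r e' he'
    by_cases hr : r = top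
    · subst hr
      rw [Function.update_self] at he'
      rw [hL]
      exact List.mem_cons_of_mem _ he'
    · rwa [Function.update_of_ne hr] at he'
  refine ⟨e, L, hL, hb, h₁, h₂, fun need' hn => ⟨fun r hr => ?_, fun r hr e' he' =>
    h.fresh r hr e' (hmem r e' he'), fun r hr e' he' => h.node r hr e' (hmem r e' he'),
    fun y hy hny => ?_, fun r hr htr => ?_, h.top_lt⟩⟩
  · by_cases hrt : r = top
    · subst hrt
      simpa using hc
    · simpa [hrt] using h.chains r hr
  · obtain ⟨hr, e', he', hey⟩ := h.cover y hy (hn y hny).1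
    refine ⟨hr, e', ?_, hey⟩
    by_cases hrt : rank y = top
    · rw [hrt, hL, List.mem_cons] at he'
      rw [hrt, Function.update_self]
      refine he'.resolve_left ?_
      rintro rfl
      exact (hn y hny).2 hey.symm
    · rwa [Function.update_of_ne hrt]
  · rw [Function.update_of_ne (by omega)]
    exact h.above r hr htr

end BucketInv

end Sparsification

/-! ## The Nagamochi–Ibaraki algorithm -/

/-- Both outcomes are described by one state with a conditional value, so a sequence of conditionals
does not multiply the number of cases. -/
theorem runs_when_put {c : Test} {t : Arr} {d e : Expr} {s : State} {Q : State → ℕ → Prop}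
    (p : Prop) [Decidable p] (hp : c.eval s ↔ p)
    (h : ∀ τ ≤ c.cost + d.cost + e.cost + 3,
      Q (s.setArr t (d.eval s) (if p then e.eval s else s.arr t (d.eval s))) τ) :
    Runs (.when c (.put t d e)) s Q := by
  rw [runs_when, runs_put, hp]
  refine ⟨fun hc => ?_, fun hc => ?_⟩
  · simpa [hc] using h (c.cost + 1 + (d.cost + e.cost + 1)) (by omega)
  · have := h (c.cost + 1 + 1) (by omega)
    rw [if_neg hc] at this
    convert this using 1
    ext t' i
    · rfl
    · by_cases ht : t' = t
      · subst ht; simp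
      · simp [ht]

theorem runs_when_set {c : Test} {r : Reg} {e : Expr} {s : State} {Q : State → ℕ → Prop}
    (p : Prop) [Decidable p] (hp : c.eval s ↔ p)
    (h : ∀ τ ≤ c.cost + e.cost + 3, Q (s.setReg r (if p then e.eval s else s.reg r)) τ) :
    Runs (.when c (.set r e)) s Q := by
  rw [runs_when, runs_set, hp]
  refine ⟨fun hc => ?_, fun hc => ?_⟩
  · simpa [hc] using h (c.cost + 1 + (e.cost + 1)) (by omega)
  · have := h (c.cost + 1 + 1) (by omega)
    rw [if_neg hc] at this
    convert this using 1
    ext r'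
    · by_cases hr : r' = r
      · subst hr; simp
      · simp [hr]
    · rfl

theorem runs_ite_set {c : Test} {r : Reg} {e e' : Expr} {s : State} {Q : State → ℕ → Prop}
    (p : Prop) [Decidable p] (hp : c.eval s ↔ p)
    (h : ∀ τ ≤ c.cost + e.cost + e'.cost + 3, Q (s.setReg r (if p then e.eval s else e'.eval s)) τ) :
    Runs (.ite c (.set r e) (.set r e')) s Q := by
  rw [runs_ite, runs_set, runs_set, hp]
  refine ⟨fun hc => ?_, fun hc => ?_⟩
  · simpa [hc] using h (c.cost + 1 + (e.cost + 1)) (by omega)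
  · simpa [hc] using h (c.cost + 1 + (e'.cost + 1)) (by omega)

/-- The treatment of an unscanned edge in `Prog.scanNode`. -/
def scanEdgeProg : Prog := Prog.block [
  .set .y (.get .target (.reg .a - 1)),
  .when (.lt (.get .rank (.reg .y)) (.reg .k)) (.put .keep (.reg .b) 1),
  .when (.eq (.get .rank (.reg .x)) (.get .rank (.reg .y)))
    (.put .rank (.reg .x) (.get .rank (.reg .x) + 1)),
  .put .rank (.reg .y) (.get .rank (.reg .y) + 1),
  .put .used (.reg .b) 1,
  Prog.pushBucket,
  .when (.lt (.reg .top) (.get .rank (.reg .y))) (.set .top (.get .rank (.reg .y)))]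

theorem scanEdgeProg_runs {s : State} {x y b j top k : ℕ} {R : ℕ → ℕ} (hx : s.reg .x = x)
    (hy : s.arr .target (s.reg .a - 1) = y) (hb : s.reg .b = b) (hj : s.reg .j = j)
    (htop : s.reg .top = top) (hk : s.reg .k = k) (hR : s.arr .rank = R) (hxy : y ≠ x) :
    Runs scanEdgeProg s (fun s' t => Frame scanEdgeProg s s' ∧
      s'.arr .rank = Function.update (Function.update R x (if R x = R y then R x + 1 else R x)) y
        (R y + 1) ∧
      s'.arr .keep = Function.update (s.arr .keep) b (if R y < k then 1 else s.arr .keep b) ∧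
      s'.arr .used = Function.update (s.arr .used) b 1 ∧
      s'.arr .bucket = Function.update (s.arr .bucket) (R y + 1) (j + 1) ∧
      s'.arr .entNode = Function.update (s.arr .entNode) j y ∧
      s'.arr .entNext = Function.update (s.arr .entNext) j (s.arr .bucket (R y + 1)) ∧
      s'.reg .j = j + 1 ∧ s'.reg .top = (if top < R y + 1 then R y + 1 else top) ∧ t ≤ 200) := by
  apply Runs.frame
  simp only [scanEdgeProg, Prog.block, runs_seq, runs_set]
  refine runs_when_put (R y < k) (by simp [hy, hR, hk]) fun t₁ ht₁ => ?_
  refine runs_when_put (R x = R y) (by simp [hx, hy, hR]) fun t₂ ht₂ => ?_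
  simp only [runs_put, Prog.pushBucket, Prog.block, runs_seq, runs_set]
  refine runs_when_set (top < R y + 1) (by simp [hy, hR, hx, htop, hxy]) fun t₃ ht₃ => ?_
  simp at ht₁ ht₂ ht₃
  simp [hx, hy, hb, hj, htop, hR, hxy]
  omega

/-! ### The scan of one node and its amortized cost. -/

section Sparsify

variable {n m : ℕ} {E : Set (Sym2 ℕ)}

/-- The number of unused edges. -/
def unusedCount (m : ℕ) (used : ℕ → ℕ) : ℕ := ((Finset.range m).filter fun b => used b = 0).card

theorem unusedCount_update {m b : ℕ} {used : ℕ → ℕ} (hb : b < m) (hu : used b = 0) :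
    unusedCount m (Function.update used b 1) + 1 = unusedCount m used := by
  have : (Finset.range m).filter (fun c => Function.update used b 1 c = 0) =
      ((Finset.range m).filter fun c => used c = 0).erase b := by
    ext c
    by_cases hc : c = b
    · simp [hc]
    · simp [hc]
  rw [unusedCount, unusedCount, this]
  exact Finset.card_erase_add_one (by simp [hb, hu])

/-- The steps that are paid for by the bucket entries, the unused edges and the top bucket. -/
def bucketCost (n m : ℕ) (bl : ℕ → List ℕ) (used : ℕ → ℕ) (top : ℕ) : ℕ :=
  60 * (∑ r ∈ Finset.range n, (bl r).length) + 120 * unusedCount m used + 60 * top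

theorem sum_length_push {n r a : ℕ} {bl : ℕ → List ℕ} (hr : r < n) :
    ∑ y ∈ Finset.range n, (Function.update bl r (a :: bl r) y).length =
      ∑ y ∈ Finset.range n, (bl y).length + 1 := by
  have := sum_length_update (rem := Function.update bl r (a :: bl r)) hr (Function.update_self ..)
  simp only [Function.update_idem, Function.update_eq_self] at this
  exact this.symm

/-- During the scan `x` is still active for `ForestInv`, but its rank may grow without a new bucket
entry. The bucket invariant therefore exempts `x` until it is marked as scanned. -/
theorem scanNode_runs {N : Network n m E} (hrev : ∀ a < m, N.rev a = a + m) {k x : ℕ} {s : State}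
    (hN : N.Holds s) (hk : s.reg .k = k) (hx : s.reg .x = x) (hxn : x < n)
    (hsx : s.arr .scanned x = 0) {forest : ℕ → ℕ} {bl : ℕ → List ℕ}
    (hF : ForestInv N k (s.arr .rank) (s.arr .used) (s.arr .keep) (fun z => s.arr .scanned z = 0)
      forest)
    (hB : BucketInv n (s.arr .rank) (s.arr .bucket) (s.arr .entNode) (s.arr .entNext) (s.reg .j)
      (s.reg .top) (fun z => s.arr .scanned z = 0 ∧ z ≠ x) bl)
    (hmax : ∀ z < n, s.arr .scanned z = 0 → s.arr .rank z ≤ s.arr .rank x) :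
    Runs Prog.scanNode s (fun s' t => Frame Prog.scanNode s s' ∧
      s'.arr .scanned = Function.update (s.arr .scanned) x 1 ∧ ∃ forest' bl',
      ForestInv N k (s'.arr .rank) (s'.arr .used) (s'.arr .keep) (fun z => s'.arr .scanned z = 0)
        forest' ∧
      BucketInv n (s'.arr .rank) (s'.arr .bucket) (s'.arr .entNode) (s'.arr .entNext) (s'.reg .j)
        (s'.reg .top) (fun z => s'.arr .scanned z = 0) bl' ∧
      t + bucketCost n m bl' (s'.arr .used) (s'.reg .top) ≤
        bucketCost n m bl (s.arr .used) (s.reg .top) + 400 * (N.adj x).length + 20) := by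
  apply Runs.frame
  -- The program is regrouped so that `scanEdgeProg` appears as one piece.
  change Runs (.seq (.set .a (.get .head (.reg .x))) (.seq (.loop (.lt 0 (.reg .a))
    (.seq (.ite (.lt (.reg .a - 1) (.reg .m)) (.set .b (.reg .a - 1))
        (.set .b (.reg .a - 1 - .reg .m)))
      (.seq (.when (.eq (.get .used (.reg .b)) 0) scanEdgeProg)
        (.set .a (.get .nxt (.reg .a - 1))))))
    (.put .scanned (.reg .x) 1))) s _
  simp only [runs_seq, runs_set]
  refine (Runs.loop (fun s' φ => ∃ L forest' bl', Chain N.nxt (s'.reg .a) L ∧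
    (∀ c ∈ L, c < m + m ∧ N.tail c = x) ∧
    (∀ c < m + m, N.tail c = x → c ∈ L ∨ s'.arr .used (edgeId m c) ≠ 0) ∧
    ForestInv N k (s'.arr .rank) (s'.arr .used) (s'.arr .keep) (fun z => s.arr .scanned z = 0)
      forest' ∧
    BucketInv n (s'.arr .rank) (s'.arr .bucket) (s'.arr .entNode) (s'.arr .entNext) (s'.reg .j)
      (s'.reg .top) (fun z => s.arr .scanned z = 0 ∧ z ≠ x) bl' ∧
    (∀ z < n, s.arr .scanned z = 0 → s'.arr .rank z ≤ s'.arr .rank x) ∧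
    φ = bucketCost n m bl' (s'.arr .used) (s'.reg .top) + 400 * L.length)
    (φ := bucketCost n m bl (s.arr .used) (s.reg .top) + 400 * (N.adj x).length) ?_ ?_).mono ?_
  · refine ⟨N.adj x, forest, bl, ?_, fun c hc => (N.mem_adj x hxn c).1 hc,
      fun c hc hcx => .inl ((N.mem_adj x hxn c).2 ⟨hc, hcx⟩), hF, by simpa using hB, hmax,
      by simp⟩
    simpa [hx, hN.head_eq] using N.chains x hxn
  · rintro s₁ φ hf₁ ⟨L, forest', bl', hL, hmem, hall, hF₁, hB₁, hmax₁, rfl⟩ hc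
    have hN₁ : N.Holds s₁ := Network.Holds.frame (s := s.setReg .a _)
      ⟨by simpa using hN.n_eq, by simpa using hN.m_eq, hN.tgt_eq, hN.rev_eq, hN.head_eq,
        hN.nxt_eq⟩ hf₁ rfl
    have hx₁ : s₁.reg .x = x := (hf₁.reg .x rfl).trans (by simpa using hx)
    have hk₁ : s₁.reg .k = k := (hf₁.reg .k rfl).trans (by simpa using hk)
    simp only [Test.eval, Expr.eval] at hc
    obtain ⟨a, L, rfl, ha, hL'⟩ := hL.eq_cons hc.ne'
    obtain ⟨ham, hax⟩ := hmem a List.mem_cons_self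
    have hcond : (Test.lt (.reg .a - 1) (.reg .m)).eval s₁ ↔ a < m := by simp [ha, hN₁.m_eq]
    simp only [runs_seq]
    refine runs_ite_set (a < m) hcond fun τ hτ => ?_
    have hb : (if a < m then (Expr.reg .a - 1).eval s₁ else
        (Expr.reg .a - 1 - .reg .m).eval s₁) = edgeId m a := by
      simp [edgeId, ha, hN₁.m_eq]
    rw [hb]
    simp at hτ
    simp only [runs_when, runs_set]
    constructor
    · intro hu
      simp at hu
      obtain ⟨R, hR⟩ : ∃ R, s₁.arr .rank = R := ⟨_, rfl⟩
      rw [hR] at hF₁ hB₁ hmax₁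
      have hne : N.tgt a ≠ x := by
        rw [← hax]
        exact (N.loopless a ham).symm
      refine (scanEdgeProg_runs (s := s₁.setReg .b (edgeId m a)) (x := x) (y := N.tgt a)
        (b := edgeId m a) (by simpa using hx₁) (by simp [ha, hN₁.tgt_eq]) (by simp) rfl rfl
        (k := k) (by simpa using hk₁) hR hne).mono ?_
      rintro s₂ t ⟨hf₂, hr, hke, hus, hbu, hen, hex, hj, htop, ht⟩
      simp only [State.setReg_arr, State.setReg_reg, reduceCtorEq, if_false]
        at hr hke hus hbu hen hex hj htop
      have hy' : s₂.arr .rank (N.tgt a) = R (N.tgt a) + 1 := by simp [hr]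
      have hx' : s₂.arr .rank x = if R x = R (N.tgt a) then R x + 1 else R x := by
        simp [hr, hne.symm]
      have hz' : ∀ z, z ≠ x → z ≠ N.tgt a → s₂.arr .rank z = R z := fun z h₁ h₂ => by
        simp [hr, h₁, h₂]
      obtain ⟨hact, hmax₂, hF₂⟩ := hF₁.scanEdge hrev ham hax hsx hmax₁ hu hy' hx' hz'
      rw [← hus, ← hke] at hF₂
      have hyn := N.tgt_lt a ham
      -- The new rank of the neighbour is below `n`, so its bucket exists.
      have hlt := hF₂.rank_lt hyn
      have hle := hB₁.rank_le_top hyn ⟨hact, hne⟩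
      have htl := hB₁.top_lt
      have hmono : ∀ z, R z ≤ s₂.arr .rank z := by
        intro z
        by_cases h₁ : z = x
        · rw [h₁, hx']; split_ifs <;> omega
        · by_cases h₂ : z = N.tgt a
          · rw [h₂, hy']; omega
          · rw [hz' z h₁ h₂]
      have hB₂ := (hB₁.mono (need' := fun z => s.arr .scanned z = 0 ∧ z ≠ x ∧ z ≠ N.tgt a)
        hmono fun z hz => ⟨⟨hz.1, hz.2.1⟩, hz' z hz.2.1 hz.2.2⟩).push (y := N.tgt a)
        (top' := s₂.reg .top) (need' := fun z => s.arr .scanned z = 0 ∧ z ≠ x) hyn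
        (by rw [hy', htop]; split_ifs <;> omega) (by rw [htop]; split_ifs <;> omega)
        (by rw [htop]; split_ifs <;> omega) fun z hz hzy => ⟨hz.1, hz.2, hzy⟩
      rw [hy', ← hbu, ← hen, ← hex, ← hj] at hB₂
      have ha₂ : s₂.reg .a = a + 1 := by
        rw [hf₂.reg .a rfl]
        simpa using ha
      have hnx₂ : s₂.arr .nxt = N.nxt := by
        rw [hf₂.arr .nxt rfl]
        simpa using hN₁.nxt_eq
      refine ⟨_, ⟨L, _, Function.update bl' (R (N.tgt a) + 1) (s₁.reg .j :: bl' (R (N.tgt a) + 1)), ?_,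
        fun c hc => hmem c (List.mem_cons_of_mem _ hc), ?_, hF₂, ?_, hmax₂, rfl⟩, ?_⟩
      · simpa [ha₂, hnx₂] using hL'
      · intro c hc hcx
        simp only [State.setReg_arr, hus]
        by_cases hca : edgeId m c = edgeId m a
        · simp [hca]
        · rw [Function.update_of_ne hca]
          refine (hall c hc hcx).imp_left fun h => ?_
          rcases List.mem_cons.1 h with rfl | h
          · exact absurd rfl hca
          · exact h
      · simpa using hB₂
      -- The 120 steps released by the edge pay for one more entry (60) and a rise of `top` by at
      -- most one (60). The work itself is paid for by the 400 steps of the arc.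
      · have h₁ := unusedCount_update (edgeId_lt ham) hu
        have h₂ := sum_length_push (a := s₁.reg .j) (bl := bl') (r := R (N.tgt a) + 1)
          (hy' ▸ hlt)
        have h₃ : s₂.reg .top ≤ s₁.reg .top + 1 := by rw [htop]; split_ifs <;> omega
        simp [bucketCost, hus, h₂]
        omega
    · intro hu
      simp at hu
      refine ⟨_, ⟨L, forest', bl', ?_, fun c hc => hmem c (List.mem_cons_of_mem _ hc), ?_, hF₁,
        by simpa using hB₁, hmax₁, rfl⟩, ?_⟩
      · simpa [ha, hN₁.nxt_eq] using hL'
      · intro c hc hcx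
        rcases hall c hc hcx with h | h
        · rcases List.mem_cons.1 h with rfl | h
          · exact .inr hu
          · exact .inl h
        · exact .inr h
      · simp
        omega
  · rintro s₁ t ⟨hf₁, hc, φ', ⟨L, forest', bl', hL, hmem, hall, hF₁, hB₁, hmax₁, rfl⟩, ht⟩
    simp only [Test.eval, Expr.eval, not_lt, nonpos_iff_eq_zero] at hc
    have hx₁ : s₁.reg .x = x := (hf₁.reg .x rfl).trans (by simpa using hx)
    have hsc₁ : s₁.arr .scanned = s.arr .scanned := hf₁.arr .scanned rfl
    rw [hc] at hL
    obtain rfl := hL.eq_nil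
    have hsc : ∀ z, Function.update (s.arr .scanned) x 1 z = 0 ↔ s.arr .scanned z = 0 ∧ z ≠ x := by
      intro z
      by_cases hz : z = x
      · simp [hz]
      · simp [hz]
    simp only [runs_put]
    refine ⟨by simp [hx₁, hsc₁], forest', bl', ?_, ?_, ?_⟩
    · simp only [State.setArr_arr, Expr.eval, hx₁, hsc₁, reduceCtorEq, if_false,
        if_true, hsc]
      exact hF₁.finishNode (fun z hz => hz.1) (fun z h₁ h₂ => ⟨h₁, h₂⟩)
        fun a ha hax => (hall a ha hax).resolve_left (by simp)
    · simpa [hx₁, hsc₁, hsc] using hB₁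
    · simp at ht ⊢
      omega

end Sparsify

/-! ### The main loop: scanning all nodes in order of rank. -/

section SparsifyLoop

variable {n m : ℕ} {E : Set (Sym2 ℕ)}

/-- The main loop of `Prog.sparsify`. -/
def scanLoop : Prog := .loop (.eq (.reg .fin) 0)
  (.ite (.eq (.get .bucket (.reg .top)) 0)
    (.ite (.eq (.reg .top) 0) (.set .fin 1) (.set .top (.reg .top - 1)))
    (Prog.block [
      .set .a (.get .bucket (.reg .top) - 1),
      .set .x (.get .entNode (.reg .a)),
      .put .bucket (.reg .top) (.get .entNext (.reg .a)),
      .when (.eq (.get .scanned (.reg .x)) 0) Prog.scanNode]))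

/-- The steps that are paid for by the unscanned nodes. -/
def Network.scanCost (N : Network n m E) (scanned : ℕ → ℕ) : ℕ :=
  ∑ z ∈ Finset.range n, if scanned z = 0 then 100 + 400 * (N.adj z).length else 0

theorem Network.scanCost_update (N : Network n m E) {scanned : ℕ → ℕ} {x : ℕ} (hx : x < n)
    (h : scanned x = 0) : N.scanCost (Function.update scanned x 1) +
      (100 + 400 * (N.adj x).length) = N.scanCost scanned := by
  have hmem := Finset.mem_range.2 hx
  rw [scanCost, scanCost, ← Finset.add_sum_erase _ _ hmem, ← Finset.add_sum_erase _ _ hmem, if_pos h,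
    Function.update_self, if_neg one_ne_zero, zero_add, add_comm]
  congr 1
  refine Finset.sum_congr rfl fun z hz => ?_
  rw [Function.update_of_ne (Finset.ne_of_mem_erase hz)]

theorem Network.scanCost_le (N : Network n m E) (scanned : ℕ → ℕ) :
    N.scanCost scanned ≤ 100 * n + 400 * (m + m) := by
  rw [← N.sum_length_adj, Finset.mul_sum, mul_comm 100 n]
  calc N.scanCost scanned ≤ ∑ z ∈ Finset.range n, (100 + 400 * (N.adj z).length) :=
        Finset.sum_le_sum fun z _ => by split_ifs <;> omega
    _ = _ := by rw [Finset.sum_add_distrib]; simp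

theorem BucketInv.not_need {rank bucket entNode entNext : ℕ → ℕ} {j : ℕ} {need : ℕ → Prop}
    {bl : ℕ → List ℕ} (h : BucketInv n rank bucket entNode entNext j 0 need bl)
    (h₀ : bucket 0 = 0) {y : ℕ} (hy : y < n) : ¬ need y := by
  intro hn
  obtain ⟨hr, e, he, -⟩ := h.cover y hy hn
  have hle := h.rank_le_top hy hn
  have hc := h.chains _ hr
  rw [Nat.le_zero.1 hle, h₀] at hc
  rw [Nat.le_zero.1 hle, hc.eq_nil] at he
  simp at he

theorem scanLoop_runs {N : Network n m E} (hrev : ∀ a < m, N.rev a = a + m) {k : ℕ} {s : State}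
    (hN : N.Holds s) (hk : s.reg .k = k) (hfin : s.reg .fin = 0) {forest : ℕ → ℕ}
    {bl : ℕ → List ℕ}
    (hF : ForestInv N k (s.arr .rank) (s.arr .used) (s.arr .keep) (fun z => s.arr .scanned z = 0)
      forest)
    (hB : BucketInv n (s.arr .rank) (s.arr .bucket) (s.arr .entNode) (s.arr .entNext) (s.reg .j)
      (s.reg .top) (fun z => s.arr .scanned z = 0) bl) :
    Runs scanLoop s (fun s' t => Frame scanLoop s s' ∧ (∀ b < m, s'.arr .used b ≠ 0) ∧
      (∃ forest', ForestInv N k (s'.arr .rank) (s'.arr .used) (s'.arr .keep)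
        (fun z => s'.arr .scanned z = 0) forest') ∧
      t ≤ bucketCost n m bl (s.arr .used) (s.reg .top) + N.scanCost (s.arr .scanned) + 60) := by
  -- Removing an entry or lowering `top` releases 60 steps, scanning a node `100 + 400 · degree`,
  -- and the final pass 50.
  refine (Runs.loop (fun s' φ => ∃ forest' bl',
    ForestInv N k (s'.arr .rank) (s'.arr .used) (s'.arr .keep) (fun z => s'.arr .scanned z = 0)
      forest' ∧
    BucketInv n (s'.arr .rank) (s'.arr .bucket) (s'.arr .entNode) (s'.arr .entNext) (s'.reg .j)
      (s'.reg .top) (fun z => s'.arr .scanned z = 0) bl' ∧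
    (s'.reg .fin ≠ 0 → ∀ b < m, s'.arr .used b ≠ 0) ∧
    φ = bucketCost n m bl' (s'.arr .used) (s'.reg .top) + N.scanCost (s'.arr .scanned) +
      if s'.reg .fin = 0 then 50 else 0)
    (φ := bucketCost n m bl (s.arr .used) (s.reg .top) + N.scanCost (s.arr .scanned) + 50)
    ⟨forest, bl, hF, hB, fun h => absurd hfin h, by simp [hfin]⟩ ?_).mono ?_
  · rintro s₁ φ hf₁ ⟨forest', bl', hF₁, hB₁, -, rfl⟩ hc
    have hN₁ : N.Holds s₁ := hN.frame hf₁ rfl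
    have hk₁ : s₁.reg .k = k := (hf₁.reg .k rfl).trans hk
    simp only [Test.eval, Expr.eval] at hc
    simp only [Prog.block, runs_ite, runs_seq, runs_set, runs_put, runs_when]
    refine ⟨fun hb => ⟨fun ht => ?_, fun ht => ?_⟩, fun hb => ?_⟩
    · simp at hb ht
      rw [ht] at hB₁ hb
      refine ⟨_, ⟨forest', bl', hF₁, by simpa [ht] using hB₁, fun _ b hbm => ?_, rfl⟩, ?_⟩
      -- When bucket `0` is empty at `top = 0`, no node is active, so `closed` at the tail of the
      -- arc `b` shows that edge `b` has been used.
      · have := hF₁.closed b (by omega) (hB₁.not_need hb (N.tail_lt (by omega)))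
        rwa [edgeId_of_lt hbm] at this
      · simp [hc]
        omega
    · simp at hb ht
      obtain ⟨top, htop⟩ := Nat.exists_eq_succ_of_ne_zero ht
      rw [htop] at hB₁ hb
      refine ⟨_, ⟨forest', bl', hF₁, by simpa [htop] using hB₁.lower_top hb, ?_, rfl⟩, ?_⟩
      · simp [hc]
      · simp [hc, bucketCost, htop]
        omega
    · simp at hb
      obtain ⟨e, L, hL, hbe, hen, hre, hpop⟩ := hB₁.pop hb
      have hlen := sum_length_update hB₁.top_lt hL
      refine ⟨fun hsc => ?_, fun hsc => ?_⟩
      · simp [hbe] at hsc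
        refine (scanNode_runs hrev (x := s₁.arr .entNode e) (k := k) (forest := forest')
          (bl := Function.update bl' (s₁.reg .top) L) ?_ ?_ ?_ hen ?_ ?_ ?_ ?_).mono ?_
        · exact ⟨by simpa using hN₁.n_eq, by simpa using hN₁.m_eq, hN₁.tgt_eq, hN₁.rev_eq,
            hN₁.head_eq, hN₁.nxt_eq⟩
        · simpa using hk₁
        · simp [hbe]
        · simpa using hsc
        · simpa using hF₁
        · simpa [hbe] using hpop (fun z => s₁.arr .scanned z = 0 ∧ z ≠ s₁.arr .entNode e)
            fun z hz => hz
        · intro z hz hsz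
          simp at hsz ⊢
          exact (hB₁.rank_le_top hz hsz).trans hre
        · rintro s₂ t ⟨hf₂, hsc₂, forest₂, bl₂, hF₂, hB₂, ht⟩
          have hfin₂ : s₂.reg .fin = 0 := by rw [hf₂.reg .fin rfl]; simpa using hc
          refine ⟨_, ⟨forest₂, bl₂, hF₂, hB₂, fun h => absurd hfin₂ h, rfl⟩, ?_⟩
          have hcost := N.scanCost_update hen hsc
          simp at hsc₂ ht
          rw [← hsc₂] at hcost
          simp only [bucketCost] at ht ⊢
          simp [hc, hfin₂]
          omega
      -- A stale entry: its node has been scanned already, and no unscanned node loses its entry.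
      · simp [hbe] at hsc
        refine ⟨_, ⟨forest', Function.update bl' (s₁.reg .top) L, by simpa using hF₁, ?_, ?_, rfl⟩,
          ?_⟩
        · simpa [hbe] using hpop (fun z => s₁.arr .scanned z = 0)
            fun z hz => ⟨hz, fun h => hsc (h ▸ hz)⟩
        · simp [hc]
        · simp [hc, bucketCost]
          omega
  · rintro s₁ t ⟨hf₁, hc, φ', ⟨forest', bl', hF₁, hB₁, hfin₁, rfl⟩, ht⟩
    refine ⟨hf₁, hfin₁ hc, ⟨forest', hF₁⟩, ?_⟩
    simp at ht
    omega

end SparsifyLoop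

/-! ### Output of the kept edges and correctness of the sparsifier. -/

section SparsifyRuns

variable {n m : ℕ} {E : Set (Sym2 ℕ)}

/-- The last part of `Prog.sparsify`, which keeps the marked edges. -/
def keepEdges : Prog := Prog.block [
  .set .j 0,
  Prog.upTo .i (.reg .m) (.when (.lt 0 (.get .keep (.reg .i))) (Prog.block [
    .put .src (.reg .j) (.get .src (.reg .i)),
    .put .dst (.reg .j) (.get .dst (.reg .i)),
    .set .j (.reg .j + 1)])),
  .set .m (.reg .j)]

/-- The list is compacted in place. Since `j ≤ i`, writing never overtakes reading, and the entries
from `i` on are still the original ones. -/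
theorem keepEdges_runs {s : State} (hE : HasEdges s E) :
    Runs keepEdges s (fun s' t => Frame keepEdges s s' ∧
      HasEdges s' ((fun b => s(s.arr .src b, s.arr .dst b)) ''
        {b | b < s.reg .m ∧ s.arr .keep b ≠ 0}) ∧ t ≤ 50 * s.reg .m + 10) := by
  apply Runs.frame
  simp only [keepEdges, Prog.block, runs_seq, runs_set]
  refine (Runs.upTo (fun i s' => s'.reg .j ≤ i ∧
    (∀ b, i ≤ b → s'.arr .src b = s.arr .src b ∧ s'.arr .dst b = s.arr .dst b) ∧
    EdgeList (s'.reg .j) (s'.arr .src) (s'.arr .dst)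
      ((fun b => s(s.arr .src b, s.arr .dst b)) '' {b | b < i ∧ s.arr .keep b ≠ 0}))
    40 rfl rfl (by simp) ?_ ?_).mono ?_
  · refine ⟨by simp, by simp, ?_⟩
    simp [EdgeList, Set.BijOn, Set.MapsTo, Set.InjOn, Set.SurjOn]
  · rintro i s₁ hi hf₁ hri ⟨hj, hsame, hL⟩
    simp at hi
    have hkeep : s₁.arr .keep = s.arr .keep := hf₁.arr .keep rfl
    obtain ⟨hs, hd⟩ := hsame i le_rfl
    simp only [runs_when, runs_seq, runs_put, runs_set]
    refine ⟨fun hk => ?_, fun hk => ?_⟩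
    · simp [hri, hkeep] at hk
      have hset : {b | b < i + 1 ∧ s.arr .keep b ≠ 0} =
          insert i {b | b < i ∧ s.arr .keep b ≠ 0} := by
        ext b
        simp only [Set.mem_ofPred_eq, Set.mem_insert_iff]
        constructor
        · rintro ⟨h₁, h₂⟩
          rcases Nat.lt_succ_iff_lt_or_eq.1 h₁ with h | rfl
          · exact .inr ⟨h, h₂⟩
          · exact .inl rfl
        · rintro (rfl | ⟨h₁, h₂⟩)
          · exact ⟨by omega, by omega⟩
          · exact ⟨by omega, h₂⟩
      have hnew : s(s.arr .src i, s.arr .dst i) ∉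
          (fun b => s(s.arr .src b, s.arr .dst b)) '' {b | b < i ∧ s.arr .keep b ≠ 0} := by
        rintro ⟨b, ⟨hb, -⟩, he⟩
        exact hb.ne (hE.injOn (Set.mem_Iio.2 (hb.trans hi)) hi he)
      refine ⟨by simp, by simpa using hj, fun b hb => ?_, ?_⟩
      · have hbj : b ≠ s₁.reg .j := by omega
        simpa [hbj] using hsame b (by omega)
      · rw [hset, Set.image_insert_eq]
        simpa [hri, hs, hd] using hL.insert hnew
    · simp [hri, hkeep] at hk
      have hset : {b | b < i + 1 ∧ s.arr .keep b ≠ 0} = {b | b < i ∧ s.arr .keep b ≠ 0} := by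
        ext b
        simp only [Set.mem_ofPred_eq]
        constructor
        · rintro ⟨h₁, h₂⟩
          rcases Nat.lt_succ_iff_lt_or_eq.1 h₁ with h | rfl
          · exact ⟨h, h₂⟩
          · exact absurd hk h₂
        · rintro ⟨h₁, h₂⟩
          exact ⟨by omega, h₂⟩
      refine ⟨by simp, ?_, fun b hb => hsame b (by omega), ?_⟩
      · simp
        omega
      · rw [hset]
        simpa using hL
  · rintro s₁ t ⟨hf₁, ⟨hj, hsame, hL⟩, ht⟩
    simp at ht hL ⊢
    refine ⟨?_, by omega⟩
    simpa [HasEdges] using hL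

/-- `F` is a certificate of connectivity for `E`: a cut either has the same edges in `F` and `E`, or
at least `k` edges in `F`. -/
def IsCutCertificate (k : ℕ) (E F : Set (Sym2 ℕ)) : Prop :=
  ∀ X : ℕ → Prop, (∀ x y, s(x, y) ∈ E → X x → ¬ X y → s(x, y) ∈ F) ∨
    ∃ e : Fin k → Sym2 ℕ, Function.Injective e ∧ ∀ j, e j ∈ F ∧ ∃ x y, e j = s(x, y) ∧ X x ∧ ¬ X y

/-- The `k` edges are distinct because they belong to the different forests `1, …, k`; an edge that
enters `X` is turned around. -/
theorem ForestInv.isCutCertificate {N : Network n m E} {k : ℕ} {rank used keep : ℕ → ℕ}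
    {active : ℕ → Prop} {forest : ℕ → ℕ} (h : ForestInv N k rank used keep active forest)
    (hu : ∀ b < m, used b ≠ 0) {src dst : ℕ → ℕ} (hE : EdgeList m src dst E)
    (hsrc : ∀ b < m, N.tail b = src b) (hdst : ∀ b < m, N.tgt b = dst b) :
    IsCutCertificate k E ((fun b => s(src b, dst b)) '' {b | b < m ∧ keep b ≠ 0}) := by
  intro X
  refine (h.cut_kept hu X).imp (fun hall x y hxy hx hy => ?_) fun hall => ?_
  · obtain ⟨b, hb, he⟩ := hE.surjOn hxy
    refine ⟨b, ⟨hb, hall b hb ?_⟩, he⟩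
    rw [Network.Cross, hsrc b hb, hdst b hb]
    rcases Sym2.eq_iff.1 he with ⟨h₁, h₂⟩ | ⟨h₁, h₂⟩
    · rw [h₁, h₂]; tauto
    · rw [h₁, h₂]; tauto
  · have hall' : ∀ j : Fin k, ∃ b < m, keep b ≠ 0 ∧ N.Cross X b ∧ forest b = j + 1 :=
      fun j => hall (j + 1) (by omega) (by omega)
    choose b hb hk hc hf using hall'
    refine ⟨fun j => s(src (b j), dst (b j)), fun i j hij => ?_, fun j =>
      ⟨⟨b j, ⟨hb j, hk j⟩, rfl⟩, ?_⟩⟩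
    · have : b i = b j := hE.injOn (Set.mem_Iio.2 (hb i)) (Set.mem_Iio.2 (hb j)) hij
      have h₁ := hf i
      rw [this, hf j] at h₁
      exact Fin.ext (by omega)
    · have hcj := hc j
      rw [Network.Cross, hsrc _ (hb j), hdst _ (hb j)] at hcj
      by_cases hX : X (src (b j))
      · exact ⟨_, _, rfl, hX, by tauto⟩
      · exact ⟨_, _, Sym2.eq_swap, by tauto, hX⟩

theorem ForestInv.ncard_le {N : Network n m E} {k : ℕ} {rank used keep : ℕ → ℕ}
    {active : ℕ → Prop} {forest : ℕ → ℕ} (h : ForestInv N k rank used keep active forest)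
    (f : ℕ → Sym2 ℕ) : (f '' {b | b < m ∧ keep b ≠ 0}).ncard ≤ k * n := by
  have hset : {b | b < m ∧ keep b ≠ 0} = ((Finset.range m).filter fun b => keep b ≠ 0 : Finset ℕ) := by
    ext b; simp
  calc (f '' {b | b < m ∧ keep b ≠ 0}).ncard ≤ {b | b < m ∧ keep b ≠ 0}.ncard :=
        Set.ncard_image_le (by rw [hset]; exact Finset.finite_toSet _)
    _ = ∑ b ∈ Finset.range m, if keep b ≠ 0 then 1 else 0 := by
        rw [hset, Set.ncard_coe_finset, Finset.card_filter]
    _ ≤ ∑ b ∈ Finset.range m, keep b := Finset.sum_le_sum fun b _ => by split_ifs <;> omega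
    _ ≤ ∑ y ∈ Finset.range n, min (rank y) k := h.count
    _ ≤ ∑ y ∈ Finset.range n, k := Finset.sum_le_sum fun y _ => min_le_right _ _
    _ = k * n := by rw [Finset.sum_const, Finset.card_range, smul_eq_mul, mul_comm]

theorem sparsify_runs {s : State} {k : ℕ} (hn : s.reg .n = n) (hpos : 0 < n) (hk : s.reg .k = k)
    (hE : HasEdges s E) (hv : ValidEdges n E) :
    Runs Prog.sparsify s (fun s' t => Frame Prog.sparsify s s' ∧ t ≤ 1200 * (n + s.reg .m) + 200 ∧
      ∃ F ⊆ E, HasEdges s' F ∧ F.ncard ≤ k * n ∧ IsCutCertificate k E F) := by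
  apply Runs.frame
  change Runs (.seq Prog.buildNetwork (.seq
    (Prog.upTo .i (.reg .m) (.seq (.put .used (.reg .i) 0) (.put .keep (.reg .i) 0)))
    (.seq (.put .bucket 0 0) (.seq
    (Prog.upTo .i (.reg .n) (.seq (.put .rank (.reg .i) 0) (.seq (.put .scanned (.reg .i) 0)
      (.put .bucket (.reg .i) 0))))
    (.seq (.set .j 0) (.seq (Prog.upTo .y (.reg .n) Prog.pushBucket) (.seq (.set .top 0)
    (.seq (.set .fin 0) (.seq scanLoop keepEdges))))))))) s _
  simp only [runs_seq, runs_set, runs_put]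
  refine (buildNetwork_runs hn hE hv).mono ?_
  rintro s₁ t₁ ⟨hf₁, ht₁, -, harcs, N, hN₁⟩
  refine (Runs.upTo (fun i s' => ∀ b < i, s'.arr .used b = 0 ∧ s'.arr .keep b = 0) 20 rfl rfl
    (by simp) (by simp) ?_).mono ?_
  · intro i s' hi hf hri h
    simp only [runs_seq, runs_put]
    refine ⟨by simp, fun b hb => ?_⟩
    rcases Nat.lt_succ_iff_lt_or_eq.1 hb with hb | rfl
    · simpa [hri, hb.ne] using h b hb
    · simp [hri]
  rintro s₂ t₂ ⟨hf₂, h₂, ht₂⟩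
  have hN₂ : N.Holds s₂ := hN₁.frame hf₂ rfl
  rw [hN₁.m_eq] at h₂ ht₂
  refine (Runs.upTo (fun i s' => ∀ b < i, s'.arr .rank b = 0 ∧ s'.arr .scanned b = 0 ∧
    s'.arr .bucket b = 0) 20 rfl rfl (by simp) (by simp) ?_).mono ?_
  · intro i s' hi hf hri h
    simp only [runs_seq, runs_put]
    refine ⟨by simp, fun b hb => ?_⟩
    rcases Nat.lt_succ_iff_lt_or_eq.1 hb with hb | rfl
    · simpa [hri, hb.ne] using h b hb
    · simp [hri]
  rintro s₃ t₃ ⟨hf₃, h₃, ht₃⟩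
  have hN₃ : N.Holds s₃ := Network.Holds.frame (s := s₂.setArr .bucket _ _)
    ⟨hN₂.n_eq, hN₂.m_eq, by simpa using hN₂.tgt_eq, by simpa using hN₂.rev_eq,
      by simpa using hN₂.head_eq, by simpa using hN₂.nxt_eq⟩ hf₃ rfl
  rw [State.setArr_reg, hN₂.n_eq] at h₃ ht₃
  -- The indices `n ≤ z` are included so that at `i = n` the predicate holds for every `z`: memory
  -- beyond `n` is arbitrary, and `BucketInv.mono` compares the predicates everywhere.
  refine (Runs.upTo (fun i s' => ∃ bl, BucketInv n (s'.arr .rank) (s'.arr .bucket)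
    (s'.arr .entNode) (s'.arr .entNext) (s'.reg .j) 0 (fun z => z < i ∨ n ≤ z) bl ∧
    ∑ r ∈ Finset.range n, (bl r).length ≤ i) 20 rfl rfl (by simp) ?_ ?_).mono ?_
  · refine ⟨fun _ => [], ⟨fun r hr => (h₃ r hr).2.2, by simp, by simp, fun y hy hy' => ?_,
      fun _ _ _ => rfl, hpos⟩, by simp⟩
    omega
  · rintro i s' hi hf hri ⟨bl, hB, hsum⟩
    simp only [State.setReg_reg, reduceCtorEq, if_false, hN₃.n_eq] at hi
    have hrank : s'.arr .rank i = 0 := by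
      rw [hf.arr .rank rfl]
      exact (h₃ i hi).1
    simp only [Prog.pushBucket, Prog.block, runs_seq, runs_put, runs_set]
    have := hB.push (y := i) (top' := 0) (need' := fun z => z < i + 1 ∨ n ≤ z) hi (by omega) le_rfl
      hpos fun z hz hzi => by omega
    refine ⟨by simp, _, by simpa [hri] using this, ?_⟩
    rw [hrank, sum_length_push hpos]
    omega
  rintro s₄ t₄ ⟨hf₄, ⟨bl, hB₄, hsum⟩, ht₄⟩
  simp only [State.setReg_reg, reduceCtorEq, if_false, hN₃.n_eq] at hB₄ hsum ht₄
  have hN₄ : N.Holds s₄ := Network.Holds.frame (s := s₃.setReg .j _)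
    ⟨by simpa using hN₃.n_eq, by simpa using hN₃.m_eq, hN₃.tgt_eq, hN₃.rev_eq, hN₃.head_eq,
      hN₃.nxt_eq⟩ hf₄ rfl
  have hk₄ : s₄.reg .k = k := by
    rw [hf₄.reg .k rfl, ← hk, ← hf₁.reg .k rfl, ← hf₂.reg .k rfl]
    simpa using hf₃.reg .k rfl
  have harr : ∀ r ∈ [Arr.used, .keep], s₄.arr r = s₂.arr r := by
    intro r hr
    simp only [List.mem_cons, List.not_mem_nil, or_false] at hr
    rcases hr with rfl | rfl
    · rw [hf₄.arr _ rfl]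
      exact (hf₃.arr _ rfl).trans (by simp)
    · rw [hf₄.arr _ rfl]
      exact (hf₃.arr _ rfl).trans (by simp)
  have hused := harr .used (by simp)
  have hkeep := harr .keep (by simp)
  have hrank : ∀ z < n, s₄.arr .rank z = 0 := fun z hz => by
    rw [hf₄.arr .rank rfl]
    exact (h₃ z hz).1
  have hsc : ∀ z < n, s₄.arr .scanned z = 0 := fun z hz => by
    rw [hf₄.arr .scanned rfl]
    exact (h₃ z hz).2.1
  have hrev : ∀ a < s.reg .m, N.rev a = a + s.reg .m := fun a ha => by
    rw [← hN₁.rev_eq]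
    exact (harcs a ha).1
  refine (scanLoop_runs (s := (s₄.setReg .top 0).setReg .fin 0) hrev (k := k) (bl := bl) ?_ ?_ ?_
    (ForestInv.init hrank (fun b hb => ?_) (fun b hb => ?_) hsc) ?_).mono ?_
  · exact ⟨by simpa using hN₄.n_eq, by simpa using hN₄.m_eq, hN₄.tgt_eq, hN₄.rev_eq, hN₄.head_eq,
      hN₄.nxt_eq⟩
  · simpa using hk₄
  · simp
  · exact (congrFun hused b).trans (h₂ b hb).1
  · exact (congrFun hkeep b).trans (h₂ b hb).2
  · simpa using hB₄.mono (fun _ => le_rfl) fun z _ => ⟨lt_or_ge z n, rfl⟩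
  rintro s₅ t₅ ⟨hf₅, hu₅, ⟨forest, hF₅⟩, ht₅⟩
  have hm₅ : s₅.reg .m = s.reg .m := by
    rw [hf₅.reg .m rfl]
    simpa using hN₄.m_eq
  have hedges : ∀ r ∈ [Arr.src, .dst], s₅.arr r = s.arr r := by
    intro r hr
    simp only [List.mem_cons, List.not_mem_nil, or_false] at hr
    rcases hr with rfl | rfl
    · rw [hf₅.arr _ rfl, ← hf₁.arr _ rfl, ← hf₂.arr _ rfl]
      exact (hf₄.arr _ rfl).trans ((hf₃.arr _ rfl).trans (by simp))
    · rw [hf₅.arr _ rfl, ← hf₁.arr _ rfl, ← hf₂.arr _ rfl]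
      exact (hf₄.arr _ rfl).trans ((hf₃.arr _ rfl).trans (by simp))
  have hsrc := hedges .src (by simp)
  have hdst := hedges .dst (by simp)
  refine (keepEdges_runs (s := s₅) (E := E) (by rwa [HasEdges, hm₅, hsrc, hdst])).mono ?_
  rintro s₆ t₆ ⟨hf₆, hE₆, ht₆⟩
  rw [hm₅, hsrc, hdst] at hE₆
  rw [hm₅] at ht₆
  refine ⟨?_, _, ?_, hE₆, hF₅.ncard_le _, hF₅.isCutCertificate hu₅ hE (fun b hb => ?_)
    fun b hb => ?_⟩
  · have hc := N.scanCost_le (s₄.arr .scanned)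
    have huc : unusedCount (s.reg .m) (s₄.arr .used) ≤ s.reg .m :=
      (Finset.card_filter_le _ _).trans_eq (Finset.card_range _)
    simp [bucketCost] at ht₅ ⊢
    omega
  · rintro _ ⟨b, ⟨hb, -⟩, rfl⟩
    exact hE.mapsTo hb
  · rw [Network.tail, hrev b hb, ← hN₁.tgt_eq]
    exact (harcs b hb).2.2
  · rw [← hN₁.tgt_eq]
    exact (harcs b hb).2.1

end SparsifyRuns

/-! ## Deletion and restoration of edges -/

theorem exists_graph_of_subset_natEdges {n : ℕ} {G : SimpleGraph (Fin n)} {F : Set (Sym2 ℕ)}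
    (hF : F ⊆ natEdges G) : ∃ H ≤ G, natEdges H = F := by
  have hadj : ∀ x y : Fin n, s((x : ℕ), (y : ℕ)) ∈ F → G.Adj x y := fun x y h =>
    mem_natEdges.1 (hF h)
  refine ⟨⟨fun x y => s((x : ℕ), (y : ℕ)) ∈ F, ⟨fun x y h => by rwa [Sym2.eq_swap]⟩,
    ⟨fun x h => (hadj x x h).ne rfl⟩⟩, fun x y h => hadj x y h, ?_⟩
  ext e
  induction e with
  | _ a b =>
    constructor
    · intro h
      obtain ⟨x, y, rfl, rfl, hxy⟩ := exists_of_mem_natEdges h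
      exact hxy
    · intro h
      obtain ⟨x, y, rfl, rfl, -⟩ := exists_of_mem_natEdges (hF h)
      exact mem_natEdges.2 h

/-- Suppose that deleting `S` from `H` separates `u` from `v`, and let `X` be the nodes still
reachable from `u`. All edges of `H` that leave `X` are in `S`. Then `k` of them would contradict
`|S| < k`. If instead `H` contains all edges of `G` across `X`, these are in `S` too, so a walk from
`u` to `v` in `G` without `S` could never leave `X`. -/
theorem IsCutCertificate.isEdgeConnected {n k : ℕ} {G H : SimpleGraph (Fin n)}
    (h : IsCutCertificate k (natEdges G) (natEdges H)) (hG : G.IsEdgeConnected k) :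
    H.IsEdgeConnected k := by
  intro u v S hS
  by_contra hv
  have hcross : ∀ a b : ℕ, s(a, b) ∈ natEdges H →
      (∃ w : Fin n, w = a ∧ (H.deleteEdges S).Reachable u w) →
      (¬ ∃ w : Fin n, w = b ∧ (H.deleteEdges S).Reachable u w) →
      ∃ e ∈ S, Sym2.map Fin.val e = s(a, b) := by
    rintro a b hab ⟨w, rfl, hw⟩ hb
    obtain ⟨x, y, hx, rfl, hxy⟩ := exists_of_mem_natEdges hab
    obtain rfl := Fin.ext hx
    refine ⟨s(x, y), ?_, Sym2.map_mk ..⟩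
    by_contra hmem
    have hadj : (H.deleteEdges S).Adj x y := SimpleGraph.deleteEdges_adj.2 ⟨hxy, hmem⟩
    exact hb ⟨y, rfl, hw.trans hadj.reachable⟩
  rcases h fun a => ∃ w : Fin n, w = a ∧ (H.deleteEdges S).Reachable u w with hall | ⟨e, he, hmem⟩
  · have hreach : Relation.ReflTransGen (G.deleteEdges S).Adj u v :=
      (SimpleGraph.reachable_iff_reflTransGen u v).1 (hG u v hS)
    refine hv ?_
    clear hv
    induction hreach with
    | refl => exact .refl _
    | @tail x y _ hxy ih =>
      by_contra hy
      obtain ⟨hadj, hns⟩ := SimpleGraph.deleteEdges_adj.1 hxy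
      have hny : ¬ ∃ w : Fin n, (w : ℕ) = y ∧ (H.deleteEdges S).Reachable u w := by
        rintro ⟨w, hw, hr⟩
        exact hy (Fin.ext hw ▸ hr)
      obtain ⟨e, heS, he⟩ := hcross x y
        (hall x y (mem_natEdges.2 hadj) ⟨x, rfl, ih⟩ hny) ⟨x, rfl, ih⟩ hny
      rw [← Sym2.map_mk] at he
      exact hns (sym2Map_val_injective he ▸ heS)
  · have hS' : ∀ j, ∃ e' ∈ S, Sym2.map Fin.val e' = e j := fun j => by
      obtain ⟨hj, x, y, hxy, hx, hy⟩ := hmem j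
      rw [hxy] at hj ⊢
      exact hcross x y hj hx hy
    choose e' he' hmap using hS'
    have hinj : Function.Injective e' := fun i j hij => he (by rw [← hmap i, ← hmap j, hij])
    have hle := hinj.encard_range.trans (Set.encard_le_encard (Set.range_subset_iff.2 he'))
    rw [ENat.card_eq_coe_fintype_card, Fintype.card_fin] at hle
    exact absurd hS (not_lt.2 hle)

/-- Connectedness is what turns a bound linear in `n + m` into one linear in `m`. -/
theorem le_ncard_edgeSet_add_one {n k : ℕ} {G : SimpleGraph (Fin n)} (hk : 1 ≤ k)
    (hG : G.IsEdgeConnected k) (u : Fin n) : n ≤ G.edgeSet.ncard + 1 := by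
  have : Nonempty (Fin n) := ⟨u⟩
  simpa [Nat.card_coe_set_eq] using
    (hG.connected (by omega)).card_vert_le_card_edgeSet_add_one

/-! ### Real exponents and the final time bounds. -/

theorem sq_lt_cube_of_rpow_lt {n D : ℕ} (h : (n : ℝ) ^ (2 / 3 : ℝ) < D + 1) :
    n ^ 2 < (D + 1) ^ 3 := by
  have h₁ : ((n : ℝ) ^ (2 / 3 : ℝ)) ^ 3 = (n : ℝ) ^ 2 := by
    rw [← Real.rpow_natCast, ← Real.rpow_mul n.cast_nonneg]
    norm_num
  have h₂ : ((n : ℝ) ^ (2 / 3 : ℝ)) ^ 3 < ((D : ℝ) + 1) ^ 3 :=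
    pow_lt_pow_left₀ h (by positivity) (by norm_num)
  rw [h₁] at h₂
  exact_mod_cast h₂

theorem exists_phase_bound {n m : ℕ} (hn : 1 ≤ n) (hm : 1 ≤ m) : ∃ D : ℕ,
    (m < (D + 1) ^ 2 ∨ n ^ 2 < (D + 1) ^ 3) ∧
    (D : ℝ) + 1 ≤ 2 * min ((n : ℝ) ^ (2 / 3 : ℝ)) ((m : ℝ) ^ (1 / 2 : ℝ)) := by
  have h₁ : 1 ≤ (n : ℝ) ^ (2 / 3 : ℝ) := Real.one_le_rpow (by exact_mod_cast hn) (by norm_num)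
  have h₂ : 1 ≤ (m : ℝ) ^ (1 / 2 : ℝ) := Real.one_le_rpow (by exact_mod_cast hm) (by norm_num)
  have h₃ : (⌊(n : ℝ) ^ (2 / 3 : ℝ)⌋₊ : ℝ) ≤ (n : ℝ) ^ (2 / 3 : ℝ) := Nat.floor_le (by positivity)
  have h₄ : (m.sqrt : ℝ) ≤ (m : ℝ) ^ (1 / 2 : ℝ) := by
    rw [← Real.sqrt_eq_rpow]
    exact Real.nat_sqrt_le_real_sqrt
  -- Whichever term attains the minimum gives the corresponding alternative. Both real powers are at
  -- least `1`, so the summand `1` is absorbed by the factor `2`.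
  refine ⟨min ⌊(n : ℝ) ^ (2 / 3 : ℝ)⌋₊ m.sqrt, ?_, ?_⟩
  · rcases min_choice ⌊(n : ℝ) ^ (2 / 3 : ℝ)⌋₊ m.sqrt with h | h
    · rw [h]
      exact .inr (sq_lt_cube_of_rpow_lt (Nat.lt_floor_add_one _))
    · rw [h]
      exact .inl (Nat.lt_succ_sqrt' m)
  · have h₅ := min_le_min h₃ h₄
    have h₆ := le_min h₁ h₂
    push_cast
    linarith

theorem mainTheorem8 :
    ∃ C : ℝ, 0 < C ∧
      ∀ (n : ℕ) (G : SimpleGraph (Fin n)) (k : ℕ), 1 ≤ k → G.IsEdgeConnected k →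
      -- restoration in the graph itself
      (∀ (u v : Fin n), G.Adj u v → ∀ s : State, EncodesDeletion s G k u v →
        ∃ (s' : State) (t : ℕ) (G'' : SimpleGraph (Fin n)) (f : Fin n → Fin n → ℤ),
          Exec Prog.handleDeletion s s' t ∧
          (t : ℝ) ≤ C * (min ((n : ℝ) ^ (2 / 3 : ℝ)) ((G.edgeSet.ncard : ℝ) ^ (1 / 2 : ℝ)) *
            (G.edgeSet.ncard : ℝ)) ∧
          IsMaxUnitFlow (G.deleteEdges {s(u, v)}) u v f ∧
          (s'.reg .flow : ℤ) = flowValue u f ∧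
          IsRestoration G u v k f G'' ∧ Encodes s' G'') ∧
      -- restoration in the sparsified graph
      (∀ s₀ : State, Encodes s₀ G → s₀.reg .k = k → 1 ≤ G.edgeSet.ncard →
        ∃ (s₁ : State) (t₁ : ℕ) (H : SimpleGraph (Fin n)),
          Exec Prog.sparsify s₀ s₁ t₁ ∧
          (t₁ : ℝ) ≤ C * (G.edgeSet.ncard : ℝ) ∧
          Encodes s₁ H ∧ s₁.reg .k = k ∧
          H ≤ G ∧ H.edgeSet.ncard ≤ k * n ∧ H.IsEdgeConnected k ∧
          ∀ (u v : Fin n), G.Adj u v →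
            ∃ (s' : State) (t : ℕ) (H'' : SimpleGraph (Fin n)) (f : Fin n → Fin n → ℤ),
              Exec Prog.handleDeletion ((s₁.setReg .u u).setReg .v v) s' t ∧
              (t : ℝ) ≤ C * ((k : ℝ) * (n : ℝ) ^ (5 / 3 : ℝ)) ∧
              IsMaxUnitFlow (H.deleteEdges {s(u, v)}) u v f ∧
              (s'.reg .flow : ℤ) = flowValue u f ∧
              IsRestoration H u v k f H'' ∧ Encodes s' H'') := by
  -- `64000 = 8000 · 2 · 4`: the constant of `handleDeletion_runs`, the factor from
  -- `exists_phase_bound`, and `n + m + 1 ≤ 4m`, which follows from `n ≤ m + 1` and `m ≥ 1`.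
  refine ⟨64000, by norm_num, fun n G k hk hG => ⟨fun u v huv s hs => ?_, fun s hs hsk hm => ?_⟩⟩
  · have hn := le_ncard_edgeSet_add_one hk hG u
    have hm : 1 ≤ G.edgeSet.ncard := (Set.ncard_pos (Set.toFinite _)).2 ⟨s(u, v), huv⟩
    obtain ⟨D, hD, hDle⟩ := exists_phase_bound u.pos hm
    obtain ⟨s', t, he, ht, G'', f, hf⟩ := handleDeletion_runs huv.ne hs hD
    refine ⟨s', t, G'', f, he, ?_, hf⟩
    set M := min ((n : ℝ) ^ (2 / 3 : ℝ)) ((G.edgeSet.ncard : ℝ) ^ (1 / 2 : ℝ))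
    have hsize : ((n + G.edgeSet.ncard + 1 : ℕ) : ℝ) ≤ 4 * G.edgeSet.ncard := by
      exact_mod_cast (by omega : n + G.edgeSet.ncard + 1 ≤ 4 * G.edgeSet.ncard)
    calc (t : ℝ) ≤ 8000 * ((D + 1) * ((n + G.edgeSet.ncard + 1 : ℕ) : ℝ)) := by exact_mod_cast ht
      _ ≤ 8000 * (2 * M * (4 * G.edgeSet.ncard)) := by gcongr
      _ = 64000 * (M * G.edgeSet.ncard) := by ring
  · obtain ⟨hn, hE⟩ := encodes_iff.1 hs
    obtain ⟨e₀, he₀⟩ := (Set.ncard_pos (Set.toFinite _)).1 hm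
    have hn₀ : 0 < n := by
      induction e₀ with
      | _ x y => exact x.pos
    have hnm := le_ncard_edgeSet_add_one hk hG ⟨0, hn₀⟩
    obtain ⟨s₁, t₁, he, hf, ht₁, F, hFE, hF, hcard, hcut⟩ :=
      sparsify_runs hn hn₀ hsk hE (validEdges_natEdges G)
    obtain ⟨H, hHG, rfl⟩ := exists_graph_of_subset_natEdges hFE
    have hs₁ : Encodes s₁ H := encodes_iff.2 ⟨(hf.reg .n rfl).trans hn, hF⟩
    have hk₁ : s₁.reg .k = k := (hf.reg .k rfl).trans hsk
    rw [natEdges_ncard] at hcard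
    refine ⟨s₁, t₁, H, he, ?_, hs₁, hk₁, hHG, hcard, hcut.isEdgeConnected hG, fun u v huv => ?_⟩
    · rw [hs.numEdges] at ht₁
      exact_mod_cast (by omega : t₁ ≤ 64000 * G.edgeSet.ncard)
    · have hs₂ : EncodesDeletion ((s₁.setReg .u u).setReg .v v) H k u v :=
        ⟨encodes_iff.2 ⟨by simpa using hs₁.numNodes, by simpa [HasEdges] using hF⟩,
          by simpa using hk₁, by simp, by simp⟩
      -- Here `D = ⌊n^{2/3}⌋`. Only `u ≠ v` is required, so the case that the edge is missing from
      -- `H` is covered.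
      obtain ⟨s', t, he', ht, H'', f, hf'⟩ := handleDeletion_runs huv.ne hs₂
        (.inr (sq_lt_cube_of_rpow_lt (Nat.lt_floor_add_one _)))
      refine ⟨s', t, H'', f, he', ?_, hf'⟩
      have hn₁ : (1 : ℝ) ≤ n := by exact_mod_cast hn₀
      have h₁ : 1 ≤ (n : ℝ) ^ (2 / 3 : ℝ) := Real.one_le_rpow hn₁ (by norm_num)
      have h₂ : (⌊(n : ℝ) ^ (2 / 3 : ℝ)⌋₊ : ℝ) ≤ (n : ℝ) ^ (2 / 3 : ℝ) :=
        Nat.floor_le (by positivity)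
      have h₃ : (n : ℝ) ^ (2 / 3 : ℝ) * n = (n : ℝ) ^ (5 / 3 : ℝ) := by
        rw [← Real.rpow_add_one (by positivity)]
        norm_num
      -- Each of the three summands is at most `kn`, since `k ≥ 1` and `n ≥ 1`.
      have hsize : ((n + H.edgeSet.ncard + 1 : ℕ) : ℝ) ≤ 3 * (k * n) := by
        have : n ≤ k * n := Nat.le_mul_of_pos_left n hk
        exact_mod_cast (by omega : n + H.edgeSet.ncard + 1 ≤ 3 * (k * n))
      calc (t : ℝ) ≤ 8000 * ((⌊(n : ℝ) ^ (2 / 3 : ℝ)⌋₊ + 1) *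
            ((n + H.edgeSet.ncard + 1 : ℕ) : ℝ)) := by exact_mod_cast ht
        _ ≤ 8000 * (2 * (n : ℝ) ^ (2 / 3 : ℝ) * (3 * (k * n))) := by
          gcongr
          linarith
        _ = 48000 * (k * ((n : ℝ) ^ (2 / 3 : ℝ) * n)) := by ring
        _ ≤ 64000 * (k * (n : ℝ) ^ (5 / 3 : ℝ)) := by
          rw [h₃]
          gcongr
          norm_num
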